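/- Let $\mathbf C$ be an infinitary pretopos, i.e. a Barr exact category with small coproducts which are disjoint and stable under pullback. Formulas about elements of objects of $\mathbf C$ are understood for generalized elements, and $\exists$ means existence after passing to a cover (an epimorphism onto the domain). Let $R$ be a (not necessarily unital) associative ring object in $\mathbf C$ which is \emph{weakly unital}: there is a subobject $\mathcal E \subseteq R$ such that - $\mathcal E$ is closed under multiplication and central in $R$; - for all $\varepsilon, \eta \in \mathcal E$ there are $\zeta, \varepsilon', \eta' \in \mathcal E$ with $\varepsilon = \varepsilon' \zeta$ and $\eta = \eta' \zeta$; - the multiplications $\mathcal E \times \mathcal E \to \mathcal E$ and $R \times \mathcal E \to R$ are epimorphisms; - if $m \in R$, $\varepsilon \in \mathcal E$ and $m \varepsilon = 0$, then there are $\varepsilon', \varepsilon'' \in \mathcal E$ with $\varepsilon = \varepsilon' \varepsilon''$ and $m \varepsilon' = 0$. Let $\mathrm{St}(\mathsf A_3, R)$ be the group object in $\mathbf C$ with generators $x_{ij}(p)$ for distinct $i, j \in \{1, 2, 3, 4\}$ and $p \in R$, and relations $$x_{ij}(p)\, x_{ij}(q) = x_{ij}(p + q),$$ $$[x_{ij}(p),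 x_{jk}(q)] = x_{ik}(p q) \quad (i \neq k),$$ $$[x_{ij}(p), x_{kl}(q)] = 1 \quad (j \neq k,\ i \neq l),$$ where $[a, b] = a b a^{-1} b^{-1}$. Let $$R_{2 \varepsilon} = R / \langle 2 p,\ p q - q p,\ (p^2 - p)(q^2 - q) \mid p, q \in R \rangle,$$ where $\langle \ldots \rangle$ denotes the generated two-sided ideal. Both objects exist, being given by their universal properties. Moreover, $\mathrm{St}(\mathsf A_3, R)$ has a universal central extension $\kappa \colon \widetilde{\mathrm{St}} \to \mathrm{St}(\mathsf A_3, R)$ (a central extension is an epimorphic homomorphism of group objects with central kernel). Its kernel is the Schur multiplier of $\mathrm{St}(\mathsf A_3, R)$. There is a pairing $$\langle -, = \rangle \colon \mathrm{St}(\mathsf A_3, R) \times \mathrm{St}(\mathsf A_3, R) \to \widetilde{\mathrm{St}}, \qquad \kappa(\langle a, b \rangle) = [a, b], \quad \langle \kappa(x), \kappa(y) \rangle = [x, y].$$ For every permutation $i j k l$ of $\{1, 2, 3, 4\}$ there is a unique homomorphism $c_{ij \mid kl} \colon R \to \widetilde{\mathrm{St}}$ from the additive group of $R$ such that $$\langle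 x_{ij}(p), x_{kl}(q) \rangle = c_{ij \mid kl}(p q)$$ for all $p, q \in R$. The homomorphisms $c_{ij \mid kl} = c$ do not depend on the permutation, $c$ factors through a homomorphism from the additive group of $R_{2 \varepsilon}$, and the Schur multiplier of $\mathrm{St}(\mathsf A_3, R)$ is the image of $c$. -/

import Mathlib

open CategoryTheory Limits MonoidalCategory CartesianMonoidalCategory
open scoped MonObj AddMonObj commutatorElement

universe w v u

/-- An infinitary pretopos: a Barr exact category (regular, and every internal equivalence
relation is a kernel pair) with small coproducts which are disjoint and stable under pullback.
Here "small" refers to the universe `w`. -/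
class InfinitaryPretopos (C : Type u) [Category.{v} C] : Prop extends Regular C where
  isKernelPair_of_equivalenceRelation :
    ∀ {R X : C} (p₁ p₂ : R ⟶ X), IsEquivalenceRelation p₁ p₂ →
      ∃ (Y : C) (f : X ⟶ Y), IsKernelPair f p₁ p₂
  hasCoproducts : HasCoproducts.{w} C
  disjoint : ∀ {I : Type w} (X : I → C), CoproductDisjoint X
  universal : ∀ {I : Type w} (X : I → C) (c : Cofan X), IsColimit c → IsUniversalColimit c

section RingObjects

variable {C : Type u} [Category.{v} C] [CartesianMonoidalCategory C] [BraidedCategory C]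

/-- A non-unital associative ring object: a commutative additive group object with an associative
biadditive multiplication (the axioms are stated for generalized elements). -/
class NonUnitalRingObj (R : C) extends AddGrpObj R, IsCommAddMonObj R where
  /-- the multiplication morphism -/
  rmul : R ⊗ R ⟶ R
  rmul_assoc : ∀ {T : C} (p q r : T ⟶ R),
    lift (lift p q ≫ rmul) r ≫ rmul = lift p (lift q r ≫ rmul) ≫ rmul
  rmul_add : ∀ {T : C} (p q r : T ⟶ R),
    lift p (q + r) ≫ rmul = lift p q ≫ rmul + lift p r ≫ rmul
  add_rmul : ∀ {T : C} (p q r : T ⟶ R),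
    lift (p + q) r ≫ rmul = lift p r ≫ rmul + lift q r ≫ rmul

/-- The generalized elements of a ring object form a non-unital ring. -/
instance NonUnitalRingObj.homRing (T R : C) [NonUnitalRingObj R] : NonUnitalRing (T ⟶ R) where
  __ := (Hom.addCommGroup : AddCommGroup (T ⟶ R))
  mul p q := lift p q ≫ NonUnitalRingObj.rmul
  left_distrib := NonUnitalRingObj.rmul_add
  right_distrib := NonUnitalRingObj.add_rmul
  mul_assoc := NonUnitalRingObj.rmul_assoc
  zero_mul p := by
    have h := NonUnitalRingObj.add_rmul (0 : T ⟶ R) 0 p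
    rw [add_zero] at h
    exact left_eq_add.mp h
  mul_zero p := by
    have h := NonUnitalRingObj.rmul_add p (0 : T ⟶ R) 0
    rw [add_zero] at h
    exact left_eq_add.mp h

/-- Homomorphisms of non-unital ring objects. -/
structure IsNonUnitalRingHom {R S : C} [NonUnitalRingObj R] [NonUnitalRingObj S]
    (f : R ⟶ S) : Prop where
  map_add : ∀ {T : C} (p q : T ⟶ R), (p + q) ≫ f = p ≫ f + q ≫ f
  map_mul : ∀ {T : C} (p q : T ⟶ R), (p * q) ≫ f = (p ≫ f) * (q ≫ f)

/-- `E` is a weak unit of the ring object `R`. Existential quantifiers of the internal language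
are interpreted as usual: existence after passing to a cover, i.e. an epimorphism `T' ⟶ T`. -/
structure IsWeakUnit (R : C) [NonUnitalRingObj R] (E : Subobject R) : Prop where
  /-- `E` is a multiplicative subsemigroup and its multiplication is an epimorphism -/
  mul_epi : ∃ m : (E : C) ⊗ (E : C) ⟶ (E : C),
    m ≫ E.arrow = (E.arrow ⊗ₘ E.arrow) ≫ NonUnitalRingObj.rmul ∧ Epi m
  /-- `E` is central -/
  central : ∀ {T : C} (ε p : T ⟶ R), E.Factors ε → ε * p = p * ε
  /-- any two elements of `E` have a common divisor in `E` -/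
  common_divisor : ∀ {T : C} (ε θ : T ⟶ R), E.Factors ε → E.Factors θ →
    ∃ (T' : C) (e : T' ⟶ T) (ξ ε' θ' : T' ⟶ R), Epi e ∧
      E.Factors ξ ∧ E.Factors ε' ∧ E.Factors θ' ∧ e ≫ ε = ε' * ξ ∧ e ≫ θ = θ' * ξ
  /-- the multiplication `R × E → R` is an epimorphism -/
  smul_epi : Epi ((R ◁ E.arrow) ≫ NonUnitalRingObj.rmul)
  /-- if `m ε = 0`, then locally `ε = ε' ε''` with `m ε' = 0` -/
  torsion : ∀ {T : C} (m ε : T ⟶ R), E.Factors ε → m * ε = 0 →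
    ∃ (T' : C) (e : T' ⟶ T) (ε' ε'' : T' ⟶ R), Epi e ∧
      E.Factors ε' ∧ E.Factors ε'' ∧ e ≫ ε = ε' * ε'' ∧ (e ≫ m) * ε' = 0

/-- A ring object is weakly unital if it has a weak unit. -/
def IsWeaklyUnital (R : C) [NonUnitalRingObj R] : Prop :=
  ∃ E : Subobject R, IsWeakUnit R E

/-- The morphism `f` kills `2 p`, `p q - q p` and `(p² - p) (q² - q)` for all `p`, `q` in `R`. -/
def KillsTwoEps {R S : C} [NonUnitalRingObj R] [NonUnitalRingObj S] (f : R ⟶ S) : Prop :=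
  ∀ {T : C} (p q : T ⟶ R), (p + p) ≫ f = 0 ∧ (p * q - q * p) ≫ f = 0 ∧
    ((p * p - p) * (q * q - q)) ≫ f = 0

/-- `π : R ⟶ Q` is the factor-ring `R_{2ε} = R / ⟨2 p, p q - q p, (p² - p) (q² - q)⟩`, i.e.
the universal ring homomorphism killing these elements. -/
structure IsTwoEpsQuotient {R Q : C} [NonUnitalRingObj R] [NonUnitalRingObj Q]
    (π : R ⟶ Q) : Prop where
  isHom : IsNonUnitalRingHom π
  kills : KillsTwoEps π
  universal : ∀ (S : C) [NonUnitalRingObj S] (f : R ⟶ S), IsNonUnitalRingHom f →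
    KillsTwoEps f → ∃! g : Q ⟶ S, IsNonUnitalRingHom g ∧ π ≫ g = f

/-- A homomorphism from the additive group of a ring object to a (multiplicative) group object. -/
def IsAddToMulHom {R G : C} [NonUnitalRingObj R] [GrpObj G] (c : R ⟶ G) : Prop :=
  ∀ {T : C} (p q : T ⟶ R), (p + q) ≫ c = (p ≫ c) * (q ≫ c)

/-- A family `x i j : R ⟶ G`, where `i ≠ j` are elements of `Fin n`, satisfying the Steinberg
relations of type `A_{n-1}`. -/
structure SteinbergRelations {n : ℕ} {R G : C} [NonUnitalRingObj R] [GrpObj G]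
    (x : ∀ i j : Fin n, i ≠ j → (R ⟶ G)) : Prop where
  map_add : ∀ (i j : Fin n) (hij : i ≠ j) {T : C} (p q : T ⟶ R),
    (p ≫ x i j hij) * (q ≫ x i j hij) = (p + q) ≫ x i j hij
  comm_mul : ∀ (i j k : Fin n) (hij : i ≠ j) (hjk : j ≠ k) (hik : i ≠ k) {T : C} (p q : T ⟶ R),
    ⁅p ≫ x i j hij, q ≫ x j k hjk⁆ = (p * q) ≫ x i k hik
  comm_one : ∀ (i j k l : Fin n) (hij : i ≠ j) (hkl : k ≠ l), j ≠ k → i ≠ l →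
    ∀ {T : C} (p q : T ⟶ R), ⁅p ≫ x i j hij, q ≫ x k l hkl⁆ = 1

/-- The group object `G` with the morphisms `x i j` is the Steinberg group `St(A_{n-1}, R)`: it is
given by the generators `x i j p` and the Steinberg relations. -/
structure IsSteinbergGroup {n : ℕ} {R G : C} [NonUnitalRingObj R] [GrpObj G]
    (x : ∀ i j : Fin n, i ≠ j → (R ⟶ G)) : Prop where
  relations : SteinbergRelations x
  universal : ∀ (H : C) [GrpObj H] (y : ∀ i j : Fin n, i ≠ j → (R ⟶ H)), SteinbergRelations y →
    ∃! f : G ⟶ H, IsMonHom f ∧ ∀ (i j : Fin n) (hij : i ≠ j), x i j hij ≫ f = y i j hij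

end RingObjects

section CentralExtensions

variable {C : Type u} [Category.{v} C] [CartesianMonoidalCategory C]

/-- A central extension: an epimorphic homomorphism with central kernel. -/
structure IsCentralExtension {H G : C} [GrpObj H] [GrpObj G] (f : H ⟶ G) : Prop where
  isHom : IsMonHom f
  epi : Epi f
  central : ∀ {T : C} (z h : T ⟶ H), z ≫ f = 1 → z * h = h * z

/-- A universal central extension. -/
structure IsUniversalCentralExtension {H G : C} [GrpObj H] [GrpObj G] (κ : H ⟶ G) : Prop where
  isCentralExtension : IsCentralExtension κ
  universal : ∀ (X : C) [GrpObj X] (d : X ⟶ G), IsCentralExtension d →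
    ∃! f : H ⟶ X, IsMonHom f ∧ f ≫ d = κ

/-- The kernel of `κ : H ⟶ G`. If `κ` is the universal central extension of `G`, this is the Schur
multiplier of `G`. -/
noncomputable def kernelOf [HasPullbacks C] {H G : C} [GrpObj H] [GrpObj G] (κ : H ⟶ G) :
    Subobject H :=
  (Subobject.pullback κ).obj (Subobject.mk η[G])

/-- `B` is the pairing `⟨-, =⟩ : G × G ⟶ H` associated with the central extension `κ : H ⟶ G`,
i.e. `κ ⟨a, b⟩ = [a, b]` and `⟨κ x, κ y⟩ = [x, y]`. -/
structure IsCommutatorPairing {H G : C} [GrpObj H] [GrpObj G] (κ : H ⟶ G)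
    (B : G ⊗ G ⟶ H) : Prop where
  comp : ∀ {T : C} (a b : T ⟶ G), lift a b ≫ B ≫ κ = ⁅a, b⁆
  lift_comp : ∀ {T : C} (x y : T ⟶ H), lift (x ≫ κ) (y ≫ κ) ≫ B = ⁅x, y⁆

end CentralExtensions

/-- `c : R ⟶ H` is the homomorphism `c_{ij|kl}`, i.e. `⟨x i j p, x k l q⟩ = c (p q)`. -/
structure IsRootPairing {C : Type u} [Category.{v} C] [CartesianMonoidalCategory C]
    [BraidedCategory C] {n : ℕ} {R G H : C} [NonUnitalRingObj R] [GrpObj G] [GrpObj H]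
    (x : ∀ i j : Fin n, i ≠ j → (R ⟶ G)) (B : G ⊗ G ⟶ H)
    (i j k l : Fin n) (hij : i ≠ j) (hkl : k ≠ l) (c : R ⟶ H) : Prop where
  isHom : IsAddToMulHom c
  pairing : ∀ {T : C} (p q : T ⟶ R),
    lift (p ≫ x i j hij) (q ≫ x k l hkl) ≫ B = (p * q) ≫ c

/-!
The objects in question are quotients of presheaves which are small coproducts of representables
(words in the generators, elements of `R`) by small relations; the congruences generated by such
relations are unions of countably many stages, hence small again, and exactness together with
extensivity provides the quotients. A statement about generalized elements can then be checked
locally, where every element of `R` is a product.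

Let `d` be a central extension of `St(A₃, R)` with commutator pairing `B`. On disjoint roots `B` is
biadditive and balanced, `⟨x i j (p * q), x k l r⟩ = ⟨x i j p, x k l (q * r)⟩`, so it is given by
homomorphisms `c i j k l` applied to the product. Moving factors through the pairing in different
ways shows that they all agree with one `c`, which satisfies `2 c = 0` and does not see the order of
factors. Hence equations between values of `c` can be checked in commutative rings of characteristic
two.
On adjacent roots `B` is biadditive but not balanced. The deviation consists of values of `c`, and
comparing two ways to compute it shows that `c` kills the ideal defining `R_{2ε}`.
After multiplication by `c (p * (q * q - q))` the pairing on `x i j p`, `x j k q` becomes balanced,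
so it is given by a homomorphism `y i j k` applied to `p * q`, which lifts `x i k`.

The relations between the `y i j k` and `c` present a group object over `St(A₃, R)`. In it the image
of `c` is central, and the quotient by this image satisfies the Steinberg relations, so the kernel
of the projection is the image of `c`. It maps to every central extension by the above, and uniquely
since its generators are determined by commutators. It is therefore the universal central extension.
-/

section Covers

variable {C : Type u} [Category.{v} C]

/-- A jointly extremal epimorphic family: it does not factor through a proper subobject. -/
def IsCover {A : Type*} {T : C} (X : A → C) (e : ∀ a, X a ⟶ T) : Prop :=
  ∀ ⦃S : C⦄ (m : S ⟶ T), Mono m → (∀ a, ∃ g, g ≫ m = e a) → IsIso m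

lemma isCover_of_strongEpi {T T' : C} (e : T' ⟶ T) [StrongEpi e] :
    IsCover (fun _ : PUnit.{w + 1} => T') fun _ => e := fun _ m _ hm =>
  have ⟨g, hg⟩ := hm ⟨⟩
  ExtremalEpi.isIso e g m hg

lemma isCover_sigma_ι {A : Type*} (X : A → C) [HasCoproduct X] : IsCover X (Sigma.ι X) := by
  intro S m _ hm
  choose g hg using hm
  have : Sigma.desc g ≫ m = 𝟙 _ := by
    ext a
    simp [hg]
  have := IsSplitEpi.mk' ⟨_, this⟩
  exact isIso_of_mono_of_isSplitEpi m

lemma IsCover.of_isInitial {T : C} (h : IsInitial T) (X : PEmpty.{w + 1} → C)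
    (e : ∀ a, X a ⟶ T) : IsCover X e := by
  intro S m _ _
  have := IsSplitEpi.mk' (f := m) ⟨h.to S, h.hom_ext _ _⟩
  exact isIso_of_mono_of_isSplitEpi m

lemma IsCover.isRegularEpi_desc [Regular C] {A : Type*} {T : C} {X : A → C} [HasCoproduct X]
    {e : ∀ a, X a ⟶ T} (h : IsCover X e) : IsRegularEpi (Sigma.desc e) := by
  have : ExtremalEpi (Sigma.desc e) := .mk_of_hasEqualizers _ fun Z p i hp _ =>
    h i inferInstance fun a => ⟨Sigma.ι X a ≫ p, by simp [hp]⟩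
  infer_instance

lemma IsCover.factors [HasPullbacks C] {A : Type*} {T Z S : C} {X : A → C} {e : ∀ a, X a ⟶ T}
    (h : IsCover X e) {f : T ⟶ Z} (m : S ⟶ Z) [Mono m] (hf : ∀ a, ∃ g, g ≫ m = e a ≫ f) :
    ∃ g, g ≫ m = f := by
  have : IsIso (pullback.snd m f) := h _ inferInstance fun a => by
    obtain ⟨g, hg⟩ := hf a
    exact ⟨pullback.lift g (e a) hg, pullback.lift_snd _ _ _⟩
  exact ⟨inv (pullback.snd m f) ≫ pullback.fst m f, by simp [pullback.condition]⟩

lemma IsCover.comp [HasPullbacks C] {A : Type*} {T : C} {X : A → C} {e : ∀ a, X a ⟶ T}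
    (h : IsCover X e) {B : A → Type*} {Y : ∀ a, B a → C} {e' : ∀ a b, Y a b ⟶ X a}
    (h' : ∀ a, IsCover (Y a) (e' a)) :
    IsCover (fun x : Σ a, B a => Y x.1 x.2) fun x => e' x.1 x.2 ≫ e x.1 := fun _ m _ hm =>
  h m inferInstance fun a => (h' a).factors m fun b => hm ⟨a, b⟩

attribute [instance] InfinitaryPretopos.hasCoproducts InfinitaryPretopos.disjoint

variable [InfinitaryPretopos.{w} C]

lemma IsCover.pullback {A : Type w} {T T' : C} {X : A → C} {e : ∀ a, X a ⟶ T}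
    (h : IsCover X e) (f : T' ⟶ T) :
    IsCover (fun a => pullback f (e a)) (fun a => pullback.fst f (e a)) := by
  intro S m _ hm
  choose g hg using hm
  let d : Cofan (fun a => Limits.pullback f (e a)) :=
    Cofan.mk (Limits.pullback f (Sigma.desc e)) fun a =>
      pullback.lift (pullback.fst f (e a)) (pullback.snd f (e a) ≫ Sigma.ι X a)
        (by simp [pullback.condition])
  obtain ⟨hd⟩ : Nonempty (IsColimit d) :=
    have hX : IsUniversalColimit _ := InfinitaryPretopos.universal X _ (coproductIsCoproduct X)
    hX.nonempty_isColimit_of_isPullback_left e (Sigma.desc e) f (fun a => pullback.fst f (e a))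
      (fun a => pullback.snd f (e a)) (fun a => IsPullback.of_hasPullback f (e a))
      (IsPullback.of_hasPullback f (Sigma.desc e)) d (Iso.refl _)
      (fun a => by simp)
      (fun a => (congrArg _ (Category.id_comp _)).trans (pullback.lift_fst _ _ _))
      (fun a => (congrArg _ (Category.id_comp _)).trans (pullback.lift_snd _ _ _))
  have := h.isRegularEpi_desc
  refine ExtremalEpi.isIso (pullback.fst f (Sigma.desc e)) (Cofan.IsColimit.desc hd g) m ?_
  refine Cofan.IsColimit.hom_ext hd _ _ fun a => ?_
  rw [Cofan.IsColimit.fac_assoc, hg]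
  exact (pullback.lift_fst _ _ _).symm

variable (C) in
/-- The canonical topology of an infinitary pretopos: a sieve is covering if it contains a small
covering family. -/
def coverTopology : GrothendieckTopology C where
  sieves T := {S | ∃ (A : Type w) (X : A → C) (e : ∀ a, X a ⟶ T), IsCover X e ∧ ∀ a, S (e a)}
  top_mem' T := ⟨PUnit, _, _, isCover_of_strongEpi (𝟙 T), fun _ => trivial⟩
  pullback_stable' := by
    rintro T T' S f ⟨A, X, e, hc, he⟩
    refine ⟨A, _, _, hc.pullback f, fun a => ?_⟩
    rw [Sieve.pullback_apply, pullback.condition]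
    exact S.downward_closed (he a) _
  transitive' := by
    rintro T S ⟨A, X, e, hc, he⟩ S' h
    choose B Y e' hc' he' using fun a => h (he a)
    exact ⟨Σ a, B a, _, _, hc.comp hc', fun x => he' _ _⟩

/-- The statement `P` about morphisms to `T` holds locally on `T`, i.e. on a covering sieve. -/
def Locally (T : C) (P : ∀ ⦃T' : C⦄, (T' ⟶ T) → Prop) : Prop :=
  ∃ S ∈ coverTopology.{w} C T, ∀ ⦃T' : C⦄ (e : T' ⟶ T), S e → P e

namespace Locally

variable {T : C} {P Q : ∀ ⦃T' : C⦄, (T' ⟶ T) → Prop}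

lemma mono (h : Locally.{w} T P) (hPQ : ∀ ⦃T' : C⦄ (e : T' ⟶ T), P e → Q e) : Locally.{w} T Q :=
  have ⟨S, hS, hP⟩ := h
  ⟨S, hS, fun _ e he => hPQ e (hP e he)⟩

lemma of_forall (h : ∀ ⦃T' : C⦄ (e : T' ⟶ T), P e) : Locally.{w} T P :=
  ⟨⊤, (coverTopology.{w} C).top_mem T, fun _ e _ => h e⟩

lemma and (h : Locally.{w} T P) (h' : Locally.{w} T Q) : Locally.{w} T fun _ e => P e ∧ Q e :=
  have ⟨S, hS, hP⟩ := h
  have ⟨S', hS', hQ⟩ := h'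
  ⟨S ⊓ S', (coverTopology.{w} C).intersection_covering hS hS', fun _ e he =>
    ⟨hP e he.1, hQ e he.2⟩⟩

lemma trans (h : Locally.{w} T fun T' e => Locally.{w} T' fun _ e' => P (e' ≫ e)) :
    Locally.{w} T P := by
  obtain ⟨S, hS, hP⟩ := h
  choose S' hS' hP' using hP
  refine ⟨Sieve.bind S fun _ e he => S' e he, (coverTopology.{w} C).bind_covering hS
    fun _ _ he => hS' _ he, ?_⟩
  rintro T' _ ⟨T'', e', e, he, he', rfl⟩
  exact hP' e he e' he'

lemma of_isCover {A : Type w} {X : A → C} {e : ∀ a, X a ⟶ T} (hc : IsCover X e)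
    (h : ∀ a ⦃T' : C⦄ (f : T' ⟶ X a), P (f ≫ e a)) : Locally.{w} T P := by
  refine ⟨Sieve.generate (Presieve.ofArrows X e), ⟨A, X, e, hc, fun a => ?_⟩, ?_⟩
  · exact Sieve.le_generate _ _ _ (Presieve.ofArrows.mk a)
  · rintro T' _ ⟨_, f, _, ⟨a⟩, rfl⟩
    exact h a f

lemma of_strongEpi {T' : C} (e : T' ⟶ T) [StrongEpi e]
    (h : ∀ ⦃T'' : C⦄ (f : T'' ⟶ T'), P (f ≫ e)) : Locally.{w} T P :=
  of_isCover (isCover_of_strongEpi e) fun _ => h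

lemma exists_isCover (h : Locally.{w} T P) :
    ∃ (A : Type w) (X : A → C) (e : ∀ a, X a ⟶ T), IsCover X e ∧ ∀ a, P (e a) :=
  have ⟨_, ⟨A, X, e, hc, he⟩, hP⟩ := h
  ⟨A, X, e, hc, fun a => hP _ (he a)⟩

lemma factors {Z S : C} {f : T ⟶ Z} (m : S ⟶ Z) [Mono m]
    (h : Locally.{w} T fun _ e => ∃ g, g ≫ m = e ≫ f) : ∃ g, g ≫ m = f :=
  have ⟨_, _, _, hc, h⟩ := h.exists_isCover
  hc.factors m h

lemma eq {Z : C} {f g : T ⟶ Z} (h : Locally.{w} T fun _ e => e ≫ f = e ≫ g) : f = g := by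
  obtain ⟨k, hk⟩ := factors (f := 𝟙 T) (equalizer.ι f g) <|
    h.mono fun _ e he => ⟨equalizer.lift e he, by simp⟩
  rw [← Category.id_comp f, ← hk, Category.assoc, equalizer.condition, reassoc_of% hk]

end Locally

lemma IsCover.locally_exists_fac {A : Type w} {T T' : C} {X : A → C} {e : ∀ a, X a ⟶ T}
    (hc : IsCover X e) (f : T' ⟶ T) :
    Locally.{w} T' fun T'' e' => ∃ (a : A) (x : T'' ⟶ X a), x ≫ e a = e' ≫ f :=
  .of_isCover (hc.pullback f) fun a _ g =>
    ⟨a, g ≫ pullback.snd f (e a), by simp [pullback.condition]⟩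

lemma locally_exists_fac_of_strongEpi {T X Y : C} (p : X ⟶ Y) [StrongEpi p] (f : T ⟶ Y) :
    Locally.{w} T fun T' e => ∃ g : T' ⟶ X, g ≫ p = e ≫ f :=
  ((isCover_of_strongEpi p).locally_exists_fac f).mono fun _ _ ⟨_, g, hg⟩ => ⟨g, hg⟩

lemma locally_of_sigma_ι_eq {A : Type w} (X : A → C) {T : C} {a b : A} (x : T ⟶ X a) (y : T ⟶ X b)
    (h : x ≫ Sigma.ι X a = y ≫ Sigma.ι X b) :
    Locally.{w} T fun T' e => (⟨a, e ≫ x⟩ : Σ a, (T' ⟶ X a)) = ⟨b, e ≫ y⟩ := by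
  by_cases hab : a = b
  · subst hab
    rw [cancel_mono] at h
    exact .of_forall fun _ _ => by rw [h]
  · have hi := IsInitial.ofCoproductDisjoint (X := X) hab
    exact .of_isCover ((IsCover.of_isInitial hi PEmpty.elim fun a => a.elim).pullback
      (pullback.lift x y h)) fun a => a.elim

lemma IsCover.exists_desc {A : Type w} {V Z : C} {X : A → C} {e : ∀ a, X a ⟶ V}
    (hc : IsCover X e) (z : ∀ a, X a ⟶ Z)
    (h : ∀ ⦃T : C⦄ (a b : A) (x : T ⟶ X a) (y : T ⟶ X b),
      x ≫ e a = y ≫ e b → x ≫ z a = y ≫ z b) :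
    ∃ g : V ⟶ Z, ∀ a, e a ≫ g = z a := by
  have := hc.isRegularEpi_desc
  have hw : IsRegularEpi.left (Sigma.desc e) ≫ Sigma.desc z =
      IsRegularEpi.right (Sigma.desc e) ≫ Sigma.desc z := by
    apply Locally.eq.{w}
    refine (((isCover_sigma_ι X).locally_exists_fac (IsRegularEpi.left (Sigma.desc e))).and
      ((isCover_sigma_ι X).locally_exists_fac (IsRegularEpi.right (Sigma.desc e)))).mono ?_
    rintro T' e' ⟨⟨a, x, hx⟩, ⟨b, y, hy⟩⟩
    have hxy := congr(e' ≫ $(IsRegularEpi.w (Sigma.desc e)))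
    rw [← reassoc_of% hx, ← reassoc_of% hy] at hxy ⊢
    simp only [Sigma.ι_desc] at hxy ⊢
    exact h a b x y hxy
  refine ⟨IsRegularEpi.desc (Sigma.desc e) (Sigma.desc z) hw, fun a => ?_⟩
  rw [← Sigma.ι_desc e a, Category.assoc, IsRegularEpi.fac, Sigma.ι_desc]

lemma exists_glue {V Z : C} (S : ∀ ⦃T : C⦄, (T ⟶ V) → (T ⟶ Z) → Prop)
    (nat : ∀ ⦃T T' : C⦄ (f : T' ⟶ T) (s : T ⟶ V) (z : T ⟶ Z), S s z → S (f ≫ s) (f ≫ z))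
    (single : ∀ ⦃T : C⦄ (s : T ⟶ V) (z z' : T ⟶ Z), S s z → S s z' → z = z')
    (cov : Locally.{w} V fun _ e => ∃ z, S e z) :
    ∃ g : V ⟶ Z, ∀ ⦃T : C⦄ (s : T ⟶ V) (z : T ⟶ Z), S s z → s ≫ g = z := by
  obtain ⟨A, X, e, hc, hz⟩ := cov.exists_isCover
  choose z hz using hz
  obtain ⟨g, hg⟩ := hc.exists_desc z fun T a b x y h =>
    single _ _ _ (nat x _ _ (hz a)) (h ▸ nat y _ _ (hz b))
  refine ⟨g, fun T s t h => Locally.eq.{w} <| (hc.locally_exists_fac s).mono ?_⟩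
  rintro T' e' ⟨a, x, hx⟩
  rw [← reassoc_of% hx, hg]
  exact single _ _ _ (nat x _ _ (hz a)) (hx ▸ nat e' _ _ h)

end Covers

section Quotients

universe t

variable {C : Type u} [Category.{v} C]

/-- A relation on the elements of the presheaf `D`. -/
abbrev PresheafRel (D : Cᵒᵖ ⥤ Type t) : Type (max u t) :=
  ∀ ⦃T : C⦄, D.obj (.op T) → D.obj (.op T) → Prop

/-- The presheaf `D` is a small coproduct of representable presheaves. -/
def IsFamiliallyRepresentable (D : Cᵒᵖ ⥤ Type t) : Prop :=
  ∃ (A : Type w) (U : A → C) (s : ∀ a, D.obj (.op (U a))), ∀ ⦃T : C⦄ (x : D.obj (.op T)),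
    ∃! p : Σ a, (T ⟶ U a), D.map p.2.op (s p.1) = x

/-- The relation `ρ` on the presheaf `D` is stable under restriction and is the image of a small
coproduct of representable presheaves. -/
structure IsSmallRel (D : Cᵒᵖ ⥤ Type t) (ρ : PresheafRel D) : Prop where
  res : ∀ ⦃T T' : C⦄ (f : T' ⟶ T) (x y : D.obj (.op T)), ρ x y → ρ (D.map f.op x) (D.map f.op y)
  small : ∃ (A : Type w) (V : A → C) (x y : ∀ a, D.obj (.op (V a))), (∀ a, ρ (x a) (y a)) ∧
    ∀ ⦃T : C⦄ (p q : D.obj (.op T)), ρ p q →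
      ∃ (a : A) (f : T ⟶ V a), D.map f.op (x a) = p ∧ D.map f.op (y a) = q

lemma isEquivalenceRelation_of_equivalence_factors [CartesianMonoidalCategory C] [HasPullbacks C]
    {I U : C} (m : I ⟶ U ⊗ U) [Mono m]
    (h : ∀ ⦃T : C⦄, Equivalence fun p q : T ⟶ U => ∃ g, g ≫ m = lift p q) :
    IsEquivalenceRelation (m ≫ fst _ _) (m ≫ snd _ _) := by
  have hm : ∀ ⦃T : C⦄ (g : T ⟶ I), ∃ g', g' ≫ m = lift (g ≫ m ≫ fst _ _) (g ≫ m ≫ snd _ _) :=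
    fun T g => ⟨g, by ext <;> simp⟩
  obtain ⟨r, hr⟩ := h.refl (𝟙 U)
  obtain ⟨s, hs⟩ := h.symm (hm (𝟙 I))
  obtain ⟨t, ht⟩ := h.trans (hm (pullback.fst (m ≫ snd _ _) (m ≫ fst _ _)))
    (by rw [pullback.condition]; exact hm _)
  exact ⟨⟨{
    right_cancellation := fun Y f g h₁ h₂ => by
      rw [← cancel_mono m]
      ext
      · simpa using h₁
      · simpa using h₂
    r := r
    reflexivity₁ := by simp [reassoc_of% hr]
    reflexivity₂ := by simp [reassoc_of% hr]
    s := s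
    symmetry₁ := by simp [reassoc_of% hs]
    symmetry₂ := by simp [reassoc_of% hs]
    c := _
    isLimit := pullbackIsPullback _ _
    t := t
    transitivity₁ := (Category.assoc _ _ _).symm.trans
      ((congrArg (· ≫ fst _ _) ht).trans (lift_fst _ _))
    transitivity₂ := (Category.assoc _ _ _).symm.trans
      ((congrArg (· ≫ snd _ _) ht).trans (lift_snd _ _)) }⟩⟩

variable [InfinitaryPretopos.{w} C]

/-- The object `Q` is the quotient of the presheaf `D` by the relation `ρ` in the internal sense:
`π` is locally surjective and identifies exactly the elements which are locally related. -/
structure IsLocalQuotient (D : Cᵒᵖ ⥤ Type t) (ρ : PresheafRel D) (Q : C)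
    (π : ∀ ⦃T : C⦄, D.obj (.op T) → (T ⟶ Q)) : Prop where
  comp : ∀ ⦃T T' : C⦄ (f : T' ⟶ T) (x : D.obj (.op T)), f ≫ π x = π (D.map f.op x)
  eq_iff : ∀ ⦃T : C⦄ (x y : D.obj (.op T)), π x = π y ↔
    Locally.{w} T fun _ e => ρ (D.map e.op x) (D.map e.op y)
  surj : ∀ ⦃T : C⦄ (q : T ⟶ Q), Locally.{w} T fun _ e => ∃ x, π x = e ≫ q

/-- The relation between generalized elements of `U` induced by a relation `ρ` on a presheaf along
a map `π` to `U`. -/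
def LocallyRelated {D : Cᵒᵖ ⥤ Type t} (ρ : PresheafRel D) {U : C}
    (π : ∀ ⦃T : C⦄, D.obj (.op T) → (T ⟶ U)) ⦃T : C⦄ (a b : T ⟶ U) : Prop :=
  Locally.{w} T fun _ e => ∃ x y, ρ x y ∧ π x = e ≫ a ∧ π y = e ≫ b

section

variable {D : Cᵒᵖ ⥤ Type t} {ρ : PresheafRel D}

lemma IsLocalQuotient.sound {Q : C} {π : ∀ ⦃T : C⦄, D.obj (.op T) → (T ⟶ Q)}
    (h : IsLocalQuotient.{w} D ρ Q π)
    (hres : ∀ ⦃T T' : C⦄ (f : T' ⟶ T) (x y : D.obj (.op T)), ρ x y →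
      ρ (D.map f.op x) (D.map f.op y))
    {T : C} {x y : D.obj (.op T)} (hxy : ρ x y) : π x = π y :=
  (h.eq_iff _ _).2 (.of_forall fun _ e => hres e _ _ hxy)

lemma IsLocalQuotient.equivalence_locallyRelated {U : C} {π : ∀ ⦃T : C⦄, D.obj (.op T) → (T ⟶ U)}
    (h : IsLocalQuotient.{w} D (fun _ => Eq) U π)
    (hres : ∀ ⦃T T' : C⦄ (f : T' ⟶ T) (x y : D.obj (.op T)), ρ x y →
      ρ (D.map f.op x) (D.map f.op y))
    (he : ∀ ⦃T : C⦄, Equivalence (ρ (T := T))) ⦃T : C⦄ :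
    Equivalence (LocallyRelated.{w} ρ π (T := T)) := by
  refine ⟨fun a => (h.surj a).mono ?_, fun hab => hab.mono ?_, fun {a b c} hab hbc =>
    ((hab.and hbc).mono ?_).trans⟩
  · rintro T' e ⟨x, hx⟩
    exact ⟨x, x, he.refl x, hx, hx⟩
  · rintro T' e ⟨x, y, hxy, hx, hy⟩
    exact ⟨y, x, he.symm hxy, hy, hx⟩
  · rintro T' e ⟨⟨x, y, hxy, hx, hy⟩, ⟨y', z, hyz, hy', hz⟩⟩
    refine ((h.eq_iff y y').1 (hy.trans hy'.symm)).mono fun T'' e' hyy' =>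
      ⟨D.map e'.op x, D.map e'.op z, he.trans (hres e' _ _ hxy) ?_, ?_, ?_⟩
    · rw [hyy']
      exact hres e' _ _ hyz
    · rw [← h.comp, hx, Category.assoc]
    · rw [← h.comp, hz, Category.assoc]

lemma IsLocalQuotient.locallyRelated_iff {U : C} {π : ∀ ⦃T : C⦄, D.obj (.op T) → (T ⟶ U)}
    (h : IsLocalQuotient.{w} D (fun _ => Eq) U π)
    (hres : ∀ ⦃T T' : C⦄ (f : T' ⟶ T) (x y : D.obj (.op T)), ρ x y →
      ρ (D.map f.op x) (D.map f.op y)) {T : C} (x y : D.obj (.op T)) :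
    LocallyRelated.{w} ρ π (π x) (π y) ↔
      Locally.{w} T fun _ e => ρ (D.map e.op x) (D.map e.op y) := by
  refine ⟨fun hxy => (hxy.mono ?_).trans, fun hxy => hxy.mono fun T' e hρ =>
    ⟨_, _, hρ, (h.comp e x).symm, (h.comp e y).symm⟩⟩
  rintro T' e ⟨x', y', hρ, hx, hy⟩
  rw [h.comp, h.eq_iff] at hx hy
  refine (hx.and hy).mono ?_
  rintro T'' e' ⟨hx', hy'⟩
  simp only [op_comp, Functor.map_comp, ConcreteCategory.comp_apply]
  rw [← hx', ← hy']
  exact hres _ _ _ hρ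

lemma IsFamiliallyRepresentable.exists_isLocalQuotient_eq (hD : IsFamiliallyRepresentable.{w} D) :
    ∃ (U : C) (π : ∀ ⦃T : C⦄, D.obj (.op T) → (T ⟶ U)),
      IsLocalQuotient.{w} D (fun _ => Eq) U π := by
  obtain ⟨A, U, s, hs⟩ := hD
  choose p hp hp' using hs
  have hres : ∀ ⦃T T' : C⦄ (f : T' ⟶ T) (x : D.obj (.op T)),
      p (D.map f.op x) = ⟨(p x).1, f ≫ (p x).2⟩ := fun T T' f x =>
    (hp' (D.map f.op x) ⟨(p x).1, f ≫ (p x).2⟩ (by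
      simp only [op_comp, Functor.map_comp, ConcreteCategory.comp_apply]
      rw [hp])).symm
  refine ⟨∐ U, fun T x => (p x).2 ≫ Sigma.ι U (p x).1, ⟨fun T T' f x => ?_, fun T x y =>
    ⟨fun h => (locally_of_sigma_ι_eq U _ _ h).mono fun T' e h => ?_, fun h => Locally.eq <|
      h.mono fun T' e h => ?_⟩, fun T q => ((isCover_sigma_ι U).locally_exists_fac q).mono ?_⟩⟩
  · rw [hres, Category.assoc]
  · rw [← hres e x, ← hres e y] at h
    rw [← hp (D.map e.op x), ← hp (D.map e.op y), h]
  · have h' := congr(p $h)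
    rw [hres, hres] at h'
    simp only [← Category.assoc]
    exact congr($(h').2 ≫ Sigma.ι U $(h').1)
  · rintro T' e ⟨a, x, hx⟩
    refine ⟨D.map x.op (s a), ?_⟩
    rw [← hx, ← hp' (D.map x.op (s a)) ⟨a, x⟩ rfl]

end

lemma exists_mono_factors_iff_locally {A : Type w} (V : A → C) {Z : C} (f : ∀ a, V a ⟶ Z) :
    ∃ (I : C) (m : I ⟶ Z), Mono m ∧ ∀ ⦃T : C⦄ (z : T ⟶ Z), (∃ g, g ≫ m = z) ↔
      Locally.{w} T fun T' e => ∃ (a : A) (x : T' ⟶ V a), x ≫ f a = e ≫ z := by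
  let F := Regular.strongEpiMonoFactorisation (Sigma.desc f)
  have hF (a : A) : (Sigma.ι V a ≫ F.e) ≫ F.m = f a := by simp [F]
  refine ⟨F.I, F.m, inferInstance, fun T z => ⟨?_, fun h => Locally.factors F.m (h.mono ?_)⟩⟩
  · rintro ⟨g, rfl⟩
    refine ((locally_exists_fac_of_strongEpi F.e g).mono fun T' e ⟨s, hs⟩ => ?_).trans
    refine ((isCover_sigma_ι V).locally_exists_fac s).mono ?_
    rintro T'' e' ⟨a, x, hx⟩
    refine ⟨a, x, ?_⟩
    rw [← hF, Category.assoc, reassoc_of% hx, reassoc_of% hs, Category.assoc]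
  · rintro T' e ⟨a, x, hx⟩
    exact ⟨x ≫ Sigma.ι V a ≫ F.e, by rw [Category.assoc, hF, hx]⟩

variable [CartesianMonoidalCategory C]

lemma exists_strongEpi_comp_eq_iff_factors {I U : C} (m : I ⟶ U ⊗ U) [Mono m]
    (h : ∀ ⦃T : C⦄, Equivalence fun p q : T ⟶ U => ∃ g, g ≫ m = lift p q) :
    ∃ (Q : C) (π : U ⟶ Q), StrongEpi π ∧
      ∀ ⦃T : C⦄ (p q : T ⟶ U), p ≫ π = q ≫ π ↔ ∃ g, g ≫ m = lift p q := by
  obtain ⟨Y, f, hf⟩ := InfinitaryPretopos.isKernelPair_of_equivalenceRelation.{w} _ _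
    (isEquivalenceRelation_of_equivalence_factors m h)
  let F := Regular.strongEpiMonoFactorisation f
  refine ⟨F.I, F.e, inferInstance, fun T p q => ?_⟩
  rw [← cancel_mono F.m, Category.assoc, Category.assoc, F.fac]
  refine ⟨fun h => ⟨hf.lift p q h, ?_⟩, ?_⟩
  · ext
    · simp [IsKernelPair.lift_fst]
    · simp [IsKernelPair.lift_snd]
  · rintro ⟨g, hg⟩
    simpa [reassoc_of% hg] using congr(g ≫ $(hf.w))

theorem IsSmallRel.exists_isLocalQuotient {D : Cᵒᵖ ⥤ Type t} {ρ : PresheafRel D}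
    (hρ : IsSmallRel.{w} D ρ) (hD : IsFamiliallyRepresentable.{w} D)
    (he : ∀ ⦃T : C⦄, Equivalence (ρ (T := T))) :
    ∃ (Q : C) (π : ∀ ⦃T : C⦄, D.obj (.op T) → (T ⟶ Q)), IsLocalQuotient.{w} D ρ Q π := by
  obtain ⟨U, p, hp⟩ := hD.exists_isLocalQuotient_eq
  obtain ⟨A, V, x, y, hxy, hsmall⟩ := hρ.small
  obtain ⟨I, m, hm, hfac⟩ := exists_mono_factors_iff_locally V fun a => lift (p (x a)) (p (y a))
  have hrel : ∀ ⦃T : C⦄ (a b : T ⟶ U), (∃ g, g ≫ m = lift a b) ↔ LocallyRelated.{w} ρ p a b := by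
    refine fun T a b => (hfac _).trans ⟨fun h => h.mono ?_, fun h => h.mono ?_⟩
    · rintro T' e ⟨i, f, hf⟩
      rw [comp_lift, comp_lift, hp.comp, hp.comp] at hf
      exact ⟨_, _, hρ.res f _ _ (hxy i), by simpa using congr($hf ≫ fst _ _),
        by simpa using congr($hf ≫ snd _ _)⟩
    · rintro T' e ⟨x', y', h, hx, hy⟩
      obtain ⟨i, f, rfl, rfl⟩ := hsmall _ _ h
      exact ⟨i, f, by rw [comp_lift, comp_lift, hp.comp, hp.comp, hx, hy]⟩
  obtain ⟨Q, q, _, hqr⟩ := exists_strongEpi_comp_eq_iff_factors.{w} m <| by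
    simpa only [hrel] using hp.equivalence_locallyRelated hρ.res he
  refine ⟨Q, fun T x => p x ≫ q, ⟨fun T T' f x => by rw [← hp.comp, Category.assoc],
    fun T x y => ?_, fun T a => .trans ((locally_exists_fac_of_strongEpi q a).mono ?_)⟩⟩
  · rw [hqr, hrel, hp.locallyRelated_iff hρ.res]
  · rintro T' e ⟨g, hg⟩
    refine (hp.surj g).mono ?_
    rintro T'' e' ⟨x, hx⟩
    exact ⟨x, by simp [hx, hg]⟩

end Quotients

section Balanced

variable {C : Type u} [Category.{v} C]

/-- The presheaf of elements of two copies of `B`. -/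
def twoCopies (B : C) : Cᵒᵖ ⥤ Type v where
  obj T := ULift Bool × (T.unop ⟶ B)
  map f := ↾fun x => (x.1, f.unop ≫ x.2)

lemma isFamiliallyRepresentable_twoCopies (B : C) :
    IsFamiliallyRepresentable.{w} (twoCopies B) := by
  refine ⟨ULift Bool, fun _ => B, fun a => (⟨a.down⟩, 𝟙 B), fun T x =>
    ⟨⟨⟨x.1.down⟩, x.2⟩, ?_, ?_⟩⟩
  · exact Prod.ext rfl (Category.comp_id _)
  · rintro ⟨a, y⟩ rfl
    exact Sigma.ext rfl (heq_of_eq (Category.comp_id y).symm)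

/-- The element `b` of the copy of `B` with index `i`. -/
def twoCopies.mk {B T : C} (i : Bool) (b : T ⟶ B) : (twoCopies B).obj (.op T) := (⟨i⟩, b)

lemma twoCopies.map_mk {B T T' : C} (f : T' ⟶ T) (i : Bool) (b : T ⟶ B) :
    (twoCopies B).map f.op (mk i b) = mk i (f ≫ b) := rfl

/-- The relation glueing the two copies of `B` along a morphism `m`. -/
def glueRel {A B : C} (m : A ⟶ B) : PresheafRel (twoCopies B) := fun _ x y =>
  x.2 = y.2 ∧ (x.1 = y.1 ∨ ∃ a, a ≫ m = x.2)

lemma isSmallRel_glueRel {A B : C} (m : A ⟶ B) : IsSmallRel.{w} (twoCopies B) (glueRel m) := by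
  refine ⟨?_, ?_⟩
  · rintro T T' f ⟨i, x⟩ ⟨j, y⟩ ⟨rfl : x = y, h⟩
    refine ⟨rfl, h.imp id ?_⟩
    rintro ⟨a, ha⟩
    exact ⟨f ≫ a, (Category.assoc _ _ _).trans (congrArg (f ≫ ·) ha)⟩
  · refine ⟨ULift (Bool ⊕ Bool × Bool), fun a => a.down.elim (fun _ => B) (fun _ => A),
      fun ⟨a⟩ => match a with
        | .inl i => (⟨i⟩, 𝟙 B)
        | .inr i => (⟨i.1⟩, m),
      fun ⟨a⟩ => match a with
        | .inl i => (⟨i⟩, 𝟙 B)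
        | .inr i => (⟨i.2⟩, m), ?_, ?_⟩
    · rintro ⟨i | i⟩
      · exact ⟨rfl, .inl rfl⟩
      · exact ⟨rfl, .inr ⟨𝟙 A, Category.id_comp m⟩⟩
    · rintro T ⟨⟨i⟩, x⟩ ⟨⟨j⟩, y⟩ ⟨rfl : x = y, (h : _ = _) | ⟨a, rfl : a ≫ m = x⟩⟩
      · cases h
        exact ⟨⟨.inl i⟩, x, Prod.ext rfl (Category.comp_id _), Prod.ext rfl (Category.comp_id _)⟩
      · exact ⟨⟨.inr (i, j)⟩, a, rfl, rfl⟩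

lemma equivalence_glueRel {A B : C} (m : A ⟶ B) ⦃T : C⦄ : Equivalence (glueRel m (T := T)) where
  refl _ := ⟨rfl, .inl rfl⟩
  symm h := ⟨h.1.symm, h.2.imp Eq.symm fun ⟨a, ha⟩ => ⟨a, ha.trans h.1⟩⟩
  trans h h' := ⟨h.1.trans h'.1, by
    obtain h₁ | ⟨a, ha⟩ := h.2
    · exact h'.2.imp h₁.trans fun ⟨a, ha⟩ => ⟨a, ha.trans h.1.symm⟩
    · exact .inr ⟨a, ha⟩⟩

variable [InfinitaryPretopos.{w} C]

lemma epi_of_locally_lift {X Y : C} (p : X ⟶ Y)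
    (h : Locally.{w} Y fun T' e => ∃ g : T' ⟶ X, g ≫ p = e) : Epi p :=
  ⟨fun a b hab => Locally.eq <| h.mono fun T' e ⟨g, hg⟩ => by
    rw [← hg, Category.assoc, hab, Category.assoc]⟩

variable [CartesianMonoidalCategory C]

/-- The two inclusions of `B` into the glueing of two copies of `B` along `m` agree after `m`. If
they are equal, then `m` is locally surjective. -/
lemma isIso_of_mono_of_epi_of_pretopos {A B : C} (m : A ⟶ B) [Mono m] [Epi m] : IsIso m := by
  obtain ⟨Q, π, hπ⟩ := (isSmallRel_glueRel.{w} m).exists_isLocalQuotient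
    (isFamiliallyRepresentable_twoCopies B) (equivalence_glueRel m)
  have hincl : m ≫ π (twoCopies.mk true (𝟙 B)) = m ≫ π (twoCopies.mk false (𝟙 B)) := by
    rw [hπ.comp, hπ.comp, twoCopies.map_mk, twoCopies.map_mk]
    refine hπ.sound (isSmallRel_glueRel.{w} m).res ⟨rfl, .inr ⟨𝟙 A, ?_⟩⟩
    exact (Category.id_comp m).trans (Category.comp_id m).symm
  rw [cancel_epi, hπ.eq_iff] at hincl
  obtain ⟨g, hg⟩ := Locally.factors (f := 𝟙 B) m <| hincl.mono fun T' e he => by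
    obtain ⟨_, he | he⟩ := he
    · cases he
    · exact he
  have := IsSplitEpi.mk' (f := m) ⟨g, hg⟩
  exact isIso_of_mono_of_isSplitEpi m

lemma strongEpi_of_epi_of_pretopos {A B : C} (f : A ⟶ B) [Epi f] : StrongEpi f := by
  let F := Regular.strongEpiMonoFactorisation f
  have : Epi (F.e ≫ F.m) := by rwa [F.fac]
  have : Epi F.m := epi_of_epi F.e F.m
  have := isIso_of_mono_of_epi_of_pretopos.{w} F.m
  rw [← F.fac]
  exact strongEpi_comp _ _

lemma Locally.of_epi {T T' : C} (e : T' ⟶ T) [Epi e] {P : ∀ ⦃T' : C⦄, (T' ⟶ T) → Prop}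
    (h : ∀ ⦃T'' : C⦄ (f : T'' ⟶ T'), P (f ≫ e)) : Locally.{w} T P :=
  have := strongEpi_of_epi_of_pretopos.{w} e
  .of_strongEpi e h

lemma exists_desc_of_epi {U V Z : C} (p : U ⟶ V) [Epi p] (f : U ⟶ Z)
    (h : ∀ ⦃T : C⦄ (s t : T ⟶ U), s ≫ p = t ≫ p → s ≫ f = t ≫ f) : ∃ g : V ⟶ Z, p ≫ g = f := by
  obtain ⟨g, hg⟩ := exists_glue.{w} (V := V) (Z := Z) (fun T s z => ∃ u, u ≫ p = s ∧ u ≫ f = z)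
    (by rintro T T' e _ _ ⟨u, rfl, rfl⟩; exact ⟨e ≫ u, by simp, by simp⟩)
    (by rintro T _ _ _ ⟨u, hu, rfl⟩ ⟨u', hu', rfl⟩; exact h _ _ (hu.trans hu'.symm))
    (.of_epi p fun _ e => ⟨e ≫ f, e, rfl, rfl⟩)
  exact ⟨g, hg p f ⟨𝟙 U, by simp, by simp⟩⟩

end Balanced

section GroupObjects

variable {C : Type u} [Category.{v} C] [CartesianMonoidalCategory C]

/-- The monoid object given by operations which satisfy the monoid axioms on generalized
elements. -/
@[to_additive]
abbrev monObjOfPoints {Q : C} (one : 𝟙_ C ⟶ Q) (mul : Q ⊗ Q ⟶ Q)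
    (one_mul : ∀ {T : C} (a : T ⟶ Q), lift (toUnit T ≫ one) a ≫ mul = a)
    (mul_one : ∀ {T : C} (a : T ⟶ Q), lift a (toUnit T ≫ one) ≫ mul = a)
    (mul_assoc : ∀ {T : C} (a b c : T ⟶ Q),
      lift (lift a b ≫ mul) c ≫ mul = lift a (lift b c ≫ mul) ≫ mul) :
    MonObj Q where
  one := one
  mul := mul
  one_mul := by
    have h : one ▷ Q = lift (toUnit _ ≫ one) (λ_ Q).hom := by
      ext
      · simp [toUnit_unique (fst (𝟙_ C) Q) (toUnit _)]
      · simp [leftUnitor_hom]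
    rw [h, one_mul]
  mul_one := by
    have h : Q ◁ one = lift (ρ_ Q).hom (toUnit _ ≫ one) := by
      ext
      · simp [rightUnitor_hom]
      · simp [toUnit_unique (snd Q (𝟙_ C)) (toUnit _)]
    rw [h, mul_one]
  mul_assoc := by
    have h₁ : mul ▷ Q = lift (lift (fst _ _ ≫ fst _ _) (fst _ _ ≫ snd _ _) ≫ mul) (snd _ _) := by
      ext <;> simp [← comp_lift]
    have h₂ : Q ◁ mul = lift (fst _ _) (lift (snd _ _ ≫ fst _ _) (snd _ _ ≫ snd _ _) ≫ mul) := by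
      ext <;> simp [← comp_lift]
    rw [h₁, h₂, mul_assoc, comp_lift_assoc, comp_lift_assoc]
    simp

lemma isMonHom_of_map_mul {G H : C} [GrpObj G] [GrpObj H] (f : G ⟶ H)
    (h : ∀ {T : C} (a b : T ⟶ G), (a * b) ≫ f = (a ≫ f) * (b ≫ f)) : IsMonHom f where
  one_hom := by
    have h₁ := h (η[G]) η[G]
    rw [MonObj.one_eq_one, mul_one] at h₁
    rw [MonObj.one_eq_one, MonObj.one_eq_one]
    exact left_eq_mul.mp h₁
  mul_hom := by
    rw [MonObj.mul_eq_mul, h, Hom.mul_def]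
    congr 1
    ext <;> simp

variable [InfinitaryPretopos.{w} C]

/-- Inverses are unique, so local inverses glue. -/
@[to_additive]
lemma exists_grpObj_of_locally_exists_mul_eq_one (Q : C) [M : MonObj Q]
    (h : ∀ {T : C} (q : T ⟶ Q), Locally.{w} T fun _ e => ∃ r, r * (e ≫ q) = 1) :
    ∃ G : GrpObj Q, G.toMonObj = M := by
  have inv_unique {T : C} (q r r' : T ⟶ Q) (hr : r * q = 1) (hr' : r' * q = 1) : r = r' := by
    refine Locally.eq ((h r).mono fun T' e ⟨s, hs⟩ => ?_)
    have hrq := congr(e ≫ $hr)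
    have hr'q := congr(e ≫ $hr')
    rw [MonObj.comp_mul, MonObj.comp_one] at hrq hr'q
    rw [left_inv_eq_right_inv hs hrq] at hs
    exact (left_inv_eq_right_inv hr'q hs).symm
  obtain ⟨i, hi⟩ := exists_glue.{w} (V := Q) (Z := Q) (fun T q r => r * q = 1)
    (fun T T' e q r hr => by rw [← MonObj.comp_mul, hr, MonObj.comp_one])
    (fun T q r r' => inv_unique q r r')
    ((h (𝟙 Q)).mono fun T e ⟨r, hr⟩ => ⟨r, by simpa using hr⟩)
  have inv_mul : i * 𝟙 Q = 1 := Locally.eq <| (h (𝟙 Q)).mono fun T e ⟨r, hr⟩ => by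
    rw [MonObj.comp_mul, MonObj.comp_one, Category.comp_id, hi e r (by simpa using hr)]
    simpa using hr
  have mul_inv : 𝟙 Q * i = 1 := Locally.eq <| (h i).mono fun T e ⟨s, hs⟩ => by
    have he : (e ≫ i) * e = 1 := by
      simpa only [MonObj.comp_mul, MonObj.comp_one, Category.comp_id] using congr(e ≫ $inv_mul)
    obtain rfl := left_inv_eq_right_inv hs he
    rwa [MonObj.comp_mul, MonObj.comp_one, Category.comp_id]
  exact ⟨{ inv := i, left_inv := inv_mul, right_inv := mul_inv }, rfl⟩

end GroupObjects

section QuotientGroups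

universe t

variable {C : Type u} [Category.{v} C] [InfinitaryPretopos.{w} C]
  {D : Cᵒᵖ ⥤ Type t} {ρ : PresheafRel D} {Q : C} {π : ∀ ⦃T : C⦄, D.obj (.op T) → (T ⟶ Q)}

namespace IsLocalQuotient

lemma hom_eq (h : IsLocalQuotient.{w} D ρ Q π) {T Z : C} (q : T ⟶ Q) {f g : T ⟶ Z}
    (hfg : ∀ ⦃T' : C⦄ (e : T' ⟶ T) (x : D.obj (.op T')), π x = e ≫ q → e ≫ f = e ≫ g) : f = g :=
  Locally.eq ((h.surj q).mono fun _ e ⟨x, hx⟩ => hfg e x hx)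

lemma hom_eq₂ (h : IsLocalQuotient.{w} D ρ Q π) {T Z : C} (q r : T ⟶ Q) {f g : T ⟶ Z}
    (hfg : ∀ ⦃T' : C⦄ (e : T' ⟶ T) (x y : D.obj (.op T')), π x = e ≫ q → π y = e ≫ r →
      e ≫ f = e ≫ g) : f = g :=
  h.hom_eq q fun _ e x hx => h.hom_eq (e ≫ r) fun _ e' y hy => by
    rw [← Category.assoc, ← Category.assoc]
    exact hfg _ (D.map e'.op x) y (by rw [← h.comp, hx, Category.assoc])
      (by rw [hy, Category.assoc])

lemma hom_eq₃ (h : IsLocalQuotient.{w} D ρ Q π) {T Z : C} (q r s : T ⟶ Q) {f g : T ⟶ Z}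
    (hfg : ∀ ⦃T' : C⦄ (e : T' ⟶ T) (x y z : D.obj (.op T')), π x = e ≫ q → π y = e ≫ r →
      π z = e ≫ s → e ≫ f = e ≫ g) : f = g :=
  h.hom_eq₂ q r fun _ e x y hx hy => h.hom_eq (e ≫ s) fun _ e' z hz => by
    rw [← Category.assoc, ← Category.assoc]
    exact hfg _ (D.map e'.op x) (D.map e'.op y) z (by rw [← h.comp, hx, Category.assoc])
      (by rw [← h.comp, hy, Category.assoc]) (by rw [hz, Category.assoc])

lemma map_eq (h : IsLocalQuotient.{w} D ρ Q π) {Z : C} (φ : ∀ ⦃T : C⦄, D.obj (.op T) → (T ⟶ Z))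
    (nat : ∀ ⦃T T' : C⦄ (f : T' ⟶ T) (x : D.obj (.op T)), f ≫ φ x = φ (D.map f.op x))
    (hφ : ∀ ⦃T : C⦄ (x y : D.obj (.op T)), ρ x y → φ x = φ y)
    {T : C} {x y : D.obj (.op T)} (hxy : π x = π y) : φ x = φ y :=
  Locally.eq (((h.eq_iff _ _).1 hxy).mono fun _ e he => by rw [nat, nat, hφ _ _ he])

lemma exists_desc (h : IsLocalQuotient.{w} D ρ Q π) {Z : C}
    (φ : ∀ ⦃T : C⦄, D.obj (.op T) → (T ⟶ Z))
    (nat : ∀ ⦃T T' : C⦄ (f : T' ⟶ T) (x : D.obj (.op T)), f ≫ φ x = φ (D.map f.op x))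
    (hφ : ∀ ⦃T : C⦄ (x y : D.obj (.op T)), ρ x y → φ x = φ y) :
    ∃ g : Q ⟶ Z, ∀ ⦃T : C⦄ (x : D.obj (.op T)), π x ≫ g = φ x := by
  obtain ⟨g, hg⟩ := exists_glue.{w} (V := Q) (Z := Z) (fun T s z => ∃ x, π x = s ∧ φ x = z)
    (by rintro T T' e _ _ ⟨x, rfl, rfl⟩; exact ⟨_, (h.comp _ _).symm, (nat _ _).symm⟩)
    (by rintro T _ _ _ ⟨x, hx, rfl⟩ ⟨y, hy, rfl⟩; exact h.map_eq φ nat hφ (hx.trans hy.symm))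
    ((h.surj (𝟙 Q)).mono fun T e ⟨x, hx⟩ => ⟨_, x, by simpa using hx, rfl⟩)
  exact ⟨g, fun T x => hg _ _ ⟨x, rfl, rfl⟩⟩

variable [CartesianMonoidalCategory C]

lemma exists_desc₂ (h : IsLocalQuotient.{w} D ρ Q π) {Z : C}
    (φ : ∀ ⦃T : C⦄, D.obj (.op T) → D.obj (.op T) → (T ⟶ Z))
    (nat : ∀ ⦃T T' : C⦄ (f : T' ⟶ T) (x y : D.obj (.op T)),
      f ≫ φ x y = φ (D.map f.op x) (D.map f.op y))
    (hl : ∀ ⦃T : C⦄ (x x' y : D.obj (.op T)), ρ x x' → φ x y = φ x' y)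
    (hr : ∀ ⦃T : C⦄ (x y y' : D.obj (.op T)), ρ y y' → φ x y = φ x y') :
    ∃ g : Q ⊗ Q ⟶ Z, ∀ ⦃T : C⦄ (x y : D.obj (.op T)), lift (π x) (π y) ≫ g = φ x y := by
  have φ_eq {T : C} {x x' y y' : D.obj (.op T)} (hx : π x = π x') (hy : π y = π y') :
      φ x y = φ x' y' := by
    refine Locally.eq ((((h.eq_iff _ _).1 hx).and ((h.eq_iff _ _).1 hy)).mono ?_)
    rintro T' e ⟨hx, hy⟩
    rw [nat, nat, hl _ _ _ hx, hr _ _ _ hy]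
  have cov : Locally.{w} (Q ⊗ Q) fun T e => ∃ z x y, lift (π x) (π y) = e ∧ φ x y = z := by
    refine Locally.trans ((h.surj (fst Q Q)).mono ?_)
    rintro T e ⟨x, hx⟩
    refine (h.surj (e ≫ snd Q Q)).mono ?_
    rintro T' e' ⟨y, hy⟩
    refine ⟨_, D.map e'.op x, y, ?_, rfl⟩
    ext <;> simp [hy, ← h.comp, hx]
  obtain ⟨g, hg⟩ := exists_glue.{w} (V := Q ⊗ Q) (Z := Z)
    (fun T s z => ∃ x y, lift (π x) (π y) = s ∧ φ x y = z)
    (by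
      rintro T T' e _ _ ⟨x, y, rfl, rfl⟩
      exact ⟨_, _, by rw [comp_lift, h.comp, h.comp], (nat _ _ _).symm⟩)
    (by
      rintro T _ _ _ ⟨x, y, rfl, rfl⟩ ⟨x', y', hx', rfl⟩
      exact φ_eq (by simpa using congr($hx'.symm ≫ fst _ _))
        (by simpa using congr($hx'.symm ≫ snd _ _)))
    cov
  exact ⟨g, fun T x y => hg _ _ ⟨x, y, rfl, rfl⟩⟩

section

variable [∀ T : C, Monoid (D.obj (.op T))]

@[to_additive]
lemma exists_monObj (h : IsLocalQuotient.{w} D ρ Q π)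
    (sound : ∀ ⦃T : C⦄ (x y : D.obj (.op T)), ρ x y → π x = π y)
    (map_one : ∀ ⦃T T' : C⦄ (f : T' ⟶ T), D.map f.op (1 : D.obj (.op T)) = (1 : D.obj (.op T')))
    (map_mul : ∀ ⦃T T' : C⦄ (f : T' ⟶ T) (x y : D.obj (.op T)),
      (D.map f.op (x * y) : D.obj (.op T')) = (D.map f.op x : D.obj (.op T')) * D.map f.op y)
    (mul_right : ∀ ⦃T : C⦄ (x x' y : D.obj (.op T)), ρ x x' → ρ (x * y) (x' * y))
    (mul_left : ∀ ⦃T : C⦄ (x y y' : D.obj (.op T)), ρ y y' → ρ (x * y) (x * y')) :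
    ∃ _ : MonObj Q, (∀ T : C, π (1 : D.obj (.op T)) = 1) ∧
      ∀ ⦃T : C⦄ (x y : D.obj (.op T)), π (x * y) = π x * π y := by
  obtain ⟨m, hm⟩ := h.exists_desc₂ (fun (T : C) (x y : D.obj (.op T)) => π (x * y))
    (fun T T' f x y => by rw [h.comp, map_mul])
    (fun T x x' y hx => sound _ _ (mul_right _ _ _ hx))
    (fun T x y y' hy => sound _ _ (mul_left _ _ _ hy))
  have ho : ∀ T : C, toUnit T ≫ π (1 : D.obj (.op (𝟙_ C))) = π (1 : D.obj (.op T)) := fun T => by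
    rw [h.comp, map_one]
  refine ⟨monObjOfPoints (π (1 : D.obj (.op (𝟙_ C)))) m (fun {T} a => ?_) (fun {T} a => ?_)
    (fun {T} a b c => ?_), fun T => (ho T).symm, fun T x y => (hm x y).symm⟩
  · refine h.hom_eq a fun T' e x hx => ?_
    rw [comp_lift_assoc, ← hx, comp_toUnit_assoc, ho, hm, one_mul]
  · refine h.hom_eq a fun T' e x hx => ?_
    rw [comp_lift_assoc, ← hx, comp_toUnit_assoc, ho, hm, mul_one]
  · refine h.hom_eq₃ a b c fun T' e x y z hx hy hz => ?_
    simp only [comp_lift_assoc, ← hx, ← hy, ← hz, hm, mul_assoc]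

@[to_additive]
lemma exists_grpObj (h : IsLocalQuotient.{w} D ρ Q π)
    (sound : ∀ ⦃T : C⦄ (x y : D.obj (.op T)), ρ x y → π x = π y)
    (map_one : ∀ ⦃T T' : C⦄ (f : T' ⟶ T), D.map f.op (1 : D.obj (.op T)) = (1 : D.obj (.op T')))
    (map_mul : ∀ ⦃T T' : C⦄ (f : T' ⟶ T) (x y : D.obj (.op T)),
      (D.map f.op (x * y) : D.obj (.op T')) = (D.map f.op x : D.obj (.op T')) * D.map f.op y)
    (mul_right : ∀ ⦃T : C⦄ (x x' y : D.obj (.op T)), ρ x x' → ρ (x * y) (x' * y))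
    (mul_left : ∀ ⦃T : C⦄ (x y y' : D.obj (.op T)), ρ y y' → ρ (x * y) (x * y'))
    (exists_inv : ∀ ⦃T : C⦄ (x : D.obj (.op T)), ∃ y : D.obj (.op T), ρ (y * x) 1) :
    ∃ _ : GrpObj Q, ∀ ⦃T : C⦄ (x y : D.obj (.op T)), π (x * y) = π x * π y := by
  obtain ⟨M, hone, hmul⟩ := h.exists_monObj sound map_one map_mul mul_right mul_left
  obtain ⟨G, rfl⟩ := exists_grpObj_of_locally_exists_mul_eq_one.{w} Q fun {T} q =>
    (h.surj q).mono fun T' e ⟨x, hx⟩ => by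
      obtain ⟨y, hy⟩ := exists_inv x
      exact ⟨π y, by rw [← hx, ← hmul, sound _ _ hy, hone]⟩
  exact ⟨G, hmul⟩

lemma exists_isMonHom_desc [GrpObj Q] (h : IsLocalQuotient.{w} D ρ Q π)
    (map_mul : ∀ ⦃T : C⦄ (x y : D.obj (.op T)), π (x * y) = π x * π y) {H : C} [GrpObj H]
    (φ : ∀ T : C, D.obj (.op T) →* (T ⟶ H))
    (nat : ∀ ⦃T T' : C⦄ (f : T' ⟶ T) (x : D.obj (.op T)), f ≫ φ T x = φ T' (D.map f.op x))
    (hφ : ∀ ⦃T : C⦄ (x y : D.obj (.op T)), ρ x y → φ T x = φ T y) :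
    ∃ f : Q ⟶ H, IsMonHom f ∧ ∀ ⦃T : C⦄ (x : D.obj (.op T)), π x ≫ f = φ T x := by
  obtain ⟨f, hf⟩ := h.exists_desc (fun T x => φ T x) nat hφ
  refine ⟨f, isMonHom_of_map_mul f fun {T} a b => h.hom_eq₂ a b fun T' e x y hx hy => ?_, hf⟩
  rw [← Category.assoc, MonObj.comp_mul, MonObj.comp_mul, ← reassoc_of% hx, ← reassoc_of% hy, ← hx,
    ← hy, ← map_mul, hf, hf, hf, _root_.map_mul]

end

end IsLocalQuotient

end QuotientGroups

section Congruences

variable {X J : Type*} {op : J → X → X → X} {r : X → X → Prop}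

/-- The least equivalence relation containing `r` and compatible with the binary operations
`op j`. -/
inductive CongruenceClosure (op : J → X → X → X) (r : X → X → Prop) : X → X → Prop
  | of (x y : X) : r x y → CongruenceClosure op r x y
  | refl (x : X) : CongruenceClosure op r x x
  | symm {x y : X} : CongruenceClosure op r x y → CongruenceClosure op r y x
  | trans {x y z : X} : CongruenceClosure op r x y → CongruenceClosure op r y z →
      CongruenceClosure op r x z
  | op (j : J) {x x' y y' : X} : CongruenceClosure op r x x' → CongruenceClosure op r y y' →
      CongruenceClosure op r (op j x y) (op j x' y')

/-- The stages of the construction of `CongruenceClosure op r` from below. -/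
def CongruenceStage (op : J → X → X → X) (r : X → X → Prop) : ℕ → X → X → Prop
  | 0, x, y => r x y ∨ x = y
  | n + 1, x, y => CongruenceStage op r n x y ∨ CongruenceStage op r n y x ∨
      (∃ z, CongruenceStage op r n x z ∧ CongruenceStage op r n z y) ∨
      ∃ j a a' b b', CongruenceStage op r n a a' ∧ CongruenceStage op r n b b' ∧
        op j a b = x ∧ op j a' b' = y

lemma CongruenceStage.mono {m n : ℕ} (hmn : m ≤ n) {x y : X} (h : CongruenceStage op r m x y) :
    CongruenceStage op r n x y := by
  induction n, hmn using Nat.le_induction with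
  | base => exact h
  | succ n _ ih => exact .inl ih

namespace CongruenceClosure

variable (op r) in
lemma equivalence : Equivalence (CongruenceClosure op r) :=
  ⟨.refl, .symm, .trans⟩

lemma map_eq {Z : Type*} (op' : J → Z → Z → Z) (φ : X → Z) (hr : ∀ x y, r x y → φ x = φ y)
    (hop : ∀ j x y, φ (op j x y) = op' j (φ x) (φ y)) {x y : X} (h : CongruenceClosure op r x y) :
    φ x = φ y := by
  induction h with
  | of x y h => exact hr x y h
  | refl => rfl
  | symm _ ih => exact ih.symm
  | trans _ _ ih ih' => exact ih.trans ih'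
  | op j _ _ ih ih' => rw [hop, hop, ih, ih']

lemma of_congruenceStage {n : ℕ} {x y : X} (h : CongruenceStage op r n x y) :
    CongruenceClosure op r x y := by
  induction n generalizing x y with
  | zero =>
    obtain h | rfl := h
    · exact .of _ _ h
    · exact .refl _
  | succ n ih =>
    obtain h | h | ⟨z, h, h'⟩ | ⟨j, a, a', b, b', h, h', rfl, rfl⟩ := h
    · exact ih h
    · exact .symm (ih h)
    · exact .trans (ih h) (ih h')
    · exact .op j (ih h) (ih h')

lemma exists_congruenceStage {x y : X} (h : CongruenceClosure op r x y) :
    ∃ n, CongruenceStage op r n x y := by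
  induction h with
  | of x y h => exact ⟨0, .inl h⟩
  | refl x => exact ⟨0, .inr rfl⟩
  | symm _ ih =>
    obtain ⟨n, hn⟩ := ih
    exact ⟨n + 1, .inr (.inl hn)⟩
  | trans _ _ ih ih' =>
    obtain ⟨n, hn⟩ := ih
    obtain ⟨m, hm⟩ := ih'
    exact ⟨max n m + 1, .inr (.inr (.inl ⟨_, hn.mono (le_max_left n m),
      hm.mono (le_max_right n m)⟩))⟩
  | op j _ _ ih ih' =>
    obtain ⟨n, hn⟩ := ih
    obtain ⟨m, hm⟩ := ih'
    exact ⟨max n m + 1, .inr (.inr (.inr ⟨j, _, _, _, _, hn.mono (le_max_left n m),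
      hm.mono (le_max_right n m), rfl, rfl⟩))⟩

end CongruenceClosure

end Congruences

section SmallRelations

universe t

variable {C : Type u} [Category.{v} C] {D : Cᵒᵖ ⥤ Type t}

lemma IsFamiliallyRepresentable.exists_equalizers [HasPullbacks C]
    (hD : IsFamiliallyRepresentable.{w} D) {V V' : C} (x : D.obj (.op V)) (y : D.obj (.op V')) :
    ∃ (A : Type w) (K : A → C) (p : ∀ a, K a ⟶ V) (q : ∀ a, K a ⟶ V'),
      (∀ a, D.map (p a).op x = D.map (q a).op y) ∧
      ∀ ⦃T : C⦄ (f : T ⟶ V) (g : T ⟶ V'), D.map f.op x = D.map g.op y →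
        ∃ (a : A) (h : T ⟶ K a), h ≫ p a = f ∧ h ≫ q a = g := by
  obtain ⟨A, U, s, hs⟩ := hD
  obtain ⟨⟨a, f⟩, rfl, -⟩ := hs x
  obtain ⟨⟨b, g⟩, rfl, -⟩ := hs y
  have index_eq : ∀ ⦃T : C⦄ (f' : T ⟶ V) (g' : T ⟶ V'),
      D.map f'.op (D.map f.op (s a)) = D.map g'.op (D.map g.op (s b)) →
      (⟨a, f' ≫ f⟩ : Σ a, (T ⟶ U a)) = ⟨b, g' ≫ g⟩ := fun T f' g' h =>
    (hs (D.map f'.op (D.map f.op (s a)))).unique (by simp) (by rw [h]; simp)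
  by_cases hab : a = b
  · subst hab
    refine ⟨PUnit, fun _ => pullback f g, fun _ => pullback.fst f g, fun _ => pullback.snd f g,
      fun _ => ?_, fun T f' g' h => ⟨⟨⟩, pullback.lift f' g' ?_, pullback.lift_fst _ _ _,
        pullback.lift_snd _ _ _⟩⟩
    · simp only [← ConcreteCategory.comp_apply, ← Functor.map_comp, ← op_comp, pullback.condition]
    · simpa using index_eq f' g' h
  · exact ⟨PEmpty, fun a => a.elim, fun a => a.elim, fun a => a.elim, fun a => a.elim,
      fun T f' g' h => (hab congr($(index_eq f' g' h).1)).elim⟩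

namespace IsSmallRel

lemma eq (hD : IsFamiliallyRepresentable.{w} D) : IsSmallRel.{w} D fun _ => Eq := by
  obtain ⟨A, U, s, hs⟩ := hD
  refine ⟨fun T T' f x y h => by rw [h], A, U, s, s, fun _ => rfl, ?_⟩
  rintro T x _ rfl
  obtain ⟨⟨a, f⟩, hf, -⟩ := hs x
  exact ⟨a, f, hf, hf⟩

variable {ρ ρ' : PresheafRel D}

lemma iSup {B : Type w} {ρ : B → PresheafRel D} (h : ∀ i, IsSmallRel.{w} D (ρ i)) :
    IsSmallRel.{w} D fun _ x y => ∃ i, ρ i x y := by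
  refine ⟨fun T T' f x y ⟨i, hi⟩ => ⟨i, (h i).res f x y hi⟩, ?_⟩
  choose A V x y h₁ h₂ using fun i => (h i).small
  refine ⟨Σ i, A i, fun a => V a.1 a.2, fun a => x a.1 a.2, fun a => y a.1 a.2,
    fun a => ⟨a.1, h₁ _ _⟩, ?_⟩
  rintro T x' y' ⟨i, hi⟩
  obtain ⟨a, f, hf⟩ := h₂ i _ _ hi
  exact ⟨⟨i, a⟩, f, hf⟩

lemma or (h : IsSmallRel.{w} D ρ) (h' : IsSmallRel.{w} D ρ') :
    IsSmallRel.{w} D fun _ x y => ρ x y ∨ ρ' x y := by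
  have := iSup (ρ := fun (i : ULift.{w} Bool) T x y => bif i.down then ρ x y else ρ' x y)
    (by rintro ⟨_ | _⟩; exacts [h', h])
  convert! this using 4
  simp [or_comm]

lemma swap (h : IsSmallRel.{w} D ρ) : IsSmallRel.{w} D fun _ x y => ρ y x := by
  refine ⟨fun T T' f x y h' => h.res f _ _ h', ?_⟩
  obtain ⟨A, V, x, y, h₁, h₂⟩ := h.small
  refine ⟨A, V, y, x, h₁, fun T x' y' h' => ?_⟩
  obtain ⟨a, f, h₃, h₄⟩ := h₂ _ _ h'
  exact ⟨a, f, h₄, h₃⟩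

lemma comp [HasPullbacks C] (hD : IsFamiliallyRepresentable.{w} D) (h : IsSmallRel.{w} D ρ)
    (h' : IsSmallRel.{w} D ρ') : IsSmallRel.{w} D fun _ x z => ∃ y, ρ x y ∧ ρ' y z := by
  refine ⟨fun T T' f x z ⟨y, h₁, h₂⟩ => ⟨_, h.res f _ _ h₁, h'.res f _ _ h₂⟩, ?_⟩
  obtain ⟨A, V, x, y, hxy, hA⟩ := h.small
  obtain ⟨B, W, y', z, hyz, hB⟩ := h'.small
  choose E K p q hpq hK using fun (i : A × B) => hD.exists_equalizers (y i.1) (y' i.2)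
  refine ⟨Σ i, E i, fun i => K i.1 i.2, fun i => D.map (p i.1 i.2).op (x i.1.1),
    fun i => D.map (q i.1 i.2).op (z i.1.2),
    fun i => ⟨_, h.res _ _ _ (hxy i.1.1), hpq i.1 i.2 ▸ h'.res _ _ _ (hyz i.1.2)⟩, ?_⟩
  rintro T x₁ z₁ ⟨y₁, h₁, h₂⟩
  obtain ⟨a, f, rfl, hf⟩ := hA _ _ h₁
  obtain ⟨b, g, hg, rfl⟩ := hB _ _ h₂
  obtain ⟨c, k, rfl, rfl⟩ := hK (a, b) f g (hf.trans hg.symm)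
  exact ⟨⟨(a, b), c⟩, k, by simp, by simp⟩

variable [CartesianMonoidalCategory C]

lemma op₂ (h : IsSmallRel.{w} D ρ) (h' : IsSmallRel.{w} D ρ')
    (op : ∀ ⦃T : C⦄, D.obj (.op T) → D.obj (.op T) → D.obj (.op T))
    (map_op : ∀ ⦃T T' : C⦄ (f : T' ⟶ T) (x y : D.obj (.op T)),
      D.map f.op (op x y) = op (D.map f.op x) (D.map f.op y)) :
    IsSmallRel.{w} D fun _ a b => ∃ x x' y y', ρ x x' ∧ ρ' y y' ∧ op x y = a ∧ op x' y' = b := by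
  refine ⟨?_, ?_⟩
  · rintro T T' f _ _ ⟨x, x', y, y', h₁, h₂, rfl, rfl⟩
    exact ⟨_, _, _, _, h.res f _ _ h₁, h'.res f _ _ h₂, (map_op _ _ _).symm, (map_op _ _ _).symm⟩
  · obtain ⟨A, V, x, x', hx, hA⟩ := h.small
    obtain ⟨B, W, y, y', hy, hB⟩ := h'.small
    refine ⟨A × B, fun i => V i.1 ⊗ W i.2,
      fun i => op (D.map (fst _ _).op (x i.1)) (D.map (snd _ _).op (y i.2)),
      fun i => op (D.map (fst _ _).op (x' i.1)) (D.map (snd _ _).op (y' i.2)),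
      fun i => ⟨_, _, _, _, h.res _ _ _ (hx i.1), h'.res _ _ _ (hy i.2), rfl, rfl⟩, ?_⟩
    rintro T _ _ ⟨x₁, x₂, y₁, y₂, h₁, h₂, rfl, rfl⟩
    obtain ⟨a, f, rfl, rfl⟩ := hA _ _ h₁
    obtain ⟨b, g, rfl, rfl⟩ := hB _ _ h₂
    refine ⟨(a, b), lift f g, ?_, ?_⟩ <;>
    · simp only [map_op, ← ConcreteCategory.comp_apply, ← Functor.map_comp, ← op_comp, lift_fst,
        lift_snd]

variable [HasPullbacks C] {J : Type w}
  (op : J → ∀ ⦃T : C⦄, D.obj (.op T) → D.obj (.op T) → D.obj (.op T))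
  (map_op : ∀ j ⦃T T' : C⦄ (f : T' ⟶ T) (x y : D.obj (.op T)),
    D.map f.op (op j x y) = op j (D.map f.op x) (D.map f.op y))

include map_op in
lemma congruenceStage (hD : IsFamiliallyRepresentable.{w} D) (h : IsSmallRel.{w} D ρ) (n : ℕ) :
    IsSmallRel.{w} D fun T => CongruenceStage (fun j => op j (T := T)) (ρ (T := T)) n := by
  induction n with
  | zero => exact h.or (.eq hD)
  | succ n ih =>
    exact ih.or (ih.swap.or ((ih.comp hD ih).or (.iSup fun j => ih.op₂ ih (op j) (map_op j))))

include map_op in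
lemma congruenceClosure (hD : IsFamiliallyRepresentable.{w} D) (h : IsSmallRel.{w} D ρ) :
    IsSmallRel.{w} D fun T => CongruenceClosure (fun j => op j (T := T)) (ρ (T := T)) := by
  have := iSup (B := ULift ℕ) fun n => h.congruenceStage op map_op hD n.down
  convert! this using 4
  exact ⟨fun hxy => let ⟨n, hn⟩ := hxy.exists_congruenceStage; ⟨⟨n⟩, hn⟩,
    fun ⟨_, hn⟩ => .of_congruenceStage hn⟩

end IsSmallRel

end SmallRelations

section PresentedGroups

variable {C : Type u} [Category.{v} C]

/-- Words in the generators `(i, p)`, where `i : I` and `p` is an element of `R`. -/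
abbrev Word (I : Type) (R T : C) := FreeMonoid (I × (T ⟶ R))

/-- Restriction of words along `f : T' ⟶ T`. -/
def Word.res {I : Type} {R T T' : C} (f : T' ⟶ T) : Word I R T →* Word I R T' :=
  FreeMonoid.map fun a => (a.1, f ≫ a.2)

@[simp] lemma Word.res_of {I : Type} {R T T' : C} (f : T' ⟶ T) (i : I) (p : T ⟶ R) :
    Word.res f (FreeMonoid.of (i, p)) = FreeMonoid.of (i, f ≫ p) := rfl

/-- The presheaf of words. -/
def Word.presheaf (I : Type) (R : C) : Cᵒᵖ ⥤ Type v where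
  obj T := Word I R T.unop
  map f := ↾fun w => Word.res f.unop w
  map_id T := by
    ext w
    refine DFunLike.congr_fun (f := Word.res (𝟙 T.unop)) (g := MonoidHom.id _) ?_ w
    ext a
    simp [Word.res]
  map_comp f g := by
    ext w
    refine DFunLike.congr_fun (f := Word.res (g.unop ≫ f.unop))
      (g := (Word.res g.unop).comp (Word.res f.unop)) ?_ w
    ext a
    simp [Word.res]

instance (I : Type) (R T : C) : Monoid ((Word.presheaf I R).obj (.op T)) :=
  inferInstanceAs (Monoid (Word I R T))

lemma Word.res_res {I : Type} {R T T' T'' : C} (f : T' ⟶ T) (g : T'' ⟶ T') (w : Word I R T) :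
    Word.res g (Word.res f w) = Word.res (g ≫ f) w :=
  (congr($((Word.presheaf I R).map_comp f.op g.op) w)).symm

/-- The least congruence on the presheaf of words which contains `ρ`. -/
def wordCongruence {I : Type} {R : C} (ρ : PresheafRel (Word.presheaf I R)) :
    PresheafRel (Word.presheaf I R) :=
  fun T => CongruenceClosure (fun _ : PUnit.{w + 1} => (· * ·)) (ρ (T := T))

lemma wordCongruence.exists_mul_one {I : Type} {R : C} {ρ : PresheafRel (Word.presheaf I R)}
    (h : ∀ (i : I) {T : C} (p : T ⟶ R), ∃ w : Word I R T,
      wordCongruence.{w} ρ (w * FreeMonoid.of (i, p) : Word I R T) (1 : Word I R T))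
    {T : C} (w : Word I R T) :
    ∃ w' : Word I R T, wordCongruence.{w} ρ (w' * w : Word I R T) (1 : Word I R T) := by
  induction w using FreeMonoid.inductionOn' with
  | one => exact ⟨1, .refl _⟩
  | of_mul a w ih =>
    obtain ⟨w', hw'⟩ := ih
    obtain ⟨b, hb⟩ := h a.1 a.2
    refine ⟨w' * b, ?_⟩
    have hbw : wordCongruence.{w} ρ (b * FreeMonoid.of a * w : Word I R T) (1 * w : Word I R T) :=
      .op ⟨⟩ hb (.refl w)
    have hbw' : wordCongruence.{w} ρ (w' * (b * FreeMonoid.of a * w) : Word I R T)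
        (w' * (1 * w) : Word I R T) := .op ⟨⟩ (.refl w') hbw
    rw [one_mul, mul_assoc b, ← mul_assoc w'] at hbw'
    exact hbw'.trans hw'

variable [CartesianMonoidalCategory C]

/-- The object of words of a given shape. -/
def Word.shape (R : C) {I : Type} : List I → C
  | [] => 𝟙_ C
  | _ :: l => R ⊗ Word.shape R l

/-- The generic word of a given shape. -/
def Word.generic (R : C) {I : Type} : ∀ l : List I, Word I R (Word.shape R l)
  | [] => 1
  | i :: l => FreeMonoid.of (i, fst R (Word.shape R l)) *
      Word.res (snd R (Word.shape R l)) (Word.generic R l)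

lemma Word.res_generic_cons {R T : C} {I : Type} (i : I) (l : List I)
    (f : T ⟶ R ⊗ Word.shape R l) :
    Word.res f (Word.generic R (i :: l)) =
      FreeMonoid.of (i, f ≫ fst R (Word.shape R l)) *
        Word.res (f ≫ snd R (Word.shape R l)) (Word.generic R l) := by
  change Word.res f (FreeMonoid.of _ * Word.res _ _) = _
  rw [map_mul, res_of, res_res]

lemma Word.isFamiliallyRepresentable (I : Type) (R : C) :
    IsFamiliallyRepresentable.{w} (Word.presheaf I R) := by
  refine ⟨ULift (List I), fun l => Word.shape R l.down, fun l => Word.generic R l.down,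
    fun T w => ?_⟩
  change ∃! p : Σ l : ULift (List I), (T ⟶ Word.shape R l.down),
    Word.res p.2 (Word.generic R p.1.down) = w
  induction w using FreeMonoid.inductionOn' with
  | one =>
    refine ⟨⟨⟨[]⟩, toUnit T⟩, rfl, ?_⟩
    rintro ⟨⟨_ | ⟨i, l⟩⟩, f⟩ h
    · exact congrArg (Sigma.mk _) (toUnit_unique _ _)
    · exact (List.cons_ne_nil _ _ ((Word.res_generic_cons i l f).symm.trans h)).elim
  | of_mul a w ih =>
    obtain ⟨⟨⟨l⟩, f⟩, rfl, hu⟩ := ih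
    refine ⟨⟨⟨a.1 :: l⟩, lift a.2 f⟩, ?_, ?_⟩
    · refine (Word.res_generic_cons _ l _).trans ?_
      rw [lift_fst, lift_snd]
    · rintro ⟨⟨_ | ⟨i, l'⟩⟩, g⟩ h
      · exact (List.cons_ne_nil _ _ h.symm).elim
      · obtain ⟨h₁, h₂⟩ := List.cons.inj ((Word.res_generic_cons i l' g).symm.trans h)
        have h₃ := hu ⟨⟨l'⟩, g ≫ snd _ _⟩ h₂
        simp only [Sigma.mk.injEq, ULift.up.injEq] at h₃
        obtain ⟨rfl, h₃⟩ := h₃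
        obtain rfl := eq_of_heq h₃
        subst h₁
        refine congrArg (Sigma.mk _) ?_
        dsimp only
        exact hom_ext _ _ (lift_fst _ _).symm (lift_snd _ _).symm

/-- The relation consisting of the pairs `l k p q`, `r k p q` for `k : K` and `p`, `q` in `R`. -/
def Word.relation {I K : Type} {R : C} (l r : K → ∀ ⦃T : C⦄, (T ⟶ R) → (T ⟶ R) → Word I R T) :
    PresheafRel (Word.presheaf I R) :=
  fun _ a b => ∃ k p q, l k p q = a ∧ r k p q = b

lemma Word.isSmallRel_relation {I K : Type} {R : C}
    {l r : K → ∀ ⦃T : C⦄, (T ⟶ R) → (T ⟶ R) → Word I R T}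
    (hl : ∀ k ⦃T T' : C⦄ (f : T' ⟶ T) (p q : T ⟶ R),
      Word.res f (l k p q) = l k (f ≫ p) (f ≫ q))
    (hr : ∀ k ⦃T T' : C⦄ (f : T' ⟶ T) (p q : T ⟶ R),
      Word.res f (r k p q) = r k (f ≫ p) (f ≫ q)) :
    IsSmallRel.{w} _ (Word.relation l r) := by
  refine ⟨?_, ULift K, fun _ => R ⊗ R, fun k => l k.down (fst R R) (snd R R),
    fun k => r k.down (fst R R) (snd R R), fun k => ⟨_, _, _, rfl, rfl⟩, ?_⟩
  · rintro T T' f _ _ ⟨k, p, q, rfl, rfl⟩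
    exact ⟨k, f ≫ p, f ≫ q, (hl _ _ _ _).symm, (hr _ _ _ _).symm⟩
  · rintro T _ _ ⟨k, p, q, rfl, rfl⟩
    exact ⟨⟨k⟩, lift p q, (hl _ _ _ _).trans (by simp), (hr _ _ _ _).trans (by simp)⟩

/-- The value of a word under an interpretation `x i : R ⟶ G` of the generators. -/
def Word.eval {I : Type} {R G T : C} [GrpObj G] (x : I → (R ⟶ G)) : Word I R T →* (T ⟶ G) :=
  FreeMonoid.lift fun a => a.2 ≫ x a.1

@[simp] lemma Word.eval_of {I : Type} {R G T : C} [GrpObj G] (x : I → (R ⟶ G)) (i : I)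
    (p : T ⟶ R) : Word.eval x (FreeMonoid.of (i, p)) = p ≫ x i := by
  simp [Word.eval]

lemma Word.comp_eval {I : Type} {R G T T' : C} [GrpObj G] (x : I → (R ⟶ G)) (f : T' ⟶ T)
    (w : Word I R T) : f ≫ Word.eval x w = Word.eval x (Word.res f w) := by
  induction w using FreeMonoid.inductionOn' with
  | one => rw [map_one, map_one, map_one, MonObj.comp_one]
  | of_mul a w ih =>
    obtain ⟨i, p⟩ := a
    simp [MonObj.comp_mul, ih]

lemma Word.eval_comp {I : Type} {R G H T : C} [GrpObj G] [GrpObj H] (x : I → (R ⟶ G)) (f : G ⟶ H)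
    [IsMonHom f] (w : Word I R T) : Word.eval x w ≫ f = Word.eval (fun i => x i ≫ f) w := by
  induction w using FreeMonoid.inductionOn' with
  | one => rw [map_one, map_one, MonObj.one_comp]
  | of_mul a w ih =>
    obtain ⟨i, p⟩ := a
    simp [MonObj.mul_comp, ih]

lemma Word.eval_eq_of_map_mul {I : Type} {R G : C} [GrpObj G] (π : ∀ ⦃T : C⦄, Word I R T → (T ⟶ G))
    (nat : ∀ ⦃T T' : C⦄ (f : T' ⟶ T) (w : Word I R T), f ≫ π w = π (Word.res f w))
    (map_mul : ∀ ⦃T : C⦄ (w w' : Word I R T), π (w * w') = π w * π w') {T : C} (w : Word I R T) :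
    Word.eval (fun i => π (FreeMonoid.of (i, 𝟙 R))) w = π w := by
  induction w using FreeMonoid.inductionOn' with
  | one =>
    have h := map_mul (1 : Word I R T) 1
    rw [mul_one] at h
    rw [map_one, left_eq_mul.mp h]
  | of_mul a w ih =>
    obtain ⟨i, p⟩ := a
    rw [_root_.map_mul, ih, Word.eval_of, nat, res_of, Category.comp_id, map_mul]

/-- The interpretation `x` of the generators satisfies the relations `ρ`. -/
def SatisfiesRelations {I : Type} {R G : C} [GrpObj G] (ρ : PresheafRel (Word.presheaf I R))
    (x : I → (R ⟶ G)) : Prop :=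
  ∀ ⦃T : C⦄ (a b : Word I R T), ρ a b → Word.eval x a = Word.eval x b

lemma satisfiesRelations_relation_iff {I K : Type} {R G : C} [GrpObj G]
    {l r : K → ∀ ⦃T : C⦄, (T ⟶ R) → (T ⟶ R) → Word I R T} {x : I → (R ⟶ G)} :
    SatisfiesRelations (Word.relation l r) x ↔
      ∀ k ⦃T : C⦄ (p q : T ⟶ R), Word.eval x (l k p q) = Word.eval x (r k p q) :=
  ⟨fun h k _ p q => h _ _ ⟨k, p, q, rfl, rfl⟩, by rintro h T _ _ ⟨k, p, q, rfl, rfl⟩; exact h k p q⟩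

lemma SatisfiesRelations.wordCongruence {I : Type} {R G : C} [GrpObj G]
    {ρ : PresheafRel (Word.presheaf I R)} {x : I → (R ⟶ G)} (hx : SatisfiesRelations ρ x) :
    SatisfiesRelations (wordCongruence.{w} ρ) x := fun _ _ _ h =>
  CongruenceClosure.map_eq (fun _ => (· * ·)) (Word.eval x) (fun _ _ h => hx _ _ h)
    (fun _ _ _ => map_mul (Word.eval x) _ _) h

variable [InfinitaryPretopos.{w} C]

/-- The group object `G` is generated by the images of `x i`, i.e. its elements are locally products
of the elements `p ≫ x i`. -/
def IsGeneratedBy {I : Type} {R G : C} [GrpObj G] (x : I → (R ⟶ G)) : Prop :=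
  ∀ ⦃T : C⦄ (g : T ⟶ G), Locally.{w} T fun _ e => ∃ a, Word.eval x a = e ≫ g

namespace IsGeneratedBy

variable {I : Type} {R G H : C} [GrpObj G] [GrpObj H] {x : I → (R ⟶ G)}

lemma hom_ext (hx : IsGeneratedBy.{w} x) {f g : G ⟶ H} [IsMonHom f] [IsMonHom g]
    (h : ∀ i, x i ≫ f = x i ≫ g) : f = g := by
  refine Locally.eq.{w} ((hx (𝟙 G)).mono ?_)
  rintro T e ⟨a, ha⟩
  rw [Category.comp_id] at ha
  rw [← ha, Word.eval_comp, Word.eval_comp]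
  simp only [h]

lemma epi (hx : IsGeneratedBy.{w} x) (f : H ⟶ G) [IsMonHom f] (y : I → (R ⟶ H))
    (h : ∀ i, y i ≫ f = x i) : Epi f := by
  refine epi_of_locally_lift.{w} f ((hx (𝟙 G)).mono ?_)
  rintro T e ⟨a, ha⟩
  rw [Category.comp_id] at ha
  exact ⟨Word.eval y a, by rw [Word.eval_comp, ← ha]; simp only [h]⟩

end IsGeneratedBy

theorem exists_presented_grpObj {I : Type} {R : C} {ρ : PresheafRel (Word.presheaf I R)}
    (hρ : IsSmallRel.{w} _ ρ)
    (h : ∀ (i : I) {T : C} (p : T ⟶ R), ∃ w : Word I R T,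
      wordCongruence.{w} ρ (w * FreeMonoid.of (i, p) : Word I R T) (1 : Word I R T)) :
    ∃ (G : C) (_ : GrpObj G) (x : I → (R ⟶ G)), SatisfiesRelations ρ x ∧ IsGeneratedBy.{w} x ∧
      ∀ (H : C) [GrpObj H] (y : I → (R ⟶ H)), SatisfiesRelations ρ y →
        ∃! f : G ⟶ H, IsMonHom f ∧ ∀ i, x i ≫ f = y i := by
  have hwords := Word.isFamiliallyRepresentable.{w} I R
  have hρ' : IsSmallRel.{w} _ (wordCongruence.{w} ρ) :=
    hρ.congruenceClosure (fun _ _ => (· * ·)) (fun _ _ _ f x y => map_mul (Word.res f) x y) hwords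
  obtain ⟨G, π, hπ⟩ := hρ'.exists_isLocalQuotient hwords fun T => CongruenceClosure.equivalence _ _
  obtain ⟨_, hmul⟩ := hπ.exists_grpObj (fun T x y => hπ.sound hρ'.res)
    (fun T T' f => map_one (Word.res f)) (fun T T' f x y => map_mul (Word.res f) x y)
    (fun T x x' y hx => .op ⟨⟩ hx (.refl y)) (fun T x y y' hy => .op ⟨⟩ (.refl x) hy)
    (fun T => wordCongruence.exists_mul_one h)
  have heval {T : C} (w : Word I R T) : Word.eval (fun i => π (FreeMonoid.of (i, 𝟙 R))) w = π w :=
    Word.eval_eq_of_map_mul π hπ.comp hmul w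
  have hgen : IsGeneratedBy.{w} fun i => π (FreeMonoid.of (i, 𝟙 R)) :=
    fun T g => (hπ.surj g).mono fun T' e ⟨a, ha⟩ => ⟨a, (heval a).trans ha⟩
  refine ⟨G, _, _, fun T a b hab => ?_, hgen, fun H _ y hy => ?_⟩
  · rw [heval, heval]
    exact hπ.sound hρ'.res (.of _ _ hab)
  · obtain ⟨f, _, hf⟩ := hπ.exists_isMonHom_desc hmul (fun T => Word.eval y)
      (fun T T' f w => Word.comp_eval y f w) (fun T a b hab => hy.wordCongruence a b hab)
    have hxf (i : I) : π (FreeMonoid.of (i, 𝟙 R)) ≫ f = y i :=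
      (hf _).trans ((Word.eval_of _ _ _).trans (Category.id_comp _))
    refine ⟨f, ⟨inferInstance, hxf⟩, fun g ⟨_, hg⟩ => hgen.hom_ext fun i => ?_⟩
    rw [hg, hxf]

end PresentedGroups

section RingCongruences

variable {A B : Type*} [NonUnitalRing A] [NonUnitalNonAssocRing B]

/-- The addition and the multiplication of a ring, indexed by a type in the universe `w`. -/
def ringOperation (b : ULift.{w} Bool) (p q : A) : A :=
  bif b.down then p * q else p + q

/-- The ring congruence generated by the relation `r`. -/
def RingCongruence (r : A → A → Prop) : A → A → Prop :=
  CongruenceClosure ringOperation.{w} r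

namespace RingCongruence

variable {r : A → A → Prop} {p p' q q' : A}

lemma add (hp : RingCongruence.{w} r p p') (hq : RingCongruence.{w} r q q') :
    RingCongruence.{w} r (p + q) (p' + q') :=
  CongruenceClosure.op (op := ringOperation.{w}) (.up false) hp hq

lemma mul (hp : RingCongruence.{w} r p p') (hq : RingCongruence.{w} r q q') :
    RingCongruence.{w} r (p * q) (p' * q') :=
  CongruenceClosure.op (op := ringOperation.{w}) (.up true) hp hq

lemma map_eq (φ : A →ₙ+* B) (hφ : ∀ p q, r p q → φ p = φ q) (h : RingCongruence.{w} r p q) :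
    φ p = φ q := by
  refine CongruenceClosure.map_eq (fun b x y => bif b.down then x * y else x + y) φ hφ ?_ h
  rintro ⟨_ | _⟩ x y
  · exact map_add φ x y
  · exact map_mul φ x y

end RingCongruence

/-- The generators of the ideal which defines `R_{2ε}`. -/
def twoEpsGenerator (k : Fin 3) (p q : A) : A :=
  ![p + p, p * q - q * p, (p * p - p) * (q * q - q)] k

/-- The relation identifying the generators of the ideal which defines `R_{2ε}` with zero. -/
def TwoEpsRel (x y : A) : Prop :=
  y = 0 ∧ ∃ k p q, twoEpsGenerator k p q = x

end RingCongruences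

section RingQuotients

variable {C : Type u} [Category.{v} C]

lemma isFamiliallyRepresentable_yoneda (X : C) :
    IsFamiliallyRepresentable.{w} (yoneda.obj X) :=
  ⟨PUnit, fun _ => X, fun _ => 𝟙 X, fun T x => ⟨⟨⟨⟩, x⟩, Category.comp_id x, by
    rintro ⟨⟨⟩, y⟩ rfl
    exact congrArg (Sigma.mk _) (Category.comp_id y).symm⟩⟩

lemma IsSmallRel.exists_epi_isLocalQuotient [CartesianMonoidalCategory C]
    [InfinitaryPretopos.{w} C] {X : C} {ρ : PresheafRel (yoneda.obj X)}
    (hρ : IsSmallRel.{w} (yoneda.obj X) ρ) (he : ∀ ⦃T : C⦄, Equivalence (ρ (T := T))) :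
    ∃ (Q : C) (q : X ⟶ Q), Epi q ∧ IsLocalQuotient.{w} (yoneda.obj X) ρ Q fun _ p => p ≫ q := by
  obtain ⟨Q, π, hπ⟩ := hρ.exists_isLocalQuotient (isFamiliallyRepresentable_yoneda X) he
  obtain ⟨q, hq⟩ : ∃ q : X ⟶ Q, ∀ ⦃T : C⦄ (p : T ⟶ X), π p = p ≫ q :=
    ⟨π (T := X) (𝟙 X), fun T p =>
      ((hπ.comp p _).trans (congrArg (π (T := T)) (Category.comp_id p))).symm⟩
  obtain rfl : π = fun T p => p ≫ q := by
    funext T p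
    exact hq p
  refine ⟨Q, q, epi_of_locally_lift _ ((hπ.surj (𝟙 Q)).mono ?_), hπ⟩
  rintro T e ⟨x, hx⟩
  exact ⟨x, hx.trans (Category.comp_id e)⟩

variable [CartesianMonoidalCategory C] [BraidedCategory C]

namespace NonUnitalRingObj

variable {R : C} [NonUnitalRingObj R] {T T' : C}

lemma comp_mul (f : T' ⟶ T) (p q : T ⟶ R) : f ≫ (p * q) = (f ≫ p) * (f ≫ q) := by
  change f ≫ lift p q ≫ rmul = lift (f ≫ p) (f ≫ q) ≫ rmul
  rw [comp_lift_assoc]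

lemma comp_add (f : T' ⟶ T) (p q : T ⟶ R) : f ≫ (p + q) = f ≫ p + f ≫ q :=
  AddMonObj.comp_add f p q

lemma comp_zero (f : T' ⟶ T) : f ≫ (0 : T ⟶ R) = 0 :=
  AddMonObj.comp_zero f

lemma comp_sub (f : T' ⟶ T) (p q : T ⟶ R) : f ≫ (p - q) = f ≫ p - f ≫ q :=
  AddGrpObj.comp_sub f p q

lemma comp_twoEpsGenerator (f : T' ⟶ T) (k : Fin 3) (p q : T ⟶ R) :
    f ≫ twoEpsGenerator k p q = twoEpsGenerator k (f ≫ p) (f ≫ q) := by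
  fin_cases k <;> simp [twoEpsGenerator, comp_mul, comp_sub, comp_add]

end NonUnitalRingObj

open NonUnitalRingObj

/-- The action of a homomorphism of ring objects on generalized elements. -/
def IsNonUnitalRingHom.onPoints {R S : C} [NonUnitalRingObj R] [NonUnitalRingObj S] {f : R ⟶ S}
    (hf : IsNonUnitalRingHom f) (T : C) : (T ⟶ R) →ₙ+* (T ⟶ S) where
  toFun p := p ≫ f
  map_add' := hf.map_add
  map_mul' := hf.map_mul
  map_zero' := by simpa using hf.map_add (0 : T ⟶ R) 0

lemma killsTwoEps_iff {R S : C} [NonUnitalRingObj R] [NonUnitalRingObj S] {f : R ⟶ S} :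
    KillsTwoEps f ↔ ∀ ⦃T : C⦄ (k : Fin 3) (p q : T ⟶ R), twoEpsGenerator k p q ≫ f = 0 := by
  refine ⟨fun h T k p q => ?_, fun h T p q => ⟨h 0 p q, h 1 p q, h 2 p q⟩⟩
  fin_cases k
  · exact (h p q).1
  · exact (h p q).2.1
  · exact (h p q).2.2

lemma isSmallRel_twoEpsRel (R : C) [NonUnitalRingObj R] :
    IsSmallRel.{w} (yoneda.obj R) fun T => TwoEpsRel (A := T ⟶ R) := by
  refine ⟨?_, ULift (Fin 3), fun _ => R ⊗ R, fun k =>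
    (twoEpsGenerator k.down (fst R R) (snd R R) : R ⊗ R ⟶ R),
    fun _ => (0 : R ⊗ R ⟶ R), fun k => ⟨rfl, _, _, _, rfl⟩, ?_⟩
  · rintro T T' f _ _ ⟨rfl, k, p, q, rfl⟩
    exact ⟨comp_zero f, k, f ≫ p, f ≫ q, (comp_twoEpsGenerator f k p q).symm⟩
  · rintro T _ _ ⟨rfl, k, p, q, rfl⟩
    exact ⟨⟨k⟩, lift p q, (comp_twoEpsGenerator _ _ _ _).trans (by simp), comp_zero _⟩

namespace IsLocalQuotient

variable [InfinitaryPretopos.{w} C] {R Q : C} [NonUnitalRingObj R]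
  {ρ : PresheafRel (yoneda.obj R)} {q : R ⟶ Q}

lemma exists_nonUnitalRingObj_of_addGrpObj [AddGrpObj Q]
    (h : IsLocalQuotient.{w} (yoneda.obj R) ρ Q fun _ p => p ≫ q)
    (hadd : ∀ ⦃T : C⦄ (x y : T ⟶ R), (x + y) ≫ q = x ≫ q + y ≫ q) {m : Q ⊗ Q ⟶ Q}
    (hm : ∀ ⦃T : C⦄ (x y : T ⟶ R), lift (x ≫ q) (y ≫ q) ≫ m = (x * y) ≫ q) :
    ∃ _ : NonUnitalRingObj Q, IsNonUnitalRingHom q := by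
  have hcomm : IsCommAddMonObj Q := by
    rw [isCommAddMonObj_iff_isAddCommutative]
    refine fun T => ⟨⟨fun a b => h.hom_eq₂ a b fun T' e (x : T' ⟶ R) (y : T' ⟶ R) hx hy => ?_⟩⟩
    rw [AddMonObj.comp_add, AddMonObj.comp_add, ← hx, ← hy, ← hadd, ← hadd, add_comm]
  let ring : NonUnitalRingObj Q := by
    refine { rmul := m, rmul_assoc := ?_, rmul_add := ?_, add_rmul := ?_ }
    all_goals
      refine fun a b c => h.hom_eq₃ a b c
        fun T' e (x : T' ⟶ R) (y : T' ⟶ R) (z : T' ⟶ R) hx hy hz => ?_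
      simp only [AddMonObj.comp_add, comp_lift_assoc, ← hx, ← hy, ← hz, hm, ← hadd, mul_assoc,
        mul_add, add_mul]
  exact ⟨ring, fun x y => hadd x y, fun x y => (hm x y).symm⟩

theorem exists_nonUnitalRingObj (h : IsLocalQuotient.{w} (yoneda.obj R) ρ Q fun _ p => p ≫ q)
    (hρ : IsSmallRel.{w} (yoneda.obj R) ρ) (he : ∀ ⦃T : C⦄, Equivalence (ρ (T := T)))
    (hadd : ∀ ⦃T : C⦄ (x x' y y' : T ⟶ R), ρ x x' → ρ y y' → ρ (x + y) (x' + y'))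
    (hmul : ∀ ⦃T : C⦄ (x x' y y' : T ⟶ R), ρ x x' → ρ y y' → ρ (x * y) (x' * y')) :
    ∃ _ : NonUnitalRingObj Q, IsNonUnitalRingHom q := by
  let (T : C) : AddMonoid ((yoneda.obj R).obj (.op T)) := inferInstanceAs (AddMonoid (T ⟶ R))
  have sound ⦃T : C⦄ (x y : T ⟶ R) (hxy : ρ x y) : x ≫ q = y ≫ q := h.sound hρ.res hxy
  obtain ⟨_, hq⟩ := h.exists_addGrpObj sound (fun T T' f => comp_zero f)
    (fun T T' f => comp_add f) (fun T x x' y hx => hadd x x' y y hx (he.refl y))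
    (fun T x y y' hy => hadd x x y y' (he.refl x) hy) (fun T (x : T ⟶ R) => ⟨-x, by
      change ρ (-x + x) 0
      rw [neg_add_cancel]
      exact he.refl 0⟩)
  obtain ⟨m, hm⟩ := h.exists_desc₂ (Z := Q) (fun T (x : T ⟶ R) (y : T ⟶ R) => (x * y) ≫ q)
    (fun T T' f (x : T ⟶ R) (y : T ⟶ R) => by rw [← Category.assoc, comp_mul]; rfl)
    (fun T x x' y hx => sound _ _ (hmul _ _ _ _ hx (he.refl y)))
    (fun T x y y' hy => sound _ _ (hmul _ _ _ _ (he.refl x) hy))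
  exact h.exists_nonUnitalRingObj_of_addGrpObj hq hm

lemma isNonUnitalRingHom_of_comp (h : IsLocalQuotient.{w} (yoneda.obj R) ρ Q fun _ p => p ≫ q)
    [NonUnitalRingObj Q] (hq : IsNonUnitalRingHom q) {S : C} [NonUnitalRingObj S] {g : Q ⟶ S}
    (hg : IsNonUnitalRingHom (q ≫ g)) : IsNonUnitalRingHom g := by
  refine ⟨fun {T} a b => h.hom_eq₂ a b ?_, fun {T} a b => h.hom_eq₂ a b ?_⟩
  all_goals
    intro T' e (x : T' ⟶ R) (y : T' ⟶ R) (hx : x ≫ q = e ≫ a) (hy : y ≫ q = e ≫ b)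
  · rw [← Category.assoc, comp_add, comp_add, ← reassoc_of% hx, ← reassoc_of% hy, ← hx, ← hy,
      ← hq.map_add, Category.assoc, hg.map_add]
  · rw [← Category.assoc, comp_mul, comp_mul, ← reassoc_of% hx, ← reassoc_of% hy, ← hx, ← hy,
      ← hq.map_mul, Category.assoc, hg.map_mul]

end IsLocalQuotient

theorem exists_ringQuotient [InfinitaryPretopos.{w} C] {R : C} [NonUnitalRingObj R]
    {ρ : PresheafRel (yoneda.obj R)} (hρ : IsSmallRel.{w} (yoneda.obj R) ρ) :
    ∃ (Q : C) (_ : NonUnitalRingObj Q) (q : R ⟶ Q), IsNonUnitalRingHom q ∧ Epi q ∧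
      IsLocalQuotient.{w} (yoneda.obj R) (fun T => RingCongruence.{w} (A := T ⟶ R) (ρ (T := T))) Q
        fun _ p => p ≫ q := by
  have hρ' : IsSmallRel.{w} (yoneda.obj R) fun T =>
      RingCongruence.{w} (A := T ⟶ R) (ρ (T := T)) := by
    refine hρ.congruenceClosure (fun b T => ringOperation.{w} (A := T ⟶ R) b) ?_
      (isFamiliallyRepresentable_yoneda R)
    rintro ⟨_ | _⟩ T T' f x y
    · exact comp_add f x y
    · exact comp_mul f x y
  have he ⦃T : C⦄ : Equivalence (RingCongruence.{w} (A := T ⟶ R) (ρ (T := T))) :=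
    CongruenceClosure.equivalence _ _
  obtain ⟨Q, q, hq, hQ⟩ := hρ'.exists_epi_isLocalQuotient he
  obtain ⟨_, hqr⟩ := hQ.exists_nonUnitalRingObj hρ' he (fun T x x' y y' => .add)
    fun T x x' y y' => .mul
  exact ⟨Q, _, q, hqr, hq, hQ⟩

theorem exists_isTwoEpsQuotient [InfinitaryPretopos.{w} C] (R : C) [NonUnitalRingObj R] :
    ∃ (Q : C) (_ : NonUnitalRingObj Q) (q : R ⟶ Q), IsTwoEpsQuotient q ∧ Epi q ∧
      ∀ ⦃T : C⦄ (p p' : T ⟶ R), p ≫ q = p' ≫ q →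
        Locally.{w} T fun _ e => RingCongruence.{w} TwoEpsRel (e ≫ p) (e ≫ p') := by
  obtain ⟨Q, _, q, hq, hepi, hQ⟩ := exists_ringQuotient (isSmallRel_twoEpsRel.{w} R)
  have kills : KillsTwoEps q := killsTwoEps_iff.2 fun T k x y => by
    refine Eq.trans ?_ (map_zero (hq.onPoints T))
    exact (hQ.eq_iff _ _).2 (.of_forall fun _ e =>
      .of _ _ ((isSmallRel_twoEpsRel.{w} R).res e _ _ ⟨rfl, k, x, y, rfl⟩))
  refine ⟨Q, _, q, ⟨hq, kills, fun S _ f hf hf' => ?_⟩, hepi, fun T p p' => (hQ.eq_iff p p').1⟩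
  have f_eq {T : C} (x y : T ⟶ R) (h : RingCongruence.{w} TwoEpsRel x y) : x ≫ f = y ≫ f := by
    refine h.map_eq (hf.onPoints T) ?_
    rintro _ _ ⟨rfl, k, p, r, rfl⟩
    exact (killsTwoEps_iff.1 hf' k p r).trans (map_zero (hf.onPoints T)).symm
  obtain ⟨g, rfl⟩ := exists_desc_of_epi.{w} q f fun T p p' h =>
    Locally.eq (((hQ.eq_iff p p').1 h).mono fun T' e he => by
      rw [← Category.assoc, ← Category.assoc]
      exact f_eq _ _ he)
  exact ⟨g, ⟨hQ.isNonUnitalRingHom_of_comp hq hf, rfl⟩, fun g' hg' => (cancel_epi q).1 hg'.2⟩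

end RingQuotients

section CommPairings

/-- The properties of the commutator pairing of a central extension `d` which do not refer to the
surjectivity of `d`. -/
structure CommPairing {X G : Type*} [Group X] [Group G] (d : X → G) (β : G → G → X) : Prop where
  map : ∀ a b, d (β a b) = ⁅a, b⁆
  comm : ∀ x y, β (d x) (d y) = ⁅x, y⁆
  swap : ∀ a b, β a b * β b a = 1
  one_left : ∀ a, β 1 a = 1
  mul_left : ∀ a b c, β (a * b) c = β a ⁅b, c⁆ * β b c * β a c
  conj : ∀ a b c, β (a * b * a⁻¹) (a * c * a⁻¹) = β a ⁅b, c⁆ * β b c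
  central : ∀ z h, d z = 1 → z * h = h * z

namespace CommPairing

variable {X G : Type*} [Group X] [Group G] {d : X → G} {β : G → G → X} (H : CommPairing d β)
include H

lemma swap' (a b : G) : β a b = (β b a)⁻¹ :=
  eq_inv_of_mul_eq_one_left (H.swap a b)

lemma one_right (a : G) : β a 1 = 1 := by
  rw [H.swap', H.one_left, inv_one]

lemma mul_right (a b c : G) : β a (b * c) = β a b * β a c * (β b ⁅c, a⁆)⁻¹ := by
  rw [H.swap', H.mul_left, H.swap' a b, H.swap' a c]
  group

lemma pairing_mul_comm {a b : G} (h : ⁅a, b⁆ = 1) (x : X) : β a b * x = x * β a b :=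
  H.central _ _ (by rw [H.map, h])

lemma mul_left_of_comm (a : G) {b c : G} (h : ⁅b, c⁆ = 1) : β (a * b) c = β b c * β a c := by
  rw [H.mul_left, h, H.one_right, one_mul]

lemma mul_right_of_comm (a : G) {b c : G} (h : ⁅c, a⁆ = 1) : β a (b * c) = β a b * β a c := by
  rw [H.mul_right, h, H.one_right, inv_one, mul_one]

lemma commutator_left {a b c : G} (ha : ⁅a, c⁆ = 1) (hb : ⁅b, c⁆ = 1) : β ⁅a, b⁆ c = 1 := by
  have h := H.conj a b c
  rw [hb, H.one_right, one_mul, commutatorElement_eq_one_iff_mul_comm.1 ha, mul_inv_cancel_right,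
    show a * b * a⁻¹ = ⁅a, b⁆ * b by rw [commutatorElement_def]; group,
    H.mul_left_of_comm _ hb] at h
  exact mul_eq_left.1 h

lemma commutator_right_of_comm_right (u : G) {a b : G} (h : ⁅u, b⁆ = 1) :
    β u ⁅a, b⁆ * β a b = β ⁅u, a⁆ ⁅a, b⁆ * β a b * β ⁅u, a⁆ b := by
  rw [← H.mul_left, ← H.conj, commutatorElement_eq_one_iff_mul_comm.1 h, mul_inv_cancel_right,
    show u * a * u⁻¹ = ⁅u, a⁆ * a by rw [commutatorElement_def]; group]

lemma commutator_right_of_comm_left (u : G) {a b : G} (h : ⁅u, a⁆ = 1) :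
    β u ⁅a, b⁆ * β a b = β a ⁅u, b⁆ * β a b * (β ⁅u, b⁆ ⁅b, a⁆)⁻¹ := by
  rw [← H.mul_right, ← H.conj, commutatorElement_eq_one_iff_mul_comm.1 h, mul_inv_cancel_right,
    show u * b * u⁻¹ = ⁅u, b⁆ * b by rw [commutatorElement_def]; group]

end CommPairing

/-- The Steinberg relations of type `A₃` for elements of a group, together with a commutator
pairing. -/
structure SteinbergPairing {A X G : Type*} [NonUnitalRing A] [Group X] [Group G]
    (x : Fin 4 → Fin 4 → A → G) (d : X → G) (β : G → G → X) : Prop extends CommPairing d β where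
  map_add : ∀ {i j : Fin 4}, i ≠ j → ∀ p q, x i j (p + q) = x i j p * x i j q
  comm_mul : ∀ {i j k : Fin 4}, i ≠ j → j ≠ k → i ≠ k → ∀ p q, ⁅x i j p, x j k q⁆ = x i k (p * q)
  comm_one : ∀ {i j k l : Fin 4}, i ≠ j → k ≠ l → j ≠ k → i ≠ l → ∀ p q, ⁅x i j p, x k l q⁆ = 1

/-- A Steinberg pairing which vanishes on pairs of distinct roots with acute angle and on pairs of
equal roots. -/
structure ReducedSteinbergPairing {A X G : Type*} [NonUnitalRing A] [Group X] [Group G]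
    (x : Fin 4 → Fin 4 → A → G) (d : X → G) (β : G → G → X) : Prop
    extends SteinbergPairing x d β where
  vanish : ∀ {i j k l : Fin 4}, i ≠ j → k ≠ l → j ≠ k → i ≠ l → (i = k ∨ j = l) →
    ∀ p q, β (x i j p) (x k l q) = 1

variable {A X G : Type*} [NonUnitalRing A] [Group X] [Group G]
  {x : Fin 4 → Fin 4 → A → G} {d : X → G} {β : G → G → X}

namespace SteinbergPairing

variable (H : SteinbergPairing x d β)
include H

lemma map_zero {i j : Fin 4} (hij : i ≠ j) : x i j 0 = 1 := by
  have h := H.map_add hij 0 0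
  rw [add_zero] at h
  exact left_eq_mul.1 h

lemma map_neg {i j : Fin 4} (hij : i ≠ j) (p : A) : x i j (-p) = (x i j p)⁻¹ :=
  eq_inv_of_mul_eq_one_left (by rw [← H.map_add hij, neg_add_cancel, H.map_zero hij])

lemma comm_mul_swap {i j k : Fin 4} (hij : i ≠ j) (hjk : j ≠ k) (hik : i ≠ k) (p q : A) :
    ⁅x j k p, x i j q⁆ = x i k (-(q * p)) := by
  rw [← commutatorElement_inv, H.comm_mul hij hjk hik, H.map_neg hik]

lemma pairing_mul_eq_one {i j k l : Fin 4} (hij : i ≠ j) (hkl : k ≠ l) (hjk : j ≠ k) (hil : i ≠ l)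
    (h : i = k ∨ j = l) (p q r : A) : β (x i j (p * q)) (x k l r) = 1 := by
  obtain ⟨m, hi, hj, hk, hl⟩ : ∃ m : Fin 4, i ≠ m ∧ m ≠ j ∧ m ≠ k ∧ m ≠ l := by
    revert i j k l; decide
  rw [← H.comm_mul hi hj hij]
  exact H.commutator_left (H.comm_one hi hkl hk hil _ _) (H.comm_one hj hkl hjk hl _ _)

end SteinbergPairing

namespace ReducedSteinbergPairing

variable (H : ReducedSteinbergPairing x d β) {i j k l : Fin 4}
include H

lemma disjoint_add_left (hij : i ≠ j) (hkl : k ≠ l) (hjk : j ≠ k) (hil : i ≠ l) (p q r : A) :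
    β (x i j (p + q)) (x k l r) = β (x i j p) (x k l r) * β (x i j q) (x k l r) := by
  have h := H.comm_one hij hkl hjk hil
  rw [H.map_add hij, H.mul_left_of_comm _ (h _ _), H.pairing_mul_comm (h _ _)]

lemma disjoint_add_right (hij : i ≠ j) (hkl : k ≠ l) (hjk : j ≠ k) (hil : i ≠ l) (p q r : A) :
    β (x i j p) (x k l (q + r)) = β (x i j p) (x k l q) * β (x i j p) (x k l r) := by
  rw [H.map_add hkl, H.mul_right_of_comm _ (H.comm_one hkl hij hil.symm hjk.symm _ _)]

lemma adjacent_add_left (hij : i ≠ j) (hjk : j ≠ k) (hik : i ≠ k) (p q r : A) :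
    β (x i j (p + q)) (x j k r) = β (x i j p) (x j k r) * β (x i j q) (x j k r) := by
  rw [add_comm, H.map_add hij, H.mul_left, H.comm_mul hij hjk hik,
    H.vanish hij hik hij.symm hik (.inl rfl), one_mul]

lemma adjacent_add_right (hij : i ≠ j) (hjk : j ≠ k) (hik : i ≠ k) (p q r : A) :
    β (x i j p) (x j k (q + r)) = β (x i j p) (x j k q) * β (x i j p) (x j k r) := by
  rw [H.map_add hjk, H.mul_right, H.comm_mul_swap hij hjk hik,
    H.vanish hjk hik hik.symm hjk (.inr rfl), inv_one, mul_one]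

lemma disjoint_mul_right_eq_inv (hij : i ≠ j) (hik : i ≠ k) (hil : i ≠ l) (hjk : j ≠ k)
    (hkl : k ≠ l) (p q r : A) :
    β (x k l p) (x i j (q * r)) = (β (x i l (q * p)) (x k j r))⁻¹ := by
  have h := H.commutator_right_of_comm_right (x k l p) (a := x i k q) (b := x k j r)
    (H.comm_one hkl hjk.symm hkl.symm hjk.symm _ _)
  rw [H.comm_mul hik hjk.symm hij, H.comm_mul_swap hik hkl hil,
    H.vanish hil hij hil.symm hij (.inl rfl), one_mul,
    H.pairing_mul_comm (H.comm_one hkl hij hil.symm hjk.symm _ _)] at h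
  rw [mul_left_cancel h, eq_inv_iff_mul_eq_one,
    ← H.disjoint_add_left hil hjk.symm hkl.symm hij, neg_add_cancel, H.map_zero hil, H.one_left]

lemma disjoint_mul_right_eq (hij : i ≠ j) (hil : i ≠ l) (hjk : j ≠ k) (hjl : j ≠ l) (hkl : k ≠ l)
    (p q r : A) :
    β (x k l p) (x i j (q * r)) = β (x i l q) (x k j (p * r)) := by
  have h := H.commutator_right_of_comm_left (x k l p) (a := x i l q) (b := x l j r)
    (H.comm_one hkl hil hil.symm hkl _ _)
  rw [H.comm_mul hil hjl.symm hij, H.comm_mul hkl hjl.symm hjk.symm,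
    H.comm_mul_swap hil hjl.symm hij, H.vanish hjk.symm hij hij.symm hjk.symm (.inr rfl), inv_one,
    mul_one] at h
  exact mul_right_cancel h

lemma disjoint_mul_left (hij : i ≠ j) (hik : i ≠ k) (hil : i ≠ l) (hjk : j ≠ k)
    (hjl : j ≠ l) (hkl : k ≠ l) (p q r : A) :
    β (x i j (p * q)) (x k l r) = (β (x i j p) (x k l (q * r)))⁻¹ := by
  rw [← H.disjoint_mul_right_eq hil hij hkl.symm hjl.symm hjk.symm,
    H.disjoint_mul_right_eq_inv hil hik hij hkl.symm hjk.symm, inv_inv]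

lemma disjoint_mul_mul_sq (hij : i ≠ j) (hik : i ≠ k) (hil : i ≠ l) (hjk : j ≠ k)
    (hjl : j ≠ l) (hkl : k ≠ l) (p q r s : A) :
    β (x i j p) (x k l (q * r * s)) * β (x i j p) (x k l (q * r * s)) = 1 := by
  have h := H.disjoint_mul_left hij hik hil hjk hjl hkl p (q * r) s
  rw [← mul_assoc p, H.disjoint_mul_left hij hik hil hjk hjl hkl,
    H.disjoint_mul_left hij hik hil hjk hjl hkl, inv_inv, ← mul_assoc q] at h
  rw [← eq_inv_iff_mul_eq_one, ← h]

lemma disjoint_neg_left (hij : i ≠ j) (hkl : k ≠ l) (hjk : j ≠ k) (hil : i ≠ l) (p q : A) :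
    β (x i j (-p)) (x k l q) = (β (x i j p) (x k l q))⁻¹ := by
  rw [eq_inv_iff_mul_eq_one, ← H.disjoint_add_left hij hkl hjk hil, neg_add_cancel, H.map_zero hij,
    H.one_left]

lemma disjoint_neg_right (hij : i ≠ j) (hkl : k ≠ l) (hjk : j ≠ k) (hil : i ≠ l) (p q : A) :
    β (x i j p) (x k l (-q)) = (β (x i j p) (x k l q))⁻¹ := by
  rw [eq_inv_iff_mul_eq_one, ← H.disjoint_add_right hij hkl hjk hil, neg_add_cancel, H.map_zero hkl,
    H.one_right]

lemma adjacent_neg_right (hij : i ≠ j) (hjk : j ≠ k) (hik : i ≠ k) (p q : A) :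
    β (x i j p) (x j k (-q)) = (β (x i j p) (x j k q))⁻¹ := by
  rw [eq_inv_iff_mul_eq_one, ← H.adjacent_add_right hij hjk hik, neg_add_cancel, H.map_zero hjk,
    H.one_right]

lemma adjacent_mul_left (hij : i ≠ j) (hik : i ≠ k) (hil : i ≠ l) (hjk : j ≠ k)
    (hjl : j ≠ l) (hkl : k ≠ l) (a b r : A) :
    β (x i j (a * b)) (x j k r) =
      β (x i l a) (x l k (b * r)) * β (x l k (b * r)) (x i j (a * b)) := by
  have disjoint := H.comm_one hkl.symm hij hik.symm hjl.symm
  have h := H.commutator_right_of_comm_left (x j k r) (a := x i l a) (b := x l j b)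
    (H.comm_one hjk hil hik.symm hjl _ _)
  have commute : Commute (β (x i l a) (x l j b)) (β (x l k (b * r)) (x i j (a * b)))⁻¹ :=
    (show Commute _ _ from (H.pairing_mul_comm (disjoint _ _) _).symm).inv_right
  rw [H.comm_mul hil hjl.symm hij, H.comm_mul_swap hjl.symm hjk hkl.symm,
    H.comm_mul_swap hil hjl.symm hij, H.disjoint_neg_left hkl.symm hij hik.symm hjl.symm,
    H.disjoint_neg_right hkl.symm hij hik.symm hjl.symm, inv_inv,
    H.adjacent_neg_right hil hkl.symm hik, mul_assoc, commute.eq, ← mul_assoc, mul_left_inj,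
    H.swap' (x j k r), ← mul_inv_rev, inv_inj] at h
  rw [h, H.pairing_mul_comm (disjoint _ _)]

end ReducedSteinbergPairing

end CommPairings

section WeakUnits

variable {C : Type u} [Category.{v} C] [CartesianMonoidalCategory C]

lemma exists_epi_lift [InfinitaryPretopos.{w} C] {T X Y : C} (p : X ⟶ Y) [Epi p] (f : T ⟶ Y) :
    ∃ (T' : C) (e : T' ⟶ T) (g : T' ⟶ X), Epi e ∧ g ≫ p = e ≫ f := by
  have := strongEpi_of_epi_of_pretopos.{w} p
  have : StrongEpi (pullback.snd p f) := inferInstance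
  exact ⟨pullback p f, pullback.snd p f, pullback.fst p f, inferInstance, pullback.condition⟩

lemma exists_epi_lift₂ [InfinitaryPretopos.{w} C] {T X Y : C} (p : X ⟶ Y) [Epi p] (a b : T ⟶ Y) :
    ∃ (T' : C) (e : T' ⟶ T) (x y : T' ⟶ X), Epi e ∧ x ≫ p = e ≫ a ∧ y ≫ p = e ≫ b := by
  obtain ⟨T₁, e₁, x, h₁, hx⟩ := exists_epi_lift.{w} p a
  obtain ⟨T₂, e₂, y, h₂, hy⟩ := exists_epi_lift.{w} p (e₁ ≫ b)
  exact ⟨T₂, e₂ ≫ e₁, e₂ ≫ x, y, epi_comp _ _, by simp [hx], by simp [hy]⟩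

lemma exists_epi_lift₃ [InfinitaryPretopos.{w} C] {T X Y : C} (p : X ⟶ Y) [Epi p]
    (a b c : T ⟶ Y) : ∃ (T' : C) (e : T' ⟶ T) (x y z : T' ⟶ X), Epi e ∧ x ≫ p = e ≫ a ∧
      y ≫ p = e ≫ b ∧ z ≫ p = e ≫ c := by
  obtain ⟨T₁, e₁, x, y, h₁, hx, hy⟩ := exists_epi_lift₂.{w} p a b
  obtain ⟨T₂, e₂, z, h₂, hz⟩ := exists_epi_lift.{w} p (e₁ ≫ c)
  exact ⟨T₂, e₂ ≫ e₁, e₂ ≫ x, e₂ ≫ y, z, epi_comp _ _, by simp [hx], by simp [hy], by simp [hz]⟩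

lemma epi_tensorHom_self [InfinitaryPretopos.{w} C] {X Y : C} (p : X ⟶ Y) [Epi p] :
    Epi (p ⊗ₘ p) := by
  refine ⟨fun {Z} f g hfg => ?_⟩
  obtain ⟨T, e, a, b, he, ha, hb⟩ := exists_epi_lift₂.{w} p (fst Y Y) (snd Y Y)
  have h : lift a b ≫ (p ⊗ₘ p) = e := by ext <;> simp [ha, hb]
  rw [← cancel_epi e, ← h, Category.assoc, hfg, Category.assoc]

variable [BraidedCategory C]

open NonUnitalRingObj

namespace IsWeakUnit

variable {R : C} [NonUnitalRingObj R] {E : Subobject R} (hE : IsWeakUnit R E) {T : C}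
include hE

lemma factors_mul {a b : T ⟶ R} (ha : E.Factors a) (hb : E.Factors b) : E.Factors (a * b) := by
  obtain ⟨m, hm, -⟩ := hE.mul_epi
  rw [← Subobject.factorThru_arrow E a ha, ← Subobject.factorThru_arrow E b hb]
  rw [Subobject.factors_iff]
  refine ⟨lift (E.factorThru a ha) (E.factorThru b hb) ≫ m, ?_⟩
  change (_ ≫ m) ≫ E.arrow = lift (_ ≫ E.arrow) (_ ≫ E.arrow) ≫ rmul
  rw [Category.assoc, hm, lift_map_assoc]

section

variable [InfinitaryPretopos.{w} C]

lemma exists_mul (p : T ⟶ R) : ∃ (T' : C) (e : T' ⟶ T) (m t : T' ⟶ R), Epi e ∧ E.Factors t ∧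
    e ≫ p = m * t := by
  have := hE.smul_epi
  obtain ⟨T', e, g, he, hg⟩ := exists_epi_lift.{w} ((R ◁ E.arrow) ≫ rmul) p
  refine ⟨T', e, g ≫ fst _ _, g ≫ snd _ _ ≫ E.arrow, he, ?_, ?_⟩
  · rw [← Category.assoc]
    exact Subobject.factors_comp_arrow _
  · rw [← hg]
    change g ≫ (R ◁ E.arrow) ≫ rmul = lift (g ≫ fst _ _) (g ≫ snd _ _ ≫ E.arrow) ≫ rmul
    rw [← Category.assoc]
    congr 1
    ext <;> simp

lemma exists_mul₂ (p q : T ⟶ R) : ∃ (T' : C) (e : T' ⟶ T) (m n t : T' ⟶ R), Epi e ∧ E.Factors t ∧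
    e ≫ p = m * t ∧ e ≫ q = n * t := by
  obtain ⟨T₁, e₁, m, s, h₁, hs, hp⟩ := hE.exists_mul.{w} p
  obtain ⟨T₂, e₂, n, t, h₂, ht, hq⟩ := hE.exists_mul.{w} (e₁ ≫ q)
  obtain ⟨T₃, e₃, r, a, b, h₃, hr, -, -, ha, hb⟩ := hE.common_divisor (e₂ ≫ s) t
    (Subobject.factors_of_factors_right _ hs) ht
  refine ⟨T₃, e₃ ≫ e₂ ≫ e₁, (e₃ ≫ e₂ ≫ m) * a, (e₃ ≫ n) * b, r, epi_comp _ _, hr, ?_, ?_⟩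
  · rw [Category.assoc, Category.assoc, hp, comp_mul, comp_mul, ha, mul_assoc]
  · rw [Category.assoc, Category.assoc, hq, comp_mul, hb, mul_assoc]

lemma exists_mul_sq {p : T ⟶ R} (hp : E.Factors p) : ∃ (T' : C) (e : T' ⟶ T) (s t : T' ⟶ R),
    Epi e ∧ E.Factors t ∧ e ≫ p = s * (t * t) := by
  obtain ⟨m, hm, hm'⟩ := hE.mul_epi
  obtain ⟨T₁, e₁, g, h₁, hg⟩ := exists_epi_lift.{w} m (E.factorThru p hp)
  obtain ⟨T₂, e₂, t, a, b, h₂, ht, -, -, ha, hb⟩ := hE.common_divisor (g ≫ fst _ _ ≫ E.arrow)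
    (g ≫ snd _ _ ≫ E.arrow) (by rw [← Category.assoc]; exact Subobject.factors_comp_arrow _)
    (by rw [← Category.assoc]; exact Subobject.factors_comp_arrow _)
  refine ⟨T₂, e₂ ≫ e₁, a * b, t, epi_comp _ _, ht, ?_⟩
  have h : e₁ ≫ p = (g ≫ fst _ _ ≫ E.arrow) * (g ≫ snd _ _ ≫ E.arrow) := by
    rw [← Subobject.factorThru_arrow E p hp, ← Category.assoc, ← hg, Category.assoc, hm,
      ← Category.assoc]
    change _ = lift (g ≫ _) (g ≫ _) ≫ rmul
    congr 1
    ext <;> simp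
  rw [Category.assoc, h, comp_mul, ha, hb, mul_assoc, ← mul_assoc t, hE.central t b ht]
  simp only [mul_assoc]

lemma exists_mul_mul_pow (p : T ⟶ R) : ∃ (T' : C) (e : T' ⟶ T) (a b t : T' ⟶ R),
    Epi e ∧ E.Factors t ∧ e ≫ p = a * (b * (t * t * (t * t) * (t * t))) := by
  obtain ⟨T₁, e₁, m, s, h₁, hs, hp⟩ := hE.exists_mul.{w} p
  obtain ⟨T₂, e₂, s₁, t₁, h₂, ht₁, hp₁⟩ := hE.exists_mul_sq.{w} hs
  obtain ⟨T₃, e₃, s₂, t₂, h₃, ht₂, hp₂⟩ := hE.exists_mul_sq.{w} ht₁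
  obtain ⟨T₄, e₄, s₃, t₃, h₄, ht₃, hp₃⟩ := hE.exists_mul_sq.{w} ht₂
  refine ⟨T₄, e₄ ≫ e₃ ≫ e₂ ≫ e₁, e₄ ≫ e₃ ≫ e₂ ≫ m,
    (e₄ ≫ e₃ ≫ s₁) * ((e₄ ≫ s₂) * (s₃ * s₃) * ((e₄ ≫ s₂) * (s₃ * s₃)) * (t₃ * t₃)), t₃,
    epi_comp _ _, ht₃, ?_⟩
  have h : ∀ s t : T₄ ⟶ R, E.Factors t → s * (t * t) * (s * (t * t)) = s * s * (t * t * (t * t)) :=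
    fun s t ht => by
      rw [mul_assoc, ← mul_assoc (t * t) s, hE.central (t * t) s (hE.factors_mul ht ht)]
      simp only [mul_assoc]
  simp only [Category.assoc, hp, comp_mul, hp₁, hp₂, hp₃]
  rw [h _ _ ht₃, ← mul_assoc (e₄ ≫ s₂), h _ _ (hE.factors_mul ht₃ ht₃)]
  simp only [mul_assoc]

lemma hom_ext {X : C} {f g : R ⟶ X}
    (h : ∀ {T : C} (a b t : T ⟶ R), E.Factors t →
      (a * (b * (t * t * (t * t) * (t * t)))) ≫ f = (a * (b * (t * t * (t * t) * (t * t)))) ≫ g) :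
    f = g := by
  obtain ⟨T, e, a, b, t, he, ht, hp⟩ := hE.exists_mul_mul_pow.{w} (𝟙 R)
  rw [← cancel_epi e, ← Category.comp_id e, hp, h a b t ht]

lemma hom_ext_mul {X : C} {f g : R ⟶ X} (h : ∀ {T : C} (a b : T ⟶ R), (a * b) ≫ f = (a * b) ≫ g) :
    f = g :=
  hE.hom_ext.{w} fun _ _ _ _ => h _ _

omit [InfinitaryPretopos.{w} C] in
lemma lift_comp_eq_of_mul_eq {X : C} {f : R ⊗ R ⟶ X}
    (hb : ∀ {T : C} (p q r : T ⟶ R), lift (p * q) r ≫ f = lift p (q * r) ≫ f)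
    {m s n t : T ⟶ R} (hs : E.Factors s) (ht : E.Factors t) (h : m * s = n * t) :
    lift m s ≫ f = lift n t ≫ f := by
  obtain ⟨T₁, e₁, r, a, b, h₁, hr, -, -, ha, hb'⟩ := hE.common_divisor s t hs ht
  have h0 : ((e₁ ≫ m) * a - (e₁ ≫ n) * b) * r = 0 := by
    rw [sub_mul, mul_assoc, mul_assoc, ← ha, ← hb', ← comp_mul, ← comp_mul, h, sub_self]
  obtain ⟨T₂, e₂, r₁, r₂, h₂, -, -, hr', hr₁⟩ := hE.torsion _ r hr h0
  rw [comp_sub, sub_mul, sub_eq_zero] at hr₁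
  rw [← cancel_epi e₁, ← cancel_epi e₂, comp_lift_assoc, comp_lift_assoc, comp_lift_assoc,
    comp_lift_assoc, ha, hb', comp_mul, comp_mul, ← hb, ← hb, hr', ← hb, ← hb, ← comp_mul,
    ← comp_mul, hr₁]

/-- A balanced map is constant on the fibres of the multiplication `R × E → R`, so it descends. -/
lemma exists_hom_of_balanced {X : C} (f : R ⊗ R ⟶ X)
    (hb : ∀ {T : C} (p q r : T ⟶ R), lift (p * q) r ≫ f = lift p (q * r) ≫ f) :
    ∃ h : R ⟶ X, ∀ {T : C} (p q : T ⟶ R), lift p q ≫ f = (p * q) ≫ h := by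
  have := hE.smul_epi
  have comp_arrow {T : C} (s : T ⟶ R ⊗ (E : C)) : s ≫ (R ◁ E.arrow) =
      lift (s ≫ fst _ _) ((s ≫ snd _ _) ≫ E.arrow) := by ext <;> simp
  obtain ⟨h, hh⟩ := exists_desc_of_epi.{w} ((R ◁ E.arrow) ≫ rmul) ((R ◁ E.arrow) ≫ f)
    (fun T s t hst => by
      rw [← Category.assoc, ← Category.assoc, comp_arrow, comp_arrow] at hst ⊢
      exact hE.lift_comp_eq_of_mul_eq hb (Subobject.factors_comp_arrow _)
        (Subobject.factors_comp_arrow _) hst)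
  have factors {T : C} (m t : T ⟶ R) (ht : E.Factors t) : lift m t ≫ f = (m * t) ≫ h := by
    have key := congr(lift m (E.factorThru t ht) ≫ $hh)
    rw [← Category.assoc, ← Category.assoc, ← Category.assoc, comp_arrow, lift_fst, lift_snd,
      Subobject.factorThru_arrow] at key
    exact key.symm
  refine ⟨h, fun {T} p q => ?_⟩
  obtain ⟨T', e, m, t, he, ht, hq⟩ := hE.exists_mul.{w} q
  rw [← cancel_epi e, comp_lift_assoc, ← Category.assoc, comp_mul, hq, ← hb, ← mul_assoc,
    factors _ _ ht]

theorem exists_isAddToMulHom_of_balanced {X : C} [GrpObj X] (f : R ⊗ R ⟶ X)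
    (hl : ∀ {T : C} (p q r : T ⟶ R), lift (p + q) r ≫ f = (lift p r ≫ f) * (lift q r ≫ f))
    (hb : ∀ {T : C} (p q r : T ⟶ R), lift (p * q) r ≫ f = lift p (q * r) ≫ f) :
    ∃ h : R ⟶ X, IsAddToMulHom h ∧ ∀ {T : C} (p q : T ⟶ R), lift p q ≫ f = (p * q) ≫ h := by
  obtain ⟨h, hh⟩ := hE.exists_hom_of_balanced.{w} f hb
  refine ⟨h, fun {T} p q => ?_, hh⟩
  obtain ⟨T', e, m, n, t, he, -, hp, hq⟩ := hE.exists_mul₂.{w} p q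
  rw [← cancel_epi e, ← Category.assoc, comp_add, MonObj.comp_mul, ← Category.assoc,
    ← Category.assoc, hp, hq, ← add_mul, ← hh, ← hh, ← hh, hl]

end

end IsWeakUnit

end WeakUnits

section Pairings

lemma commutatorElement_central_mul_left {X : Type*} [Group X] {z : X} (hz : ∀ h, z * h = h * z)
    (a b : X) : ⁅z * a, b⁆ = ⁅a, b⁆ := by
  calc ⁅z * a, b⁆ = z * (a * b * a⁻¹) * z⁻¹ * b⁻¹ := by rw [commutatorElement_def]; group
    _ = ⁅a, b⁆ := by rw [hz, mul_inv_cancel_right, commutatorElement_def]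

variable {C : Type u} [Category.{v} C] [CartesianMonoidalCategory C]

lemma comp_commutator {G T T' : C} [GrpObj G] (f : T' ⟶ T) (a b : T ⟶ G) :
    f ≫ ⁅a, b⁆ = ⁅f ≫ a, f ≫ b⁆ := by
  simp only [commutatorElement_def, MonObj.comp_mul, GrpObj.comp_inv]

lemma commutator_comp {G H T : C} [GrpObj G] [GrpObj H] (f : G ⟶ H) [IsMonHom f]
    (a b : T ⟶ G) : ⁅a, b⁆ ≫ f = ⁅a ≫ f, b ≫ f⁆ := by
  simp only [commutatorElement_def, MonObj.mul_comp, GrpObj.inv_comp]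

namespace IsCentralExtension

variable {X G : C} [GrpObj X] [GrpObj G] {d : X ⟶ G}

lemma commutator_eq_of_comp_eq (hd : IsCentralExtension d) {T : C} {x x' y y' : T ⟶ X}
    (hx : x ≫ d = x' ≫ d) (hy : y ≫ d = y' ≫ d) : ⁅x, y⁆ = ⁅x', y'⁆ := by
  have := hd.isHom
  have exists_central_mul (a b : T ⟶ X) (hab : a ≫ d = b ≫ d) :
      ∃ z, (∀ h, z * h = h * z) ∧ a = z * b :=
    ⟨a * b⁻¹, fun h => hd.central _ h (by
      rw [MonObj.mul_comp, GrpObj.inv_comp, hab, mul_inv_cancel]), by group⟩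
  obtain ⟨z, hz, rfl⟩ := exists_central_mul _ _ hx
  obtain ⟨t, ht, rfl⟩ := exists_central_mul _ _ hy
  rw [commutatorElement_central_mul_left hz, ← commutatorElement_inv,
    commutatorElement_central_mul_left ht, commutatorElement_inv]

variable [InfinitaryPretopos.{w} C]

lemma exists_pairing (hd : IsCentralExtension d) : ∃ B : G ⊗ G ⟶ X, IsCommutatorPairing d B := by
  have := hd.isHom
  have := hd.epi
  have := epi_tensorHom_self.{w} d
  have h : ∀ {T : C} (s : T ⟶ X ⊗ X), s ≫ ⁅fst X X, snd X X⁆ = ⁅s ≫ fst X X, s ≫ snd X X⁆ :=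
    fun s => comp_commutator _ _ _
  obtain ⟨B, hB⟩ := exists_desc_of_epi.{w} (d ⊗ₘ d) ⁅fst X X, snd X X⁆ (fun T s t hst => by
    rw [h, h]
    have h₁ := congr($hst ≫ fst _ _)
    have h₂ := congr($hst ≫ snd _ _)
    simp only [Category.assoc, tensorHom_fst, tensorHom_snd] at h₁ h₂
    exact hd.commutator_eq_of_comp_eq (by simpa using h₁) (by simpa using h₂))
  have hB' : ∀ {T : C} (x y : T ⟶ X), lift (x ≫ d) (y ≫ d) ≫ B = ⁅x, y⁆ := fun x y => by
    rw [← lift_map, Category.assoc, hB, h, lift_fst, lift_snd]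
  refine ⟨B, fun {T} a b => ?_, hB'⟩
  obtain ⟨T', e, x, y, he, hx, hy⟩ := exists_epi_lift₂.{w} d a b
  rw [← cancel_epi e, comp_lift_assoc, ← hx, ← hy, ← Category.assoc, hB', commutator_comp,
    comp_commutator, hx, hy]

lemma commPairing (hd : IsCentralExtension d) {B : G ⊗ G ⟶ X} (hB : IsCommutatorPairing d B)
    (T : C) : CommPairing (fun z : T ⟶ X => z ≫ d) (fun a b : T ⟶ G => lift a b ≫ B) := by
  have := hd.isHom
  have := hd.epi
  have comm {T : C} (x y : T ⟶ X) : ⁅x ≫ d, y ≫ d⁆ = ⁅x, y⁆ ≫ d := (commutator_comp d x y).symm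
  refine ⟨fun a b => (Category.assoc _ _ _).trans (hB.comp a b), fun x y => hB.lift_comp x y,
    fun a b => ?_, fun a => ?_, fun a b c => ?_, fun a b c => ?_, fun z h hz => hd.central z h hz⟩
  · obtain ⟨T', e, x, y, he, hx, hy⟩ := exists_epi_lift₂.{w} d a b
    rw [← cancel_epi e]
    simp only [MonObj.comp_mul, MonObj.comp_one, comp_lift_assoc, ← hx, ← hy, hB.lift_comp]
    group
  · obtain ⟨T', e, x, he, hx⟩ := exists_epi_lift.{w} d a
    rw [← cancel_epi e, comp_lift_assoc, MonObj.comp_one, MonObj.comp_one, ← hx,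
      ← MonObj.one_comp d, hB.lift_comp, commutatorElement_one_left]
  all_goals
    obtain ⟨T', e, x, y, z, he, hx, hy, hz⟩ := exists_epi_lift₃.{w} d a b c
    rw [← cancel_epi e]
    simp only [MonObj.comp_mul, GrpObj.comp_inv, comp_lift_assoc, comp_commutator, ← hx, ← hy,
      ← hz, comm, ← MonObj.mul_comp, ← GrpObj.inv_comp, hB.lift_comp]
    simp only [commutatorElement_def]
    group

end IsCentralExtension

variable [BraidedCategory C]

/-- `B` is a reduced Steinberg pairing on generalized elements, for the root elements
`p ≫ x i j`. -/
def IsSteinbergPairing {R X G : C} [NonUnitalRingObj R] [GrpObj X] [GrpObj G]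
    (x : Fin 4 → Fin 4 → (R ⟶ G)) (d : X ⟶ G) (B : G ⊗ G ⟶ X) : Prop :=
  ∀ T : C, ReducedSteinbergPairing (fun i j (p : T ⟶ R) => p ≫ x i j) (fun z : T ⟶ X => z ≫ d)
    (fun a b : T ⟶ G => lift a b ≫ B)

lemma IsWeakUnit.isSteinbergPairing [InfinitaryPretopos.{w} C] {R X G : C} [NonUnitalRingObj R]
    [GrpObj X] [GrpObj G] {E : Subobject R} (hE : IsWeakUnit R E)
    {x : Fin 4 → Fin 4 → (R ⟶ G)} (hx : SteinbergRelations fun i j (_ : i ≠ j) => x i j)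
    {d : X ⟶ G} (hd : IsCentralExtension d) {B : G ⊗ G ⟶ X} (hB : IsCommutatorPairing d B) :
    IsSteinbergPairing x d B := by
  have H : ∀ T : C, SteinbergPairing (fun i j (p : T ⟶ R) => p ≫ x i j) (fun z : T ⟶ X => z ≫ d)
      (fun a b : T ⟶ G => lift a b ≫ B) := fun T =>
    { hd.commPairing.{w} hB T with
      map_add := fun hij p q => (hx.map_add _ _ hij p q).symm
      comm_mul := fun hij hjk hik => hx.comm_mul _ _ _ hij hjk hik
      comm_one := fun hij hkl hjk hil => hx.comm_one _ _ _ _ hij hkl hjk hil }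
  refine fun T => { H T with vanish := fun {i j k l} hij hkl hjk hil h p q => ?_ }
  obtain ⟨T', e, m, t, he, -, hp⟩ := hE.exists_mul.{w} p
  rw [← cancel_epi e, comp_lift_assoc, ← Category.assoc, ← Category.assoc, hp, MonObj.comp_one]
  exact (H T').pairing_mul_eq_one hij hkl hjk hil h m t (e ≫ q)

end Pairings

section DistinctIndices

/-- The indices `i`, `j`, `k`, `l` are distinct. -/
structure Distinct (i j k l : Fin 4) : Prop where
  ij : i ≠ j
  ik : i ≠ k
  il : i ≠ l
  jk : j ≠ k
  jl : j ≠ l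
  kl : k ≠ l

namespace Distinct

lemma zero_one_two_three : Distinct 0 1 2 3 :=
  ⟨by decide, by decide, by decide, by decide, by decide, by decide⟩

variable {i j k l : Fin 4} (h : Distinct i j k l)
include h

lemma swap₁₂ : Distinct j i k l :=
  ⟨h.ij.symm, h.jk, h.jl, h.ik, h.il, h.kl⟩

lemma swap₂₃ : Distinct i k j l :=
  ⟨h.ik, h.ij, h.il, h.jk.symm, h.kl, h.jl⟩

lemma swap₃₄ : Distinct i j l k :=
  ⟨h.ij, h.il, h.ik, h.jl, h.jk, h.kl.symm⟩

lemma swap₁₃ : Distinct k j i l :=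
  h.swap₁₂.swap₂₃.swap₁₂

lemma swap₂₄ : Distinct i l k j :=
  h.swap₂₃.swap₃₄.swap₂₃

lemma swap₁₄ : Distinct l j k i :=
  h.swap₁₂.swap₂₄.swap₁₂

lemma swap_pairs : Distinct k l i j :=
  h.swap₁₃.swap₂₄

lemma exists_perm : ∃ g : Equiv.Perm (Fin 4), g 0 = i ∧ g 1 = j ∧ g 2 = k ∧ g 3 = l := by
  have hinj : Function.Injective ![i, j, k, l] := by
    obtain ⟨hij, hik, hil, hjk, hjl, hkl⟩ := h
    intro a b hab
    fin_cases a <;> fin_cases b <;> simp_all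
  exact ⟨.ofBijective _ hinj.bijective_of_finite, rfl, rfl, rfl, rfl⟩

end Distinct

lemma Distinct.of_perm (g : Equiv.Perm (Fin 4)) : Distinct (g 0) (g 1) (g 2) (g 3) := by
  constructor <;> exact g.injective.ne (by decide)

variable {α : Type*} {c : Fin 4 → Fin 4 → Fin 4 → Fin 4 → α}

lemma eq_of_distinct_of_adjacent_swaps
    (h₁₂ : ∀ {i j k l}, Distinct i j k l → c j i k l = c i j k l)
    (h₂₃ : ∀ {i j k l}, Distinct i j k l → c i k j l = c i j k l)
    (h₃₄ : ∀ {i j k l}, Distinct i j k l → c i j l k = c i j k l)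
    {i j k l : Fin 4} (h : Distinct i j k l) : c i j k l = c 0 1 2 3 := by
  let f (g : Equiv.Perm (Fin 4)) : α := c (g 0) (g 1) (g 2) (g 3)
  have f_mul_swap (g : Equiv.Perm (Fin 4)) (a : Fin 3) :
      f (g * .swap a.castSucc a.succ) = f g := by
    fin_cases a
    · exact h₁₂ (.of_perm g)
    · exact h₂₃ (.of_perm g)
    · exact h₃₄ (.of_perm g)
  have f_eq (g : Equiv.Perm (Fin 4)) : f g = f 1 := by
    have hg : g ∈ Submonoid.closure
        (Set.range fun a : Fin 3 => Equiv.swap a.castSucc a.succ) := by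
      rw [Equiv.Perm.mclosure_swap_castSucc_succ]
      trivial
    induction hg using Submonoid.closure_induction_right with
    | one => rfl
    | mul_right g _ s hs ih =>
      obtain ⟨a, rfl⟩ := hs
      exact (f_mul_swap g a).trans ih
  obtain ⟨g, rfl, rfl, rfl, rfl⟩ := h.exists_perm
  exact f_eq g

lemma eq_of_distinct
    (h₁₃ : ∀ {i j k l}, Distinct i j k l → c i j k l = c k j i l)
    (h_pairs : ∀ {i j k l}, Distinct i j k l → c i j k l = c k l i j)
    (h₁₄ : ∀ {i j k l}, Distinct i j k l → c i j k l = c l j k i)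
    {i j k l : Fin 4} (h : Distinct i j k l) : c i j k l = c 0 1 2 3 := by
  have h₂₃ {i j k l} (h : Distinct i j k l) : c i k j l = c i j k l := by
    rw [h_pairs h, h₁₄ h.swap_pairs, h_pairs h.swap_pairs.swap₁₄]
  have h₁₂ {i j k l} (h : Distinct i j k l) : c j i k l = c i j k l := by
    rw [h₁₃ h, ← h₂₃ h.swap₁₃, h₁₃ h.swap₁₃.swap₂₃]
  have h₃₄ {i j k l} (h : Distinct i j k l) : c i j l k = c i j k l := by
    rw [h₁₄ h, h₁₃ h.swap₁₄, h₁₄ h.swap₁₄.swap₁₃]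
  exact eq_of_distinct_of_adjacent_swaps h₁₂ h₂₃ h₃₄ h

end DistinctIndices

section DisjointRoots

variable {C : Type u} [Category.{v} C] [CartesianMonoidalCategory C] [BraidedCategory C]
  {R X G : C} [NonUnitalRingObj R] [GrpObj X]

open NonUnitalRingObj

/-- The pairing `B` on the disjoint roots `i j` and `k l` factors through the product of `R` and the
homomorphism `c i j k l`. -/
structure IsDisjointRootFamily (x : Fin 4 → Fin 4 → (R ⟶ G)) (B : G ⊗ G ⟶ X)
    (c : Fin 4 → Fin 4 → Fin 4 → Fin 4 → (R ⟶ X)) : Prop where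
  isAddToMulHom : ∀ {i j k l : Fin 4}, Distinct i j k l → IsAddToMulHom (c i j k l)
  pairing : ∀ {i j k l : Fin 4}, Distinct i j k l → ∀ {T : C} (p q : T ⟶ R),
    lift (p ≫ x i j) (q ≫ x k l) ≫ B = (p * q) ≫ c i j k l

/-- The homomorphism `c` gives the values of the pairing `B` on all pairs of disjoint roots, and
takes values in involutions. It is invariant under the permutations of the factors of products. -/
structure IsDisjointRootPairing (x : Fin 4 → Fin 4 → (R ⟶ G)) (B : G ⊗ G ⟶ X) (c : R ⟶ X) :
    Prop where
  isAddToMulHom : IsAddToMulHom c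
  pairing : ∀ {i j k l : Fin 4}, Distinct i j k l → ∀ {T : C} (p q : T ⟶ R),
    lift (p ≫ x i j) (q ≫ x k l) ≫ B = (p * q) ≫ c
  mul_self : ∀ {T : C} (p : T ⟶ R), (p ≫ c) * (p ≫ c) = 1
  mul_comm : ∀ {T : C} (p q : T ⟶ R), (p * q) ≫ c = (q * p) ≫ c
  mul_left_comm : ∀ {T : C} (p q r : T ⟶ R), (p * (q * r)) ≫ c = (q * (p * r)) ≫ c

lemma IsDisjointRootPairing.isDisjointRootFamily {x : Fin 4 → Fin 4 → (R ⟶ G)} {B : G ⊗ G ⟶ X}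
    {c : R ⟶ X} (hc : IsDisjointRootPairing x B c) :
    IsDisjointRootFamily x B fun _ _ _ _ => c where
  isAddToMulHom _ := hc.isAddToMulHom
  pairing := hc.pairing

variable [GrpObj G] {E : Subobject R} (hE : IsWeakUnit R E)
  {x : Fin 4 → Fin 4 → (R ⟶ G)} {d : X ⟶ G} {B : G ⊗ G ⟶ X} (H : IsSteinbergPairing x d B)

section Existence

variable [InfinitaryPretopos.{w} C]
include hE H

lemma IsSteinbergPairing.disjoint_mul_self {i j k l : Fin 4} (h : Distinct i j k l) {T : C}
    (p q : T ⟶ R) :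
    (lift (p ≫ x i j) (q ≫ x k l) ≫ B) * (lift (p ≫ x i j) (q ≫ x k l) ≫ B) = 1 := by
  obtain ⟨T', e, a, b, t, he, -, hq⟩ := hE.exists_mul_mul_pow.{w} q
  rw [← cancel_epi e, MonObj.comp_mul, comp_lift_assoc, ← Category.assoc, ← Category.assoc, hq,
    MonObj.comp_one, ← mul_assoc]
  exact (H T').disjoint_mul_mul_sq h.ij h.ik h.il h.jk h.jl h.kl _ _ _ _

lemma IsSteinbergPairing.exists_disjoint {i j k l : Fin 4} (h : Distinct i j k l) :
    ∃ c : R ⟶ X, IsAddToMulHom c ∧ ∀ {T : C} (p q : T ⟶ R),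
      lift (p ≫ x i j) (q ≫ x k l) ≫ B = (p * q) ≫ c := by
  obtain ⟨c, hc, hc'⟩ := hE.exists_isAddToMulHom_of_balanced.{w} ((x i j ⊗ₘ x k l) ≫ B)
    (fun {T} p q r => by
      simp only [lift_map_assoc]
      exact (H T).disjoint_add_left h.ij h.kl h.jk h.il p q r)
    (fun {T} p q r => by
      simp only [lift_map_assoc]
      refine ((H T).disjoint_mul_left h.ij h.ik h.il h.jk h.jl h.kl p q r).trans ?_
      exact inv_eq_of_mul_eq_one_left (H.disjoint_mul_self.{w} hE h p (q * r)))
  simp only [lift_map_assoc] at hc'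
  exact ⟨c, hc, hc'⟩

theorem IsSteinbergPairing.exists_isDisjointRootFamily : ∃ c, IsDisjointRootFamily x B c := by
  have h_total (i j k l : Fin 4) : ∃ c : R ⟶ X, Distinct i j k l → IsAddToMulHom c ∧
      ∀ {T : C} (p q : T ⟶ R), lift (p ≫ x i j) (q ≫ x k l) ≫ B = (p * q) ≫ c := by
    by_cases h : Distinct i j k l
    · obtain ⟨c, hc⟩ := H.exists_disjoint.{w} hE h
      exact ⟨c, fun _ => hc⟩
    · exact ⟨1, fun h' => (h h').elim⟩
  choose c hc using h_total
  exact ⟨c, fun h => (hc _ _ _ _ h).1, fun h => (hc _ _ _ _ h).2⟩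

end Existence

namespace IsDisjointRootFamily

variable {c : Fin 4 → Fin 4 → Fin 4 → Fin 4 → (R ⟶ X)} (hc : IsDisjointRootFamily x B c)

section

variable {i j k l : Fin 4} (h : Distinct i j k l) {T : C}
include hc H h

lemma mul_left_comm (p q r : T ⟶ R) :
    (p * (q * r)) ≫ c k l i j = (q * (p * r)) ≫ c i l k j := by
  rw [← hc.pairing h.swap_pairs, ← hc.pairing h.swap₂₄]
  exact (H T).disjoint_mul_right_eq h.ij h.il h.jk h.jl h.kl p q r

lemma adjacent_mul_left (a b r : T ⟶ R) :
    lift ((a * b) ≫ x i j) (r ≫ x j k) ≫ B =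
      (lift (a ≫ x i l) ((b * r) ≫ x l k) ≫ B) * ((b * r) * (a * b)) ≫ c l k i j := by
  rw [← hc.pairing h.swap_pairs.swap₁₂]
  exact (H T).adjacent_mul_left h.ij h.ik h.il h.jk h.jl h.kl a b r

lemma adjacent_mul_mul_left (a b b' r : T ⟶ R) :
    lift ((a * b * b') ≫ x i j) (r ≫ x j k) ≫ B =
      (lift (a ≫ x i j) ((b * (b' * r)) ≫ x j k) ≫ B) *
        (((b * (b' * r)) * (a * b)) ≫ c j k i l * ((b' * r) * (a * b * b')) ≫ c l k i j) := by
  rw [hc.adjacent_mul_left H h, hc.adjacent_mul_left H h.swap₂₄, mul_assoc]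

end

variable [InfinitaryPretopos.{w} C] {i j k l : Fin 4} (h : Distinct i j k l) {T : C}
include hE hc H h

lemma mul_self (p : T ⟶ R) : (p ≫ c i j k l) * (p ≫ c i j k l) = 1 := by
  obtain ⟨T', e, m, t, he, -, hp⟩ := hE.exists_mul.{w} p
  rw [← cancel_epi e, MonObj.comp_mul, ← Category.assoc, hp, MonObj.comp_one, ← hc.pairing h]
  exact H.disjoint_mul_self.{w} hE h m t

lemma central (p : T ⟶ R) (z : T ⟶ X) : (p ≫ c i j k l) * z = z * (p ≫ c i j k l) := by
  obtain ⟨T', e, m, t, he, -, hp⟩ := hE.exists_mul.{w} p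
  rw [← cancel_epi e, MonObj.comp_mul, MonObj.comp_mul, ← Category.assoc, hp, ← hc.pairing h]
  exact (H T').pairing_mul_comm ((H T').comm_one h.ij h.kl h.jk h.il m t) (e ≫ z)

lemma mul_comm (p q : T ⟶ R) : (p * q) ≫ c i j k l = (q * p) ≫ c k l i j := by
  have h_swap := (H T).swap (p ≫ x i j) (q ≫ x k l)
  rw [hc.pairing h, hc.pairing h.swap_pairs] at h_swap
  rw [← mul_left_inj ((q * p) ≫ c k l i j), h_swap, hc.mul_self.{w} hE H h.swap_pairs]

lemma eq_swap₁₃ : c i j k l = c k j i l :=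
  hE.hom_ext.{w} fun {T} a b t ht => by
    have h' := hc.mul_left_comm H h.swap_pairs (a * b) t (t * (t * t) * (t * t))
    rw [← mul_assoc t (a * b), hE.central t (a * b) ht] at h'
    simpa only [mul_assoc] using h'

lemma eq_swap_pairs : c i j k l = c k l i j :=
  hE.hom_ext.{w} fun {T} a b t ht => by
    have ht₂ := hE.factors_mul ht ht
    rw [← mul_assoc, hc.mul_comm.{w} hE H h, hE.central (t * t * (t * t) * (t * t))]
    exact hE.factors_mul (hE.factors_mul ht₂ ht₂) ht₂

-- A factor `t ^ 4` moves across the pairing on adjacent roots at once or in two steps `t ^ 2`. The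
-- results differ by the product of the values of both sides.
lemma eq_swap₁₄ : c i j k l = c l j k i :=
  hE.hom_ext.{w} fun {T} r a t ht => by
    have h_adj := hc.adjacent_mul_mul_left H h.swap_pairs.swap₃₄ (T := T)
    have h_once := h_adj a (t * t) (t * t) r
    have h_twice := h_adj (a * (t * t)) t t r
    rw [← mul_assoc a t t, h_adj a t t] at h_twice
    have htr : t * r = r * t := hE.central t r ht
    have hta : t * a = a * t := hE.central t a ht
    have htr' (w : T ⟶ R) : w * t * r = w * r * t := by rw [mul_assoc, htr, ← mul_assoc]
    have hta' (w : T ⟶ R) : w * t * a = w * a * t := by rw [mul_assoc, hta, ← mul_assoc]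
    simp only [← mul_assoc r, ← mul_assoc a, ← mul_assoc t, ← mul_assoc (_ * _ : T ⟶ R), htr, htr',
      hta'] at h_once h_twice ⊢
    have h_sq (p : T ⟶ R) :
        (p ≫ c l j k i * p ≫ c i j k l) * (p ≫ c l j k i * p ≫ c i j k l) = 1 := by
      rw [Commute.mul_mul_mul_comm (hc.central.{w} hE H h p _), hc.mul_self.{w} hE H h,
        hc.mul_self.{w} hE H h.swap₁₄, mul_one]
    rw [h_once, mul_assoc (lift _ _ ≫ B), h_sq, mul_one] at h_twice
    exact (eq_inv_of_mul_eq_one_right (mul_eq_left.1 h_twice)).trans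
      (inv_eq_of_mul_eq_one_right (hc.mul_self.{w} hE H h.swap₁₄ _))

end IsDisjointRootFamily

include hE H in
theorem IsSteinbergPairing.exists_isDisjointRootPairing [InfinitaryPretopos.{w} C] :
    ∃ c : R ⟶ X, IsDisjointRootPairing x B c := by
  obtain ⟨c, hc⟩ := H.exists_isDisjointRootFamily.{w} hE
  have h := Distinct.zero_one_two_three
  have c_eq {i j k l : Fin 4} (h : Distinct i j k l) : c i j k l = c 0 1 2 3 :=
    eq_of_distinct (hc.eq_swap₁₃.{w} hE H) (hc.eq_swap_pairs.{w} hE H) (hc.eq_swap₁₄.{w} hE H) h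
  refine ⟨c 0 1 2 3, hc.isAddToMulHom h, fun h' _ _ _ => ?_, hc.mul_self.{w} hE H h,
    fun p q => ?_, fun p q r => ?_⟩
  · rw [← c_eq h', hc.pairing h']
  · rw [hc.mul_comm.{w} hE H h, c_eq h.swap_pairs]
  · rw [hc.mul_left_comm H h.swap_pairs, c_eq h.swap₁₃]

end DisjointRoots

section TraceLikeMaps

lemma exists_commRing_hom_of_traceLike {A : Type v} {M : Type*} [NonUnitalRing A] [Group M]
    (τ : A → M) (hadd : ∀ p q, τ (p + q) = τ p * τ q) (hcomm : ∀ p q, τ (p * q) = τ (q * p))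
    (hlc : ∀ p q r, τ (p * (q * r)) = τ (q * (p * r))) :
    ∃ (U : Type v) (_ : CommRing U) (φ : A →ₙ+* U), ∀ p q,
      φ p = φ q ↔ τ p = τ q ∧ ∀ r, τ (r * p) = τ (r * q) := by
  let kernel : RingCon A :=
    { r := fun p q => τ p = τ q ∧ ∀ r, τ (r * p) = τ (r * q)
      iseqv := ⟨fun p => ⟨rfl, fun _ => rfl⟩, fun h => ⟨h.1.symm, fun r => (h.2 r).symm⟩,
        fun h h' => ⟨h.1.trans h'.1, fun r => (h.2 r).trans (h'.2 r)⟩⟩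
      add' := fun {p q s t} h h' => ⟨by rw [hadd, hadd, h.1, h'.1], fun r => by
        rw [mul_add, mul_add, hadd, hadd, h.2, h'.2]⟩
      mul' := fun {p q s t} h h' => ⟨by rw [h'.2, hcomm, h.2, hcomm], fun r => by
        rw [← mul_assoc, h'.2, mul_assoc, hlc, hcomm, h.2, hcomm, hlc]⟩ }
  let _ : NonUnitalCommRing kernel.Quotient :=
    { (inferInstance : NonUnitalRing kernel.Quotient) with
      mul_comm := by
        rintro ⟨p⟩ ⟨q⟩
        refine (RingCon.eq kernel).2 ⟨hcomm p q, fun r => ?_⟩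
        rw [← mul_assoc, hcomm, hlc] }
  let φ : A →ₙ+* Unitization ℤ kernel.Quotient :=
    { toFun := fun p => ((p : kernel.Quotient) : Unitization ℤ kernel.Quotient)
      map_mul' := fun p q => by rw [RingCon.coe_mul, Unitization.inr_mul]
      map_zero' := by rw [RingCon.coe_zero, Unitization.inr_zero]
      map_add' := fun p q => by rw [RingCon.coe_add, Unitization.inr_add] }
  exact ⟨_, inferInstance, φ, fun p q => Unitization.inr_injective.eq_iff.trans (RingCon.eq kernel)⟩

end TraceLikeMaps

section AdjacentRoots

variable {C : Type u} [Category.{v} C] [CartesianMonoidalCategory C] [BraidedCategory C]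
  {R X G : C} [NonUnitalRingObj R] [GrpObj X]

open NonUnitalRingObj

namespace IsAddToMulHom

variable {c : R ⟶ X} (hc : IsAddToMulHom c) {T : C}
include hc

protected lemma map_zero : (0 : T ⟶ R) ≫ c = 1 := by
  have h := hc (0 : T ⟶ R) 0
  rw [add_zero] at h
  exact left_eq_mul.1 h

protected lemma map_neg (p : T ⟶ R) : (-p) ≫ c = (p ≫ c)⁻¹ :=
  eq_inv_of_mul_eq_one_left (by rw [← hc, neg_add_cancel, hc.map_zero])

end IsAddToMulHom

namespace IsDisjointRootPairing

variable {x : Fin 4 → Fin 4 → (R ⟶ G)} {B : G ⊗ G ⟶ X} {c : R ⟶ X}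
  (hc : IsDisjointRootPairing x B c)
include hc

lemma add_comp_eq_one_of_mul_eq {T : C} {z : T ⟶ X} {p q : T ⟶ R} (h : z * p ≫ c = z * q ≫ c) :
    (p + q) ≫ c = 1 := by
  rw [hc.isAddToMulHom, mul_left_cancel h, hc.mul_self]

lemma exists_commRing_hom (T : C) :
    ∃ (U : Type v) (_ : CommRing U) (φ : (T ⟶ R) →ₙ+* U), (∀ p, 2 * φ p = 0) ∧
      (∀ p q, φ p = φ q → p ≫ c = q ≫ c) ∧
      ∀ p, p ≫ c = 1 → (∀ r : T ⟶ R, (r * p) ≫ c = 1) → φ p = 0 := by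
  obtain ⟨U, hU, φ, hφ⟩ := exists_commRing_hom_of_traceLike (fun p : T ⟶ R => p ≫ c)
    hc.isAddToMulHom hc.mul_comm hc.mul_left_comm
  have φ_eq_zero (p : T ⟶ R) (h : p ≫ c = 1) (h' : ∀ r : T ⟶ R, (r * p) ≫ c = 1) : φ p = 0 := by
    have zero_comp : (0 : T ⟶ R) ≫ c = 1 := IsAddToMulHom.map_zero hc.isAddToMulHom
    rw [← map_zero φ, hφ]
    simp only [mul_zero, zero_comp, h, h', implies_true, and_self]
  refine ⟨U, hU, φ, fun p => ?_, fun p q h => ((hφ p q).1 h).1, φ_eq_zero⟩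
  rw [two_mul, ← map_add]
  refine φ_eq_zero _ ?_ fun r => ?_
  · rw [hc.isAddToMulHom, hc.mul_self]
  · rw [mul_add, hc.isAddToMulHom, hc.mul_self]

variable [GrpObj G] {d : X ⟶ G} (H : IsSteinbergPairing x d B) {T : C}
include H

section

variable {i j k l : Fin 4} (h : Distinct i j k l)
include h

lemma adjacent_mul_left (a b r : T ⟶ R) :
    lift ((a * b) ≫ x i j) (r ≫ x j k) ≫ B =
      (lift (a ≫ x i l) ((b * r) ≫ x l k) ≫ B) * ((b * r) * (a * b)) ≫ c :=
  hc.isDisjointRootFamily.adjacent_mul_left H h a b r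

lemma adjacent_mul_right (a b e r : T ⟶ R) :
    lift (a ≫ x i j) ((b * e * r) ≫ x j k) ≫ B =
      (lift (a ≫ x i l) ((b * e * r) ≫ x l k) ≫ B) *
        ((b * e * r) * (a * (b * e)) + ((b * e * r) * (a * b) + (e * r) * (a * (b * e)))) ≫ c := by
  have h_once := hc.adjacent_mul_left H h a (b * e) r
  have h_twice := hc.adjacent_mul_left H h (a * b) e r
  rw [hc.adjacent_mul_left H h.swap₂₄, ← mul_assoc b e r, mul_assoc a b e, h_once,
    mul_assoc (_ ≫ B), ← hc.isAddToMulHom] at h_twice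
  rw [hc.isAddToMulHom, ← mul_assoc, h_twice, mul_assoc (lift _ _ ≫ B), hc.mul_self, mul_one]

end

lemma mul_mul_sub_comp_eq_one (a r b e g : T ⟶ R) :
    (a * r * ((e * e - e) * (b * b * g - b * (g * g)))) ≫ c = 1 := by
  have h := Distinct.zero_one_two_three
  have h₁ := hc.adjacent_mul_right H h a (b * e) g r
  have h₂ := hc.adjacent_mul_right H h a b (e * g) r
  rw [← mul_assoc b e g, h₁] at h₂
  rw [← hc.add_comp_eq_one_of_mul_eq h₂]
  obtain ⟨U, _, φ, two_mul_φ, comp_eq, -⟩ := hc.exists_commRing_hom T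
  apply comp_eq
  have h_two := two_mul_φ (a * r * (b * e * g))
  simp only [map_mul, map_add, map_sub] at h_two ⊢
  linear_combination (- φ b * φ e * φ g - φ g * φ e - φ b) * h_two

lemma mul_mul_sq_mul_idempotents_comp_eq_one (a r b s e g : T ⟶ R) :
    (a * r * (b * (s * s)) * ((e * e - e) * (g * g - g))) ≫ c = 1 := by
  have h₁ := hc.mul_mul_sub_comp_eq_one H a r b e (s * g)
  have h₂ := hc.mul_mul_sub_comp_eq_one H a (r * g) b e s
  rw [← mul_one (1 : T ⟶ X)]
  nth_rw 1 [← h₁]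
  rw [← h₂, ← hc.isAddToMulHom]
  obtain ⟨U, _, φ, two_mul_φ, comp_eq, -⟩ := hc.exists_commRing_hom T
  apply comp_eq
  have h_two := two_mul_φ (a * r * b)
  simp only [map_mul, map_add, map_sub] at h_two ⊢
  linear_combination (φ s * φ g * (φ e ^ 2 - φ e) * (φ s * φ g - φ b)) * h_two

variable [InfinitaryPretopos.{w} C] {E : Subobject R} (hE : IsWeakUnit R E)
include hE

lemma central (p : T ⟶ R) (z : T ⟶ X) : (p ≫ c) * z = z * (p ≫ c) :=
  hc.isDisjointRootFamily.central.{w} hE H .zero_one_two_three p z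

lemma mul_idempotents_comp_eq_one (r e g : T ⟶ R) :
    (r * ((e * e - e) * (g * g - g))) ≫ c = 1 := by
  obtain ⟨T', e', a, b, t, he, -, hp⟩ := hE.exists_mul_mul_pow.{w} r
  rw [← cancel_epi e', ← Category.assoc, MonObj.comp_one, comp_mul, hp,
    ← hc.mul_mul_sq_mul_idempotents_comp_eq_one H a b (t * t * (t * t)) t (e' ≫ e) (e' ≫ g)]
  simp only [comp_mul, comp_sub, mul_assoc]

lemma idempotents_comp_eq_one (e g : T ⟶ R) : ((e * e - e) * (g * g - g)) ≫ c = 1 := by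
  obtain ⟨T', e', u, v, he, -, hp⟩ := hE.exists_mul.{w} e
  have h₁ := hc.mul_idempotents_comp_eq_one.{w} H hE (u * u) v (e' ≫ g)
  have h₂ := hc.mul_idempotents_comp_eq_one.{w} H hE v u (e' ≫ g)
  rw [← cancel_epi e', ← Category.assoc, MonObj.comp_one, ← mul_one (1 : T' ⟶ X)]
  nth_rw 1 [← h₁]
  rw [← h₂, ← hc.isAddToMulHom]
  obtain ⟨U, _, φ, -, comp_eq, -⟩ := hc.exists_commRing_hom T'
  apply comp_eq
  simp only [comp_mul, comp_sub, hp, map_mul, map_add, map_sub]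
  ring1

lemma exists_commRing_hom_idempotents (T : C) :
    ∃ (U : Type v) (_ : CommRing U) (φ : (T ⟶ R) →ₙ+* U), (∀ p, 2 * φ p = 0) ∧
      (∀ p q, φ p = φ q → p ≫ c = q ≫ c) ∧
      ∀ p q, (φ p * φ p - φ p) * (φ q * φ q - φ q) = 0 := by
  obtain ⟨U, hU, φ, two_mul_φ, comp_eq, φ_eq_zero⟩ := hc.exists_commRing_hom T
  refine ⟨U, hU, φ, two_mul_φ, comp_eq, fun p q => ?_⟩
  simpa only [map_mul, map_sub] using φ_eq_zero _ (hc.idempotents_comp_eq_one.{w} H hE p q)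
    fun r => hc.mul_idempotents_comp_eq_one.{w} H hE r p q

variable {i j k l : Fin 4} (h : Distinct i j k l)
include h

lemma adjacent_eq_mul (a r : T ⟶ R) :
    lift (a ≫ x i j) (r ≫ x j k) ≫ B = (lift (a ≫ x i l) (r ≫ x l k) ≫ B) * (a * r) ≫ c := by
  obtain ⟨T', e', p, q, t, he, -, hp⟩ := hE.exists_mul_mul_pow.{w} r
  rw [← cancel_epi e', MonObj.comp_mul, comp_lift_assoc, comp_lift_assoc]
  simp only [← Category.assoc, comp_mul, hp]
  rw [← mul_assoc, hc.adjacent_mul_right H h]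
  congr 1
  obtain ⟨U, _, φ, two_mul_φ, comp_eq, idempotents⟩ :=
    hc.exists_commRing_hom_idempotents.{w} H hE T'
  apply comp_eq
  have h_two := two_mul_φ (e' ≫ a)
  have h_idem := idempotents p q
  simp only [map_mul, map_add]
  linear_combination (φ (e' ≫ a) * (φ t) ^ 6) * h_idem +
    (φ p * φ q * φ t ^ 6 * (φ p + φ q - 1)) * h_two

-- The correction by values of `c` makes the pairing on adjacent roots balanced.
lemma exists_adjacent :
    ∃ y : R ⟶ X, IsAddToMulHom y ∧ ∀ {T : C} (p q : T ⟶ R),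
      (lift (p ≫ x i j) (q ≫ x j k) ≫ B) * (p * (q * q - q)) ≫ c = (p * q) ≫ y := by
  let f : R ⊗ R ⟶ X := (lift (fst R R ≫ x i j) (snd R R ≫ x j k) ≫ B) *
    (fst R R * (snd R R * snd R R - snd R R)) ≫ c
  have lift_f {T : C} (p q : T ⟶ R) : lift p q ≫ f =
      (lift (p ≫ x i j) (q ≫ x j k) ≫ B) * (p * (q * q - q)) ≫ c := by
    rw [MonObj.comp_mul, comp_lift_assoc, lift_fst_assoc, lift_snd_assoc,
      ← Category.assoc (lift p q), comp_mul, comp_sub, comp_mul, lift_fst, lift_snd]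
  have map_add_left {T : C} (p q r : T ⟶ R) :
      lift (p + q) r ≫ f = (lift p r ≫ f) * (lift q r ≫ f) := by
    rw [lift_f, lift_f, lift_f, add_mul, hc.isAddToMulHom,
      ← Commute.mul_mul_mul_comm (hc.central.{w} H hE _ _).symm]
    exact congrArg (· * _) ((H T).adjacent_add_left h.ij h.jk h.ik p q r)
  have balanced {T : C} (p q r : T ⟶ R) : lift (p * q) r ≫ f = lift p (q * r) ≫ f := by
    rw [lift_f, lift_f, hc.adjacent_mul_left H h, hc.adjacent_eq_mul.{w} H hE h.swap₂₄, mul_assoc,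
      mul_assoc, ← hc.isAddToMulHom, ← hc.isAddToMulHom]
    congr 1
    obtain ⟨U, _, φ, two_mul_φ, comp_eq, idempotents⟩ :=
      hc.exists_commRing_hom_idempotents.{w} H hE T
    apply comp_eq
    have h_two := two_mul_φ p
    have h_idem := idempotents q r
    simp only [map_mul, map_add, map_sub]
    linear_combination (-φ p) * h_idem + (φ q * φ r) * h_two
  obtain ⟨y, hy, hy'⟩ := hE.exists_isAddToMulHom_of_balanced.{w} f map_add_left balanced
  exact ⟨y, hy, fun p q => by rw [← lift_f, hy']⟩

end IsDisjointRootPairing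

end AdjacentRoots

section ExtendedRelations

variable {C : Type u} [Category.{v} C] [CartesianMonoidalCategory C] [BraidedCategory C]
  {R X G : C} [NonUnitalRingObj R] [GrpObj X]

open NonUnitalRingObj

/-- The relations between the lifts `y i j k` of the generators `x i k` to a central extension.
Here `j` is an auxiliary index, and `y i j k` is trivial unless `i`, `j`, `k` are distinct. -/
structure ExtendedSteinbergRelations (y : Fin 4 → Fin 4 → Fin 4 → (R ⟶ X)) (c : R ⟶ X) :
    Prop where
  map_add : ∀ i j k, IsAddToMulHom (y i j k)
  map_add_center : IsAddToMulHom c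
  trivial : ∀ {i j k : Fin 4}, ¬(i ≠ j ∧ j ≠ k ∧ i ≠ k) → ∀ {T : C} (p : T ⟶ R), p ≫ y i j k = 1
  central : ∀ (i j k : Fin 4) {T : C} (p q : T ⟶ R),
    (p ≫ c) * (q ≫ y i j k) = (q ≫ y i j k) * (p ≫ c)
  central_self : ∀ {T : C} (p q : T ⟶ R), (p ≫ c) * (q ≫ c) = (q ≫ c) * (p ≫ c)
  change : ∀ {i j k l : Fin 4}, Distinct i j k l → ∀ {T : C} (p : T ⟶ R),
    p ≫ y i j k = (p ≫ y i l k) * (p ≫ c)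
  comm_mul : ∀ {i j k : Fin 4} (m n : Fin 4), i ≠ j → j ≠ k → i ≠ k → i ≠ m → m ≠ j → j ≠ n →
    n ≠ k → ∀ {T : C} (p q : T ⟶ R),
      ⁅p ≫ y i m j, q ≫ y j n k⁆ = ((p * q) ≫ y i j k) * (p * (q * q - q)) ≫ c
  comm_disjoint : ∀ {i j k l : Fin 4} (m n : Fin 4), Distinct i j k l → i ≠ m → m ≠ j → k ≠ n →
    n ≠ l → ∀ {T : C} (p q : T ⟶ R), ⁅p ≫ y i m j, q ≫ y k n l⁆ = (p * q) ≫ c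
  comm_one : ∀ {i j k l : Fin 4} (m n : Fin 4), i ≠ j → k ≠ l → j ≠ k → i ≠ l → (i = k ∨ j = l) →
    i ≠ m → m ≠ j → k ≠ n → n ≠ l → ∀ {T : C} (p q : T ⟶ R), ⁅p ≫ y i m j, q ≫ y k n l⁆ = 1

/-- The homomorphisms `y i j k` give the values of the pairing `B` on the adjacent roots `i j` and
`j k`, up to a correction by the values `c` of the pairing on disjoint roots. They are trivial
unless `i`, `j`, `k` are distinct. -/
structure IsAdjacentRootFamily (x : Fin 4 → Fin 4 → (R ⟶ G)) (B : G ⊗ G ⟶ X) (c : R ⟶ X)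
    (y : Fin 4 → Fin 4 → Fin 4 → (R ⟶ X)) : Prop where
  isAddToMulHom : ∀ i j k, IsAddToMulHom (y i j k)
  eq_one : ∀ {i j k : Fin 4}, ¬(i ≠ j ∧ j ≠ k ∧ i ≠ k) → y i j k = 1
  mul_comp : ∀ {i j k : Fin 4}, i ≠ j → j ≠ k → i ≠ k → ∀ {T : C} (p q : T ⟶ R),
    (p * q) ≫ y i j k = (lift (p ≫ x i j) (q ≫ x j k) ≫ B) * (p * (q * q - q)) ≫ c

variable [GrpObj G] {x : Fin 4 → Fin 4 → (R ⟶ G)} {d : X ⟶ G} {B : G ⊗ G ⟶ X} {c : R ⟶ X}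
  {y : Fin 4 → Fin 4 → Fin 4 → (R ⟶ X)} [InfinitaryPretopos.{w} C] {E : Subobject R}
  (hE : IsWeakUnit R E) (H : IsSteinbergPairing x d B) (hc : IsDisjointRootPairing x B c)

include hE H hc in
theorem IsDisjointRootPairing.exists_isAdjacentRootFamily : ∃ y, IsAdjacentRootFamily x B c y := by
  have exists_distinct {i j k : Fin 4} (h : i ≠ j ∧ j ≠ k ∧ i ≠ k) : ∃ l, Distinct i j k l := by
    obtain ⟨l, hi, hj, hk⟩ : ∃ l : Fin 4, i ≠ l ∧ j ≠ l ∧ k ≠ l := by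
      revert i j k; decide
    exact ⟨l, h.1, h.2.2, hi, h.2.1, hj, hk⟩
  have h_total (i j k : Fin 4) : ∃ y : R ⟶ X, IsAddToMulHom y ∧
      (¬(i ≠ j ∧ j ≠ k ∧ i ≠ k) → y = 1) ∧ ((i ≠ j ∧ j ≠ k ∧ i ≠ k) → ∀ {T : C} (p q : T ⟶ R),
        (p * q) ≫ y = (lift (p ≫ x i j) (q ≫ x j k) ≫ B) * (p * (q * q - q)) ≫ c) := by
    by_cases h : i ≠ j ∧ j ≠ k ∧ i ≠ k
    · obtain ⟨l, hl⟩ := exists_distinct h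
      obtain ⟨y, hy, hy'⟩ := hc.exists_adjacent.{w} H hE hl
      exact ⟨y, hy, fun h' => (h' h).elim, fun _ {T} p q => (hy' p q).symm⟩
    · refine ⟨1, fun p q => ?_, fun _ => rfl, fun h' => (h h').elim⟩
      rw [MonObj.comp_one, MonObj.comp_one, MonObj.comp_one, mul_one]
  choose y hy y_eq_one mul_comp_y using h_total
  exact ⟨y, hy, y_eq_one _ _ _, fun hij hjk hik => mul_comp_y _ _ _ ⟨hij, hjk, hik⟩⟩

include hE H hc in
lemma IsDisjointRootPairing.comp_eq_one {T : C} (p : T ⟶ R) : (p ≫ c) ≫ d = 1 := by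
  have h := Distinct.zero_one_two_three
  obtain ⟨T', e, m, t, he, -, hp⟩ := hE.exists_mul.{w} p
  rw [← cancel_epi e, ← Category.assoc, ← Category.assoc, hp, ← hc.pairing h, MonObj.comp_one]
  exact ((H T').map _ _).trans ((H T').comm_one h.ij h.kl h.jk h.il m t)

namespace IsAdjacentRootFamily

variable (hy : IsAdjacentRootFamily x B c y)
include hE H hc hy

lemma comp_eq [IsMonHom d] {i j k : Fin 4} (hij : i ≠ j) (hjk : j ≠ k) (hik : i ≠ k) :
    y i j k ≫ d = x i k := by
  refine hE.hom_ext_mul.{w} fun {T} p q => ?_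
  rw [← Category.assoc, hy.mul_comp hij hjk hik, MonObj.mul_comp, hc.comp_eq_one.{w} hE H, mul_one]
  exact ((H T).map _ _).trans ((H T).comm_mul hij hjk hik p q)

lemma commutator_eq [IsMonHom d] {i j k l : Fin 4} (m n : Fin 4) (hij : i ≠ j) (hkl : k ≠ l)
    (him : i ≠ m) (hmj : m ≠ j) (hkn : k ≠ n) (hnl : n ≠ l) {T : C} (p q : T ⟶ R) :
    ⁅p ≫ y i m j, q ≫ y k n l⁆ = lift (p ≫ x i j) (q ≫ x k l) ≫ B := by
  rw [← (H T).comm, Category.assoc, Category.assoc, hy.comp_eq.{w} hE H hc him hmj hij,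
    hy.comp_eq.{w} hE H hc hkn hnl hkl]

lemma change {i j k l : Fin 4} (h : Distinct i j k l) : y i j k = y i l k * c := by
  refine hE.hom_ext_mul.{w} fun {T} p q => ?_
  rw [MonObj.comp_mul, hy.mul_comp h.ij h.jk h.ik, hy.mul_comp h.il h.kl.symm h.ik,
    hc.adjacent_eq_mul.{w} H hE h, mul_assoc, mul_assoc, hc.central.{w} H hE (p * q)]

theorem extendedSteinbergRelations [IsMonHom d] : ExtendedSteinbergRelations y c where
  map_add := hy.isAddToMulHom
  map_add_center := hc.isAddToMulHom
  trivial h _ p := by rw [hy.eq_one h, MonObj.comp_one]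
  central _ _ _ _ p _ := hc.central.{w} H hE p _
  central_self p _ := hc.central.{w} H hE p _
  change h _ p := by rw [← MonObj.comp_mul, hy.change.{w} hE H hc h]
  comm_mul m n hij hjk hik him hmj hjn hnk _ p q := by
    rw [hy.commutator_eq.{w} hE H hc m n hij hjk him hmj hjn hnk, hy.mul_comp hij hjk hik,
      mul_assoc, hc.mul_self, mul_one]
  comm_disjoint m n h him hmj hkn hnl _ p q := by
    rw [hy.commutator_eq.{w} hE H hc m n h.ij h.kl him hmj hkn hnl, hc.pairing h]
  comm_one m n hij hkl hjk hil h him hmj hkn hnl T p q := by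
    rw [hy.commutator_eq.{w} hE H hc m n hij hkl him hmj hkn hnl]
    exact (H T).vanish hij hkl hjk hil h p q

end IsAdjacentRootFamily

omit [GrpObj G] in
include hE in
lemma ExtendedSteinbergRelations.eq_of_commutators_eq
    {y' : Fin 4 → Fin 4 → Fin 4 → (R ⟶ X)} {c' : R ⟶ X}
    (hy : ExtendedSteinbergRelations y c) (hy' : ExtendedSteinbergRelations y' c')
    (h : ∀ {i j k l : Fin 4} (m n : Fin 4), i ≠ j → k ≠ l → i ≠ m → m ≠ j → k ≠ n → n ≠ l →
      ∀ {T : C} (p q : T ⟶ R), ⁅p ≫ y i m j, q ≫ y k n l⁆ = ⁅p ≫ y' i m j, q ≫ y' k n l⁆) :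
    y = y' ∧ c = c' := by
  have hc : c = c' := hE.hom_ext_mul.{w} fun {T} p q => by
    rw [← hy.comm_disjoint 2 1 .zero_one_two_three (by decide) (by decide) (by decide) (by decide),
      ← hy'.comm_disjoint 2 1 .zero_one_two_three (by decide) (by decide) (by decide) (by decide)]
    exact h _ _ (by decide) (by decide) (by decide) (by decide) (by decide) (by decide) _ _
  subst hc
  refine ⟨?_, rfl⟩
  ext i j k
  by_cases hijk : i ≠ j ∧ j ≠ k ∧ i ≠ k
  · obtain ⟨hij, hjk, hik⟩ := hijk
    refine hE.hom_ext_mul.{w} fun {T} p q => ?_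
    have h₁ := hy.comm_mul k i hij hjk hik hik hjk.symm hij.symm hik p q
    have h₂ := hy'.comm_mul k i hij hjk hik hik hjk.symm hij.symm hik p q
    rw [h k i hij hjk hik hjk.symm hij.symm hik, h₂] at h₁
    exact (mul_right_cancel h₁).symm
  · rw [← Category.id_comp (y i j k), ← Category.id_comp (y' i j k), hy.trivial hijk,
      hy'.trivial hijk]

end ExtendedRelations

section SteinbergPresentations

variable {C : Type u} [Category.{v} C] [CartesianMonoidalCategory C] [BraidedCategory C] {R : C}
  [NonUnitalRingObj R]

open NonUnitalRingObj

/-- The relations which make the interpretation of each generator `i : I` a homomorphism from the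
additive group of `R`. Words form a monoid only, so triviality of `(i, 0)` has to be imposed. -/
def additiveRelation (I : Type) (R : C) [NonUnitalRingObj R] : PresheafRel (Word.presheaf I R) :=
  Word.relation
    (fun k _ p q => k.elim (fun i => FreeMonoid.of (i, p) * FreeMonoid.of (i, q))
      fun i => FreeMonoid.of (i, 0))
    (fun (k : I ⊕ I) _ p q => k.elim (fun i => FreeMonoid.of (i, p + q)) fun _ => 1)

lemma isSmallRel_additiveRelation (I : Type) : IsSmallRel.{w} _ (additiveRelation I R) :=
  Word.isSmallRel_relation (by rintro (i | i) T T' f p q <;> simp)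
    (by rintro (i | i) T T' f p q <;> simp [comp_add])

lemma satisfiesRelations_additiveRelation_iff {I : Type} {G : C} [GrpObj G] {x : I → (R ⟶ G)} :
    SatisfiesRelations (additiveRelation I R) x ↔ ∀ i, IsAddToMulHom (x i) := by
  refine satisfiesRelations_relation_iff.trans
    ⟨fun h i T p q => by simpa using (h (.inl i) p q).symm, fun h k T p q => ?_⟩
  obtain i | i := k
  · simpa using (h i p q).symm
  · simpa using IsAddToMulHom.map_zero (h i)

lemma wordCongruence_neg_mul_of {I : Type} {ρ : PresheafRel (Word.presheaf I R)}
    (h : ∀ ⦃T : C⦄ (a b : Word I R T), additiveRelation I R a b → ρ a b) (i : I) {T : C}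
    (p : T ⟶ R) :
    wordCongruence.{w} ρ (FreeMonoid.of (i, -p) * FreeMonoid.of (i, p) : Word I R T)
      (1 : Word I R T) := by
  have hadd : wordCongruence.{w} ρ (FreeMonoid.of (i, -p) * FreeMonoid.of (i, p) : Word I R T)
      (FreeMonoid.of (i, 0) : Word I R T) :=
    .of _ _ (h _ _ ⟨.inl i, -p, p, rfl, by simp⟩)
  exact hadd.trans (.of _ _ (h _ _ ⟨.inr i, 0, 0, rfl, rfl⟩))

theorem exists_presented_grpObj_of_additive [InfinitaryPretopos.{w} C] {I : Type}
    {ρ : PresheafRel (Word.presheaf I R)} (hρ : IsSmallRel.{w} _ ρ) :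
    ∃ (G : C) (_ : GrpObj G) (x : I → (R ⟶ G)), (∀ i, IsAddToMulHom (x i)) ∧
      SatisfiesRelations ρ x ∧ IsGeneratedBy.{w} x ∧
      ∀ (H : C) [GrpObj H] (y : I → (R ⟶ H)), (∀ i, IsAddToMulHom (y i)) →
        SatisfiesRelations ρ y → ∃! f : G ⟶ H, IsMonHom f ∧ ∀ i, x i ≫ f = y i := by
  obtain ⟨G, _, x, hx, hgen, hu⟩ :=
    exists_presented_grpObj.{w} ((isSmallRel_additiveRelation I).or hρ)
      fun i T p => ⟨_, wordCongruence_neg_mul_of (fun _ _ _ => .inl) i p⟩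
  exact ⟨G, _, x, satisfiesRelations_additiveRelation_iff.1 fun T a b hab => hx a b (.inl hab),
    fun T a b hab => hx a b (.inr hab), hgen, fun H _ y hy hy' => hu H y fun T a b hab =>
      hab.elim (satisfiesRelations_additiveRelation_iff.2 hy a b) (hy' a b)⟩

/-- The relations between the generators of the Steinberg group. -/
inductive SteinbergRel (n : ℕ)
  | comm_mul (i j k : Fin n) (hij : i ≠ j) (hjk : j ≠ k) (hik : i ≠ k)
  | comm_one (i j k l : Fin n) (hij : i ≠ j) (hkl : k ≠ l) (hjk : j ≠ k) (hil : i ≠ l)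

namespace SteinbergRel

/-- The indices `i ≠ j` of the generators `x i j p` of the Steinberg group. -/
abbrev Gen (n : ℕ) := {a : Fin n × Fin n // a.1 ≠ a.2}

/-- The left hand sides of the relations, written without inverses. -/
def lhs {n : ℕ} {T : C} (p q : T ⟶ R) : SteinbergRel n → Word (Gen n) R T
  | comm_mul i j k hij hjk _ => .of (⟨(i, j), hij⟩, p) * .of (⟨(j, k), hjk⟩, q)
  | comm_one i j k l hij hkl _ _ => .of (⟨(i, j), hij⟩, p) * .of (⟨(k, l), hkl⟩, q)

/-- The right hand sides of the relations, written without inverses. -/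
def rhs {n : ℕ} {T : C} (p q : T ⟶ R) : SteinbergRel n → Word (Gen n) R T
  | comm_mul i j k hij hjk hik =>
    .of (⟨(i, k), hik⟩, p * q) * .of (⟨(j, k), hjk⟩, q) * .of (⟨(i, j), hij⟩, p)
  | comm_one i j k l hij hkl _ _ => .of (⟨(k, l), hkl⟩, q) * .of (⟨(i, j), hij⟩, p)

/-- The relation on words given by the Steinberg relations. -/
def relation (n : ℕ) (R : C) [NonUnitalRingObj R] : PresheafRel (Word.presheaf (Gen n) R) :=
  Word.relation (fun (k : SteinbergRel n) _ p q => k.lhs p q) fun k _ p q => k.rhs p q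

lemma isSmallRel_relation (n : ℕ) : IsSmallRel.{w} _ (relation n R) :=
  Word.isSmallRel_relation (by rintro (_ | _) T T' f p q <;> simp [lhs])
    (by rintro (_ | _) T T' f p q <;> simp [rhs, comp_mul])

end SteinbergRel

lemma commutatorElement_eq_iff {G : Type*} [Group G] {a b c : G} :
    ⁅a, b⁆ = c ↔ a * b = c * b * a := by
  rw [commutatorElement_def, mul_inv_eq_iff_eq_mul, mul_inv_eq_iff_eq_mul]

lemma steinbergRelations_iff {n : ℕ} {G : C} [GrpObj G] (x : SteinbergRel.Gen n → (R ⟶ G)) :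
    SteinbergRelations (fun i j hij => x ⟨(i, j), hij⟩) ↔
      (∀ i, IsAddToMulHom (x i)) ∧ SatisfiesRelations (SteinbergRel.relation n R) x := by
  rw [SteinbergRel.relation, satisfiesRelations_relation_iff]
  refine ⟨fun h => ⟨fun ⟨⟨i, j⟩, hij⟩ {T} p q => (h.map_add i j hij p q).symm, fun k T p q => ?_⟩,
    fun ⟨h, h'⟩ => ⟨fun i j hij {T} p q => (h ⟨(i, j), hij⟩ p q).symm,
      fun i j k hij hjk hik T p q => ?_, fun i j k l hij hkl hjk hil T p q => ?_⟩⟩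
  · cases k with
    | comm_mul i j k hij hjk hik =>
      simpa [SteinbergRel.lhs, SteinbergRel.rhs, commutatorElement_eq_iff] using
        h.comm_mul i j k hij hjk hik p q
    | comm_one i j k l hij hkl hjk hil =>
      simpa [SteinbergRel.lhs, SteinbergRel.rhs, commutatorElement_eq_iff] using
        h.comm_one i j k l hij hkl hjk hil p q
  · simpa [SteinbergRel.lhs, SteinbergRel.rhs, commutatorElement_eq_iff] using
      h' (.comm_mul i j k hij hjk hik) p q
  · simpa [SteinbergRel.lhs, SteinbergRel.rhs, commutatorElement_eq_iff] using
      h' (.comm_one i j k l hij hkl hjk hil) p q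

section SteinbergGroup

variable [InfinitaryPretopos.{w} C]

variable (R) in
theorem exists_isSteinbergGroup (n : ℕ) : ∃ (G : C) (_ : GrpObj G)
    (x : ∀ i j : Fin n, i ≠ j → (R ⟶ G)), IsSteinbergGroup x ∧
      IsGeneratedBy.{w} fun a : SteinbergRel.Gen n => x a.1.1 a.1.2 a.2 := by
  obtain ⟨G, hG, x, hx, hx', hgen, hu⟩ :=
    exists_presented_grpObj_of_additive.{w} (SteinbergRel.isSmallRel_relation (R := R) n)
  refine ⟨G, hG, fun i j hij => x ⟨(i, j), hij⟩, ⟨(steinbergRelations_iff x).2 ⟨hx, hx'⟩,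
    fun H _ y hy => ?_⟩, hgen⟩
  obtain ⟨hy₁, hy₂⟩ := (steinbergRelations_iff fun a => y a.1.1 a.1.2 a.2).1 hy
  obtain ⟨f, ⟨hf, hxf⟩, hf_unique⟩ := hu H _ hy₁ hy₂
  exact ⟨f, ⟨hf, fun i j hij => hxf ⟨(i, j), hij⟩⟩,
    fun g hg => hf_unique g ⟨hg.1, fun a => hg.2 _ _ _⟩⟩

lemma IsSteinbergGroup.isGeneratedBy {n : ℕ} {G : C} [GrpObj G]
    {x : ∀ i j : Fin n, i ≠ j → (R ⟶ G)} (hx : IsSteinbergGroup x) :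
    IsGeneratedBy.{w} fun a : SteinbergRel.Gen n => x a.1.1 a.1.2 a.2 := by
  obtain ⟨G', _, x', hx', hgen⟩ := exists_isSteinbergGroup.{w} R n
  obtain ⟨f, ⟨_, hf⟩, -⟩ := hx.universal G' x' hx'.relations
  obtain ⟨g, ⟨_, hg⟩, -⟩ := hx'.universal G x hx.relations
  have hfg : f ≫ g = 𝟙 G := (hx.universal G x hx.relations).unique
    ⟨inferInstance, fun i j hij => by rw [← Category.assoc, hf, hg]⟩
    ⟨inferInstance, fun i j hij => Category.comp_id _⟩
  refine fun T s => (hgen (s ≫ f)).mono fun T' e ⟨a, ha⟩ => ⟨a, ?_⟩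
  have hag := congr($ha ≫ g)
  rw [Category.assoc, Category.assoc, hfg, Category.comp_id, Word.eval_comp] at hag
  simpa only [hg] using hag

end SteinbergGroup

/-- The relations between the generators of the universal central extension of the Steinberg
group. -/
inductive ExtendedSteinbergRel
  | trivial (i j k : Fin 4) (h : ¬(i ≠ j ∧ j ≠ k ∧ i ≠ k))
  | central (i j k : Fin 4)
  | central_self
  | change (i j k l : Fin 4) (h : Distinct i j k l)
  | comm_mul (i j k m n : Fin 4) (hij : i ≠ j) (hjk : j ≠ k) (hik : i ≠ k) (him : i ≠ m)
    (hmj : m ≠ j) (hjn : j ≠ n) (hnk : n ≠ k)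
  | comm_disjoint (i j k l m n : Fin 4) (h : Distinct i j k l) (him : i ≠ m) (hmj : m ≠ j)
    (hkn : k ≠ n) (hnl : n ≠ l)
  | comm_one (i j k l m n : Fin 4) (hij : i ≠ j) (hkl : k ≠ l) (hjk : j ≠ k) (hil : i ≠ l)
    (h : i = k ∨ j = l) (him : i ≠ m) (hmj : m ≠ j) (hkn : k ≠ n) (hnl : n ≠ l)

namespace ExtendedSteinbergRel

/-- The indices of the generators of the universal central extension: `some (i, j, k)` stands for a
lift of the root elements `x i k`, obtained from the commutators of the root elements `x i j` and
`x j k`, and `none` for the elements of the Schur multiplier. -/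
abbrev Gen := Option (Fin 4 × Fin 4 × Fin 4)

/-- The left hand sides of the relations, written without inverses. -/
def lhs {T : C} (p q : T ⟶ R) : ExtendedSteinbergRel → Word Gen R T
  | trivial i j k _ => .of (some (i, j, k), p)
  | central i j k => .of (none, p) * .of (some (i, j, k), q)
  | central_self => .of (none, p) * .of (none, q)
  | change i j k _ _ => .of (some (i, j, k), p)
  | comm_mul i j k m n _ _ _ _ _ _ _ => .of (some (i, m, j), p) * .of (some (j, n, k), q)
  | comm_disjoint i j k l m n _ _ _ _ _ => .of (some (i, m, j), p) * .of (some (k, n, l), q)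
  | comm_one i j k l m n _ _ _ _ _ _ _ _ _ => .of (some (i, m, j), p) * .of (some (k, n, l), q)

/-- The right hand sides of the relations, written without inverses. -/
def rhs {T : C} (p q : T ⟶ R) : ExtendedSteinbergRel → Word Gen R T
  | trivial _ _ _ _ => 1
  | central i j k => .of (some (i, j, k), q) * .of (none, p)
  | central_self => .of (none, q) * .of (none, p)
  | change i _ k l _ => .of (some (i, l, k), p) * .of (none, p)
  | comm_mul i j k m n _ _ _ _ _ _ _ =>
    .of (some (i, j, k), p * q) * .of (none, p * (q * q - q)) * .of (some (j, n, k), q) *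
      .of (some (i, m, j), p)
  | comm_disjoint i j k l m n _ _ _ _ _ =>
    .of (none, p * q) * .of (some (k, n, l), q) * .of (some (i, m, j), p)
  | comm_one i j k l m n _ _ _ _ _ _ _ _ _ => .of (some (k, n, l), q) * .of (some (i, m, j), p)

/-- The relation on words given by the relations of the universal central extension. -/
def relation (R : C) [NonUnitalRingObj R] : PresheafRel (Word.presheaf Gen R) :=
  Word.relation (fun (k : ExtendedSteinbergRel) _ p q => k.lhs p q) fun k _ p q => k.rhs p q

lemma isSmallRel_relation : IsSmallRel.{w} _ (relation R) :=
  Word.isSmallRel_relation (by rintro k T T' f p q; cases k <;> simp [lhs])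
    (by rintro k T T' f p q; cases k <;> simp [rhs, comp_mul, comp_sub])

end ExtendedSteinbergRel

section ExtendedSteinbergGroup

variable {X : C} [GrpObj X] {y : ExtendedSteinbergRel.Gen → (R ⟶ X)}

lemma ExtendedSteinbergRelations.satisfiesRelations
    (h : ExtendedSteinbergRelations (fun i j k => y (some (i, j, k))) (y none)) :
    SatisfiesRelations (ExtendedSteinbergRel.relation R) y := by
  refine satisfiesRelations_relation_iff.2 fun k T p q => ?_
  cases k with
  | trivial i j k hijk =>
    simpa [ExtendedSteinbergRel.lhs, ExtendedSteinbergRel.rhs] using h.trivial hijk p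
  | central i j k =>
    simpa [ExtendedSteinbergRel.lhs, ExtendedSteinbergRel.rhs] using h.central i j k p q
  | central_self =>
    simpa [ExtendedSteinbergRel.lhs, ExtendedSteinbergRel.rhs] using h.central_self p q
  | change i j k l hi =>
    simpa [ExtendedSteinbergRel.lhs, ExtendedSteinbergRel.rhs] using h.change hi p
  | comm_mul i j k m n hij hjk hik him hmj hjn hnk =>
    simpa [ExtendedSteinbergRel.lhs, ExtendedSteinbergRel.rhs, commutatorElement_eq_iff] using
      h.comm_mul m n hij hjk hik him hmj hjn hnk p q
  | comm_disjoint i j k l m n hi him hmj hkn hnl =>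
    simpa [ExtendedSteinbergRel.lhs, ExtendedSteinbergRel.rhs, commutatorElement_eq_iff] using
      h.comm_disjoint m n hi him hmj hkn hnl p q
  | comm_one i j k l m n hij hkl hjk hil hi him hmj hkn hnl =>
    simpa [ExtendedSteinbergRel.lhs, ExtendedSteinbergRel.rhs, commutatorElement_eq_iff] using
      h.comm_one m n hij hkl hjk hil hi him hmj hkn hnl p q

lemma SatisfiesRelations.extendedSteinbergRelations (hy : ∀ i, IsAddToMulHom (y i))
    (h : SatisfiesRelations (ExtendedSteinbergRel.relation R) y) :
    ExtendedSteinbergRelations (fun i j k => y (some (i, j, k))) (y none) := by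
  have h' := satisfiesRelations_relation_iff.1 h
  refine ⟨fun i j k => hy _, hy _, fun {i j k} hi {T} p => ?_, fun i j k {T} p q => ?_,
    fun {T} p q => ?_, fun {i j k l} hi {T} p => ?_, ?_, ?_, ?_⟩
  · simpa [ExtendedSteinbergRel.lhs, ExtendedSteinbergRel.rhs] using h' (.trivial i j k hi) p p
  · simpa [ExtendedSteinbergRel.lhs, ExtendedSteinbergRel.rhs] using h' (.central i j k) p q
  · simpa [ExtendedSteinbergRel.lhs, ExtendedSteinbergRel.rhs] using h' .central_self p q
  · simpa [ExtendedSteinbergRel.lhs, ExtendedSteinbergRel.rhs] using h' (.change i j k l hi) p p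
  · intro i j k m n hij hjk hik him hmj hjn hnk T p q
    simpa [ExtendedSteinbergRel.lhs, ExtendedSteinbergRel.rhs, commutatorElement_eq_iff] using
      h' (.comm_mul i j k m n hij hjk hik him hmj hjn hnk) p q
  · intro i j k l m n hi him hmj hkn hnl T p q
    simpa [ExtendedSteinbergRel.lhs, ExtendedSteinbergRel.rhs, commutatorElement_eq_iff] using
      h' (.comm_disjoint i j k l m n hi him hmj hkn hnl) p q
  · intro i j k l m n hij hkl hjk hil hi him hmj hkn hnl T p q
    simpa [ExtendedSteinbergRel.lhs, ExtendedSteinbergRel.rhs, commutatorElement_eq_iff] using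
      h' (.comm_one i j k l m n hij hkl hjk hil hi him hmj hkn hnl) p q

/-- The group object `X` is given by the generators `y i j k p`, `c p` and the extended Steinberg
relations. It is the universal central extension of the Steinberg group. -/
structure IsExtendedSteinbergGroup [InfinitaryPretopos.{w} C]
    (y : Fin 4 → Fin 4 → Fin 4 → (R ⟶ X)) (c : R ⟶ X) : Prop where
  relations : ExtendedSteinbergRelations y c
  isGeneratedBy :
    IsGeneratedBy.{w} fun a : ExtendedSteinbergRel.Gen => a.elim c fun t => y t.1 t.2.1 t.2.2
  universal : ∀ (H : C) [GrpObj H] (z : Fin 4 → Fin 4 → Fin 4 → (R ⟶ H)) (c' : R ⟶ H),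
    ExtendedSteinbergRelations z c' →
      ∃ f : X ⟶ H, IsMonHom f ∧ (∀ i j k, y i j k ≫ f = z i j k) ∧ c ≫ f = c'

variable (R) in
theorem exists_isExtendedSteinbergGroup [InfinitaryPretopos.{w} C] :
    ∃ (X : C) (_ : GrpObj X) (y : Fin 4 → Fin 4 → Fin 4 → (R ⟶ X)) (c : R ⟶ X),
      IsExtendedSteinbergGroup.{w} y c := by
  obtain ⟨X, hX, y, hy, hy', hgen, hu⟩ :=
    exists_presented_grpObj_of_additive.{w} (ExtendedSteinbergRel.isSmallRel_relation (R := R))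
  refine ⟨X, hX, fun i j k => y (some (i, j, k)), y none, hy'.extendedSteinbergRelations hy, ?_,
    fun H _ z c' hz => ?_⟩
  · convert hgen with a
    cases a <;> rfl
  · obtain ⟨f, ⟨hf, hfy⟩, -⟩ := hu H (fun a => a.elim c' fun t => z t.1 t.2.1 t.2.2)
      (by rintro (_ | ⟨i, j, k⟩); exacts [hz.map_add_center, hz.map_add i j k])
      (ExtendedSteinbergRelations.satisfiesRelations hz)
    exact ⟨f, hf, fun i j k => hfy (some (i, j, k)), hfy none⟩

end ExtendedSteinbergGroup

end SteinbergPresentations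

section Quotients

variable {C : Type u} [Category.{v} C] [CartesianMonoidalCategory C] {S X : C} [GrpObj X]

lemma isSmallRel_inv_mul_mem (c : S ⟶ X) (N : ∀ T : C, Subgroup (T ⟶ X))
    (hN : ∀ {T : C} {z : T ⟶ X}, z ∈ N T ↔ ∃ p : T ⟶ S, p ≫ c = z) :
    IsSmallRel.{w} (yoneda.obj X) fun T (y z : T ⟶ X) => y⁻¹ * z ∈ N T := by
  refine ⟨fun T T' f (y z : T ⟶ X) h => ?_, PUnit, fun _ => X ⊗ S, fun _ => fst X S,
    fun _ => fst X S * (snd X S ≫ c), fun _ => ?_, fun T (y z : T ⟶ X) h => ?_⟩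
  · obtain ⟨p, hp⟩ := hN.1 h
    refine hN.2 ⟨f ≫ p, ?_⟩
    rw [Category.assoc, hp, MonObj.comp_mul, GrpObj.comp_inv]
    rfl
  · rw [inv_mul_cancel_left]
    exact hN.2 ⟨_, rfl⟩
  · obtain ⟨p, hp⟩ := hN.1 h
    refine ⟨⟨⟩, lift y p, lift_fst _ _, (MonObj.comp_mul _ _ _).trans ?_⟩
    change lift y p ≫ fst X S * lift y p ≫ snd X S ≫ c = z
    rw [lift_fst, lift_snd_assoc, hp, mul_inv_cancel_left]

theorem exists_grpObj_quotient [InfinitaryPretopos.{w} C] (c : S ⟶ X)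
    (N : ∀ T : C, Subgroup (T ⟶ X)) [∀ T, (N T).Normal]
    (hN : ∀ {T : C} {z : T ⟶ X}, z ∈ N T ↔ ∃ p : T ⟶ S, p ≫ c = z) :
    ∃ (Q : C) (_ : GrpObj Q) (q : X ⟶ Q), IsMonHom q ∧ Epi q ∧ c ≫ q = 1 ∧ ∀ {T : C} (z : T ⟶ X),
      z ≫ q = 1 → Locally.{w} T fun T' e => ∃ p : T' ⟶ S, p ≫ c = e ≫ z := by
  have hρ := isSmallRel_inv_mul_mem.{w} c N hN
  obtain ⟨Q, q, hq, hQ⟩ := hρ.exists_epi_isLocalQuotient fun T =>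
    QuotientGroup.leftRel_eq (N T) ▸ (QuotientGroup.leftRel (N T)).iseqv
  let (T : C) : Group ((yoneda.obj X).obj (.op T)) := inferInstanceAs (Group (T ⟶ X))
  obtain ⟨_, hmul⟩ := hQ.exists_grpObj (fun T x y => hQ.sound hρ.res)
    (fun T T' f => MonObj.comp_one f) (fun T T' f => MonObj.comp_mul f)
    (fun T x x' y h => QuotientGroup.leftRel_apply.1 <| (QuotientGroup.con (N T)).mul
      (QuotientGroup.leftRel_apply.2 h) ((QuotientGroup.con (N T)).refl y))
    (fun T x y y' h => by rwa [mul_inv_rev, mul_assoc, inv_mul_cancel_left])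
    (fun T x => ⟨x⁻¹, by simpa only [inv_mul_cancel, inv_one, one_mul] using (N T).one_mem⟩)
  have hqm : IsMonHom q := isMonHom_of_map_mul q fun a b => hmul a b
  refine ⟨Q, _, q, hqm, hq, ?_, fun {T} z hz => ?_⟩
  · refine Eq.trans (hQ.sound hρ.res ?_).symm (MonObj.one_comp q)
    rw [inv_one, one_mul]
    exact hN.2 ⟨𝟙 S, Category.id_comp c⟩
  · rw [← MonObj.one_comp q] at hz
    refine ((hQ.eq_iff _ _).1 hz.symm).mono fun T' e h => ?_
    obtain ⟨p, hp⟩ := hN.1 h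
    exact ⟨p, by simpa using hp⟩

variable [BraidedCategory C] {R : C} [NonUnitalRingObj R]

open NonUnitalRingObj

/-- The values of a homomorphism from the additive group of a ring object. -/
def IsAddToMulHom.range {c : R ⟶ X} (hc : IsAddToMulHom c) (T : C) : Subgroup (T ⟶ X) where
  carrier := {z | ∃ p : T ⟶ R, p ≫ c = z}
  mul_mem' := by
    rintro _ _ ⟨p, rfl⟩ ⟨q, rfl⟩
    exact ⟨p + q, hc p q⟩
  one_mem' := ⟨0, hc.map_zero⟩
  inv_mem' := by
    rintro _ ⟨p, rfl⟩
    exact ⟨-p, hc.map_neg p⟩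

theorem IsAddToMulHom.exists_quotient [InfinitaryPretopos.{w} C] {c : R ⟶ X}
    (hc : IsAddToMulHom c)
    (central : ∀ {T : C} (p : T ⟶ R) (z : T ⟶ X), (p ≫ c) * z = z * (p ≫ c)) :
    ∃ (Q : C) (_ : GrpObj Q) (q : X ⟶ Q), IsMonHom q ∧ Epi q ∧ c ≫ q = 1 ∧ ∀ {T : C} (z : T ⟶ X),
      z ≫ q = 1 → Locally.{w} T fun T' e => ∃ p : T' ⟶ R, p ≫ c = e ≫ z := by
  have (T : C) : (hc.range T).Normal := ⟨by
    rintro _ ⟨p, rfl⟩ z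
    exact ⟨p, by rw [← central, mul_inv_cancel_right]⟩⟩
  exact exists_grpObj_quotient c hc.range Iff.rfl

end Quotients

section ExtendedSteinbergGroup

variable {C : Type u} [Category.{v} C] [CartesianMonoidalCategory C]

lemma IsGeneratedBy.central [InfinitaryPretopos.{w} C] {I : Type} {R G T : C} [GrpObj G]
    {x : I → (R ⟶ G)} (hx : IsGeneratedBy.{w} x) (z : T ⟶ G)
    (h : ∀ ⦃T' : C⦄ (e : T' ⟶ T) (i : I) (p : T' ⟶ R),
      (e ≫ z) * (p ≫ x i) = (p ≫ x i) * (e ≫ z)) (g : T ⟶ G) : z * g = g * z := by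
  refine Locally.eq.{w} ((hx g).mono ?_)
  rintro T' e ⟨a, ha⟩
  rw [MonObj.comp_mul, MonObj.comp_mul, ← ha]
  clear ha
  induction a using FreeMonoid.inductionOn' with
  | one => rw [map_one, one_mul, mul_one]
  | of_mul a w ih =>
    obtain ⟨i, p⟩ := a
    rw [map_mul, Word.eval_of, ← mul_assoc, h, mul_assoc, ih, mul_assoc]

lemma isCentralExtension_id (G : C) [GrpObj G] : IsCentralExtension (𝟙 G) :=
  ⟨inferInstance, inferInstance, fun z h hz => by
    rw [Category.comp_id] at hz
    rw [hz, one_mul, mul_one]⟩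

variable [BraidedCategory C] {R X G : C} [NonUnitalRingObj R] [GrpObj X]
  {y : Fin 4 → Fin 4 → Fin 4 → (R ⟶ X)} {c : R ⟶ X}

open NonUnitalRingObj

lemma exists_middle_index :
    ∃ m : Fin 4 → Fin 4 → Fin 4, (∀ i k, i ≠ m i k) ∧ ∀ i k, m i k ≠ k := by
  have : ∀ i k : Fin 4, ∃ j, i ≠ j ∧ j ≠ k := by decide
  choose m hm using this
  exact ⟨m, fun i k => (hm i k).1, fun i k => (hm i k).2⟩

namespace ExtendedSteinbergRelations

lemma eq_one (hy : ExtendedSteinbergRelations y c) {i j k : Fin 4}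
    (h : ¬(i ≠ j ∧ j ≠ k ∧ i ≠ k)) : y i j k = 1 := by
  rw [← Category.id_comp (y i j k), hy.trivial h]

lemma map {Y : C} [GrpObj Y] (hy : ExtendedSteinbergRelations y c) (f : X ⟶ Y) [IsMonHom f] :
    ExtendedSteinbergRelations (fun i j k => y i j k ≫ f) (c ≫ f) := by
  let z : ExtendedSteinbergRel.Gen → (R ⟶ X) := fun a => a.elim c fun t => y t.1 t.2.1 t.2.2
  have hz : SatisfiesRelations (ExtendedSteinbergRel.relation R) z := satisfiesRelations hy
  have map_add {b : R ⟶ X} (hb : IsAddToMulHom b) : IsAddToMulHom (b ≫ f) := fun p q => by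
    rw [← Category.assoc, hb, MonObj.mul_comp, Category.assoc, Category.assoc]
  refine SatisfiesRelations.extendedSteinbergRelations (y := fun a => z a ≫ f) ?_
    fun T a b hab => ?_
  · rintro (_ | ⟨i, j, k⟩)
    exacts [map_add hy.map_add_center, map_add (hy.map_add i j k)]
  · rw [← Word.eval_comp, ← Word.eval_comp, hz a b hab]

variable {Q : C} [GrpObj Q] {q : X ⟶ Q} [IsMonHom q]

lemma comp_eq_comp (hy : ExtendedSteinbergRelations y c) (hq : c ≫ q = 1) {i j j' k : Fin 4}
    (hij : i ≠ j) (hjk : j ≠ k) (hij' : i ≠ j') (hj'k : j' ≠ k) (hik : i ≠ k) :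
    y i j k ≫ q = y i j' k ≫ q := by
  by_cases h : j = j'
  · rw [h]
  · have hchange := congr($(hy.change ⟨hij, hik, hij', hjk, h, hj'k.symm⟩ (𝟙 R)) ≫ q)
    simpa only [MonObj.mul_comp, Category.assoc, Category.id_comp, hq, mul_one] using hchange

lemma steinbergRelations (hy : ExtendedSteinbergRelations y c) (hq : c ≫ q = 1) :
    ∃ z : Fin 4 → Fin 4 → (R ⟶ Q), SteinbergRelations (fun i j (_ : i ≠ j) => z i j) ∧
      ∀ {i j k : Fin 4}, i ≠ j → j ≠ k → i ≠ k → y i j k ≫ q = z i k := by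
  obtain ⟨m, him, hmk⟩ := exists_middle_index
  have hcq {T : C} (p : T ⟶ R) : (p ≫ c) ≫ q = 1 := by rw [Category.assoc, hq, MonObj.comp_one]
  have hyz {i j k : Fin 4} (hij : i ≠ j) (hjk : j ≠ k) (hik : i ≠ k) :
      y i j k ≫ q = y i (m i k) k ≫ q :=
    hy.comp_eq_comp hq hij hjk (him i k) (hmk i k) hik
  refine ⟨fun i k => y i (m i k) k ≫ q, ⟨fun i j hij {T} p p' => ?_,
    fun i j k hij hjk hik {T} p p' => ?_, fun i j k l hij hkl hjk hil {T} p p' => ?_⟩, hyz⟩ <;>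
    simp only [← Category.assoc]
  · rw [← MonObj.mul_comp, ← hy.map_add]
  · rw [← commutator_comp, hy.comm_mul _ _ hij hjk hik (him i j) (hmk i j) (him j k)
      (hmk j k), MonObj.mul_comp, hcq, mul_one, Category.assoc, Category.assoc, hyz hij hjk hik]
  · rw [← commutator_comp]
    by_cases h : i = k ∨ j = l
    · rw [hy.comm_one _ _ hij hkl hjk hil h (him i j) (hmk i j) (him k l) (hmk k l),
        MonObj.one_comp]
    · rw [not_or] at h
      rw [hy.comm_disjoint _ _ ⟨hij, h.1, hil, hjk, h.2, hkl⟩ (him i j) (hmk i j) (him k l)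
        (hmk k l), hcq]

end ExtendedSteinbergRelations

/-- The homomorphisms `y i j k` lift the root homomorphisms `x i k` along `d`, and they satisfy the
extended Steinberg relations together with the homomorphism `c` to the kernel of `d`. -/
structure IsExtendedSteinbergLift [GrpObj G] (x : Fin 4 → Fin 4 → (R ⟶ G)) (d : X ⟶ G)
    (y : Fin 4 → Fin 4 → Fin 4 → (R ⟶ X)) (c : R ⟶ X) : Prop where
  relations : ExtendedSteinbergRelations y c
  comp_eq : ∀ {i j k : Fin 4}, i ≠ j → j ≠ k → i ≠ k → y i j k ≫ d = x i k
  center_comp : c ≫ d = 1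

variable [GrpObj G] {x : Fin 4 → Fin 4 → (R ⟶ G)} [InfinitaryPretopos.{w} C] {E : Subobject R}

lemma IsDisjointRootPairing.exists_isExtendedSteinbergLift {d : X ⟶ G} {B : G ⊗ G ⟶ X}
    [IsMonHom d] (hE : IsWeakUnit R E) (H : IsSteinbergPairing x d B)
    (hc : IsDisjointRootPairing x B c) : ∃ y, IsExtendedSteinbergLift x d y c := by
  obtain ⟨y, hy⟩ := hc.exists_isAdjacentRootFamily.{w} hE H
  refine ⟨y, hy.extendedSteinbergRelations.{w} hE H hc, hy.comp_eq.{w} hE H hc, ?_⟩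
  rw [← Category.id_comp c, hc.comp_eq_one.{w} hE H]

lemma IsCentralExtension.exists_isExtendedSteinbergLift {d : X ⟶ G} (hd : IsCentralExtension d)
    (hE : IsWeakUnit R E) (hx : SteinbergRelations fun i j (_ : i ≠ j) => x i j) :
    ∃ (y : Fin 4 → Fin 4 → Fin 4 → (R ⟶ X)) (c : R ⟶ X), IsExtendedSteinbergLift x d y c := by
  have := hd.isHom
  obtain ⟨B, hB⟩ := hd.exists_pairing.{w}
  have H := hE.isSteinbergPairing.{w} hx hd hB
  obtain ⟨c, hc⟩ := H.exists_isDisjointRootPairing.{w} hE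
  obtain ⟨y, hy⟩ := hc.exists_isExtendedSteinbergLift.{w} hE H
  exact ⟨y, c, hy⟩

namespace IsExtendedSteinbergGroup

variable (hy : IsExtendedSteinbergGroup.{w} y c)
include hy

lemma hom_ext {H : C} [GrpObj H] {f g : X ⟶ H} [IsMonHom f] [IsMonHom g]
    (hyfg : ∀ {i j k : Fin 4}, i ≠ j → j ≠ k → i ≠ k → y i j k ≫ f = y i j k ≫ g)
    (hcfg : c ≫ f = c ≫ g) : f = g := by
  refine hy.isGeneratedBy.hom_ext ?_
  rintro (_ | ⟨i, j, k⟩)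
  · exact hcfg
  · by_cases h : i ≠ j ∧ j ≠ k ∧ i ≠ k
    · exact hyfg h.1 h.2.1 h.2.2
    · change y i j k ≫ f = y i j k ≫ g
      rw [hy.relations.eq_one h, MonObj.one_comp, MonObj.one_comp]

lemma center_mul_comm {T : C} (p : T ⟶ R) (z : T ⟶ X) : (p ≫ c) * z = z * (p ≫ c) := by
  refine hy.isGeneratedBy.central _ ?_ z
  rintro T' e (_ | ⟨i, j, k⟩) q
  · rw [← Category.assoc]
    exact hy.relations.central_self _ _
  · rw [← Category.assoc]
    exact hy.relations.central i j k _ _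

lemma exists_lift {Y : C} [GrpObj Y] {κ : X ⟶ G} [IsMonHom κ] {d : Y ⟶ G} [IsMonHom d]
    (hκ : IsExtendedSteinbergLift x κ y c) {y' : Fin 4 → Fin 4 → Fin 4 → (R ⟶ Y)} {c' : R ⟶ Y}
    (hd : IsExtendedSteinbergLift x d y' c') :
    ∃ f : X ⟶ Y, IsMonHom f ∧ f ≫ d = κ ∧ c ≫ f = c' := by
  obtain ⟨f, hf, hyf, hcf⟩ := hy.universal Y y' c' hd.relations
  refine ⟨f, hf, hy.hom_ext (fun hij hjk hik => ?_) ?_, hcf⟩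
  · rw [← Category.assoc, hyf, hd.comp_eq hij hjk hik, hκ.comp_eq hij hjk hik]
  · rw [← Category.assoc, hcf, hd.center_comp, hκ.center_comp]

lemma lift_unique {Y : C} [GrpObj Y] {d : Y ⟶ G} (hE : IsWeakUnit R E) (hd : IsCentralExtension d)
    {f g : X ⟶ Y} [IsMonHom f] [IsMonHom g] (hfg : f ≫ d = g ≫ d) : f = g := by
  have h := (hy.relations.map f).eq_of_commutators_eq.{w} hE (hy.relations.map g)
    fun {i j k l} m n _ _ _ _ _ _ {T} p q => hd.commutator_eq_of_comp_eq
      (by simp only [Category.assoc, hfg]) (by simp only [Category.assoc, hfg])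
  exact hy.hom_ext (fun {i j k} _ _ _ => congr($(h.1) i j k)) h.2

variable {κ : X ⟶ G} [IsMonHom κ] (hκ : IsExtendedSteinbergLift x κ y c)
  (hx : IsSteinbergGroup fun i j (_ : i ≠ j) => x i j)
include hκ hx

lemma locally_mem_image {T : C} (z : T ⟶ X) (hz : z ≫ κ = 1) :
    Locally.{w} T fun T' e => ∃ p : T' ⟶ R, p ≫ c = e ≫ z := by
  obtain ⟨Q, _, q, _, _, hq, hker⟩ :=
    IsAddToMulHom.exists_quotient.{w} hy.relations.map_add_center hy.center_mul_comm
  obtain ⟨w, hw, hyw⟩ := hy.relations.steinbergRelations hq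
  obtain ⟨s, ⟨_, hs⟩, -⟩ := hx.universal Q _ hw
  have hκs : κ ≫ s = q := by
    refine hy.hom_ext (fun hij hjk hik => ?_) ?_
    · rw [← Category.assoc, hκ.comp_eq hij hjk hik, hs _ _ hik, hyw hij hjk hik]
    · rw [← Category.assoc, hκ.center_comp, hq, MonObj.one_comp]
  exact hker z (by rw [← hκs, ← Category.assoc, hz, MonObj.one_comp])

lemma isCentralExtension : IsCentralExtension κ where
  isHom := inferInstance
  epi := by
    obtain ⟨m, him, hmk⟩ := exists_middle_index
    exact hx.isGeneratedBy.epi κ (fun a => y a.1.1 (m a.1.1 a.1.2) a.1.2) fun a =>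
      hκ.comp_eq (him _ _) (hmk _ _) a.2
  central z h hz := by
    refine Locally.eq.{w} ((hy.locally_mem_image hκ hx z hz).mono ?_)
    rintro T' e ⟨p, hp⟩
    rw [MonObj.comp_mul, MonObj.comp_mul, ← hp, hy.center_mul_comm]

theorem isUniversalCentralExtension (hE : IsWeakUnit R E) : IsUniversalCentralExtension κ where
  isCentralExtension := hy.isCentralExtension hκ hx
  universal Y _ d hd := by
    have := hd.isHom
    obtain ⟨y', c', hy'⟩ := hd.exists_isExtendedSteinbergLift.{w} hE hx.relations
    obtain ⟨f, hf, hfd, -⟩ := hy.exists_lift hκ hy'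
    exact ⟨f, ⟨hf, hfd⟩, fun g ⟨hg, hgd⟩ => hy.lift_unique hE hd (hgd.trans hfd.symm)⟩

end IsExtendedSteinbergGroup

lemma SteinbergRelations.exists_universal_isExtendedSteinbergLift (hE : IsWeakUnit R E)
    (hx : SteinbergRelations fun i j (_ : i ≠ j) => x i j) :
    ∃ (X : C) (_ : GrpObj X) (y : Fin 4 → Fin 4 → Fin 4 → (R ⟶ X)) (c : R ⟶ X) (κ : X ⟶ G),
      IsExtendedSteinbergGroup.{w} y c ∧ IsMonHom κ ∧ IsExtendedSteinbergLift x κ y c := by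
  obtain ⟨X, _, y, c, hy⟩ := exists_isExtendedSteinbergGroup.{w} R
  obtain ⟨y₀, c₀, h₀⟩ :=
    (isCentralExtension_id G).exists_isExtendedSteinbergLift.{w} hE hx
  obtain ⟨κ, hκ, hyκ, hcκ⟩ := hy.universal G y₀ c₀ h₀.relations
  refine ⟨X, _, y, c, κ, hy, hκ, hy.relations, fun {i j k} hij hjk hik => ?_, ?_⟩
  · rw [hyκ, ← h₀.comp_eq hij hjk hik, Category.comp_id]
  · rw [hcκ, ← h₀.center_comp, Category.comp_id]

variable (hE : IsWeakUnit R E) (hx : IsSteinbergGroup fun i j (_ : i ≠ j) => x i j)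
include hE hx

theorem IsSteinbergGroup.exists_isUniversalCentralExtension :
    ∃ (X : C) (_ : GrpObj X) (κ : X ⟶ G), IsUniversalCentralExtension κ := by
  obtain ⟨X, hX, y, c, κ, hy, hκ, h⟩ := hx.relations.exists_universal_isExtendedSteinbergLift.{w} hE
  exact ⟨X, hX, κ, hy.isUniversalCentralExtension h hx hE⟩

theorem IsUniversalCentralExtension.locally_mem_image {κ : X ⟶ G}
    (hκ : IsUniversalCentralExtension κ) (h : IsExtendedSteinbergLift x κ y c) {T : C}
    (z : T ⟶ X) (hz : z ≫ κ = 1) :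
    Locally.{w} T fun T' e => ∃ p : T' ⟶ R, p ≫ c = e ≫ z := by
  have := hκ.isCentralExtension.isHom
  obtain ⟨X', _, y', c', κ', hy', _, h'⟩ :=
    hx.relations.exists_universal_isExtendedSteinbergLift.{w} hE
  obtain ⟨f, _, hfκ, hcf⟩ := hy'.exists_lift h' h
  obtain ⟨g, ⟨_, hgκ⟩, -⟩ := hκ.universal X' κ' (hy'.isCentralExtension h' hx)
  have hgf : g ≫ f = 𝟙 X := (hκ.universal X κ hκ.isCentralExtension).unique
    ⟨inferInstance, by rw [Category.assoc, hfκ, hgκ]⟩ ⟨inferInstance, Category.id_comp κ⟩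
  refine (hy'.locally_mem_image h' hx (z ≫ g) (by rw [Category.assoc, hgκ, hz])).mono ?_
  rintro T' e ⟨p, hp⟩
  refine ⟨p, ?_⟩
  rw [← hcf, ← Category.assoc, hp, Category.assoc, Category.assoc, hgf, Category.comp_id]

end ExtendedSteinbergGroup

section SchurMultiplier

variable {C : Type u} [Category.{v} C] [CartesianMonoidalCategory C]

lemma kernelOf_arrow_comp [HasPullbacks C] {X G : C} [GrpObj X] [GrpObj G] (κ : X ⟶ G) :
    (kernelOf κ).arrow ≫ κ = 1 := by
  refine (Subobject.isPullback κ (Subobject.mk η[G])).w.symm.trans ?_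
  rw [← Subobject.underlyingIso_hom_comp_eq_mk η[G], ← Category.assoc,
    toUnit_unique (_ ≫ _) (toUnit _)]
  rfl

variable [InfinitaryPretopos.{w} C]

lemma imageSubobject_eq_kernelOf {R X G : C} [GrpObj X] [GrpObj G] {κ : X ⟶ G} {c : R ⟶ X}
    (hc : c ≫ κ = 1)
    (h : ∀ {T : C} (z : T ⟶ X), z ≫ κ = 1 →
      Locally.{w} T fun T' e => ∃ p : T' ⟶ R, p ≫ c = e ≫ z) :
    imageSubobject c = kernelOf κ := by
  refine le_antisymm ?_ ?_
  · have hκ := Subobject.isPullback κ (Subobject.mk η[G])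
    refine imageSubobject_le c (hκ.lift (toUnit R ≫ (Subobject.underlyingIso η[G]).inv) c ?_)
      (hκ.lift_snd _ _ _)
    rw [Category.assoc, Subobject.underlyingIso_arrow, hc]
    rfl
  · obtain ⟨g, hg⟩ := Locally.factors.{w} (f := (kernelOf κ).arrow) (imageSubobject c).arrow
      ((h _ (kernelOf_arrow_comp κ)).mono fun T' e ⟨p, hp⟩ => ⟨p ≫ factorThruImageSubobject c, by
        rw [Category.assoc, imageSubobject_arrow_comp, hp]⟩)
    exact Subobject.le_of_comm g hg

variable [BraidedCategory C] {R Q X : C} [NonUnitalRingObj R] [NonUnitalRingObj Q] [GrpObj X]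

open NonUnitalRingObj

lemma IsAddToMulHom.of_epi_comp {q : R ⟶ Q} [Epi q] (hq : IsNonUnitalRingHom q) {c : Q ⟶ X}
    (hqc : IsAddToMulHom (q ≫ c)) : IsAddToMulHom c := by
  intro T a b
  obtain ⟨T', e, r, s, _, hr, hs⟩ := exists_epi_lift₂.{w} q a b
  rw [← cancel_epi e, ← Category.assoc, comp_add, ← hr, ← hs, ← hq.map_add, Category.assoc, hqc,
    MonObj.comp_mul, ← Category.assoc e, ← Category.assoc e, ← hr, ← hs, Category.assoc,
    Category.assoc]

variable {G : C} [GrpObj G] {E : Subobject R} {x : Fin 4 → Fin 4 → (R ⟶ G)} {d : X ⟶ G}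
  {B : G ⊗ G ⟶ X} {c : R ⟶ X}

namespace IsDisjointRootPairing

variable (hc : IsDisjointRootPairing x B c) (hE : IsWeakUnit R E) (H : IsSteinbergPairing x d B)
include hc hE H

lemma comp_eq_of_ringCongruence {T : C} {a b : T ⟶ R} (h : RingCongruence.{w} TwoEpsRel a b) :
    a ≫ c = b ≫ c := by
  obtain ⟨U, _, φ, hφ_two, hφ_eq, hφ_idem⟩ := hc.exists_commRing_hom_idempotents.{w} H hE T
  refine hφ_eq _ _ (RingCongruence.map_eq φ ?_ h)
  rintro p _ ⟨rfl, k, r, s, rfl⟩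
  fin_cases k
  · simpa [twoEpsGenerator, two_mul] using hφ_two r
  · simp [twoEpsGenerator, _root_.mul_comm]
  · simpa [twoEpsGenerator] using hφ_idem r s

theorem exists_factor {π : R ⟶ Q} (hπ : IsTwoEpsQuotient π) :
    ∃ c₀ : Q ⟶ X, IsAddToMulHom c₀ ∧ π ≫ c₀ = c := by
  obtain ⟨Q', _, q, hq, _, hker⟩ := exists_isTwoEpsQuotient.{w} R
  obtain ⟨c', rfl⟩ := exists_desc_of_epi.{w} q c fun T p p' h =>
    Locally.eq.{w} ((hker p p' h).mono fun T' e h => by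
      rw [← Category.assoc, ← Category.assoc, hc.comp_eq_of_ringCongruence hE H h])
  have hc' : IsAddToMulHom c' :=
    IsAddToMulHom.of_epi_comp.{w} hq.isHom hc.isAddToMulHom
  obtain ⟨g, ⟨hg, rfl⟩, -⟩ := hπ.universal Q' q hq.isHom hq.kills
  refine ⟨g ≫ c', fun {T} a b => ?_, (Category.assoc _ _ _).symm⟩
  rw [← Category.assoc, hg.map_add, hc', Category.assoc, Category.assoc]

end IsDisjointRootPairing

end SchurMultiplier

theorem mainTheorem5 {C : Type u} [Category.{v} C] [CartesianMonoidalCategory C]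
    [BraidedCategory C] [InfinitaryPretopos.{w} C] (R : C) [NonUnitalRingObj R]
    (hR : IsWeaklyUnital R) :
    -- the group object `St(A₃, R)` exists
    (∃ (St : C) (_ : GrpObj St) (x : ∀ i j : Fin 4, i ≠ j → (R ⟶ St)), IsSteinbergGroup x) ∧
    -- the factor-ring `R_{2ε}` exists
    (∃ (Q : C) (_ : NonUnitalRingObj Q) (π : R ⟶ Q), IsTwoEpsQuotient π) ∧
    ∀ (St : C) [GrpObj St] (x : ∀ i j : Fin 4, i ≠ j → (R ⟶ St)), IsSteinbergGroup x →
      -- `St(A₃, R)` has a universal central extension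
      (∃ (H : C) (_ : GrpObj H) (κ : H ⟶ St), IsUniversalCentralExtension κ) ∧
      ∀ (H : C) [GrpObj H] (κ : H ⟶ St), IsUniversalCentralExtension κ →
        ∃ B : St ⊗ St ⟶ H, IsCommutatorPairing κ B ∧
          ∃ c : R ⟶ H,
            -- every `c_{ij|kl}` is well defined and equal to `c`
            (∀ (i j k l : Fin 4) (hij : i ≠ j) (hkl : k ≠ l),
              i ≠ k → i ≠ l → j ≠ k → j ≠ l →
                IsRootPairing x B i j k l hij hkl c ∧
                ∀ c' : R ⟶ H, IsRootPairing x B i j k l hij hkl c' → c' = c) ∧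
            -- `c` factors through `R_{2ε}`
            (∀ (Q : C) [NonUnitalRingObj Q] (π : R ⟶ Q), IsTwoEpsQuotient π →
              ∃ c₀ : Q ⟶ H, IsAddToMulHom c₀ ∧ π ≫ c₀ = c) ∧
            -- the Schur multiplier is the image of `c`
            imageSubobject c = kernelOf κ := by
  obtain ⟨E, hE⟩ := hR
  refine ⟨?_, ?_, fun St _ x hx => ?_⟩
  · obtain ⟨St, hSt, x, hx, -⟩ := exists_isSteinbergGroup.{w} R 4
    exact ⟨St, hSt, x, hx⟩
  · obtain ⟨Q, hQ, π, hπ, -⟩ := exists_isTwoEpsQuotient.{w} R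
    exact ⟨Q, hQ, π, hπ⟩
  obtain ⟨x, rfl⟩ : ∃ x' : Fin 4 → Fin 4 → (R ⟶ St), x = fun i j _ => x' i j :=
    ⟨fun i j => if hij : i ≠ j then x i j hij else 1, by
      funext i j hij
      exact (dif_pos hij).symm⟩
  refine ⟨hx.exists_isUniversalCentralExtension.{w} hE, fun H _ κ hκ => ?_⟩
  have := hκ.isCentralExtension.isHom
  obtain ⟨B, hB⟩ := hκ.isCentralExtension.exists_pairing.{w}
  have hxB := hE.isSteinbergPairing.{w} hx.relations hκ.isCentralExtension hB
  obtain ⟨c, hc⟩ := hxB.exists_isDisjointRootPairing.{w} hE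
  obtain ⟨y, hy⟩ := hc.exists_isExtendedSteinbergLift.{w} hE hxB
  refine ⟨B, hB, c, fun i j k l hij hkl hik hil hjk hjl => ?_,
    fun Q _ π hπ => hc.exists_factor.{w} hE hxB hπ, ?_⟩
  · have hd : Distinct i j k l := ⟨hij, hik, hil, hjk, hjl, hkl⟩
    refine ⟨⟨hc.isAddToMulHom, fun p q => hc.pairing hd p q⟩, fun c' hc' => ?_⟩
    exact hE.hom_ext_mul.{w} fun p q => by rw [← hc'.pairing, hc.pairing hd]
  · exact imageSubobject_eq_kernelOf.{w} hy.center_comp fun z hz =>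
      hκ.locally_mem_image.{w} hE hx hy z hz
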